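/- Let $k$ be an algebraically closed field of characteristic zero and $G$ a finite group. Let $(X,\rhd)$ be a rack, i.e. a nonempty set with an operation such that every $\phi_i=i\rhd(\cdot)$ is bijective and $i\rhd(j\rhd l)=(i\rhd j)\rhd(i\rhd l)$. Let $q:X\times X\to k^\times$ be a rack 2-cocycle, i.e. $q_{i,j\rhd l}\,q_{j,l}=q_{i\rhd j,i\rhd l}\,q_{i,l}$. Let $(\cdot,g,\{\chi_i\}_{i\in X})$ be a faithful principal YD-realization of $(X,q)$ over $G$: an action of $G$ on $X$, an injective map $i\mapsto g_i$ from $X$ to $G$ with $g_{h\cdot i}=hg_ih^{-1}$ and $g_i\cdot j=i\rhd j$, and maps $\chi_i:G\to k^\times$ with $\chi_i(ht)=\chi_{t\cdot i}(h)\chi_i(t)$ and $\chi_i(g_j)=q_{ji}$ (in particular $X$ is finite). Let $X^*=(X,\rhd^{-1})$ with $i\rhd^{-1}j=\phi_i^{-1}(j)$ be the dual rack, and let $q^{-*}_{i,j}=(q_{i,\,i\rhd^{-1}j})^{-1}$; then $(\cdot,g^{-1},\{\chi_i\})$, where $g^{-1}$ denotes $i\mapsto g_i^{-1}$, is a principal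 YD-realization of $(X^*,q^{-*})$ over $G$. Let $V(X,q)$ be the Yetter–Drinfeld module over $kG$ with basis $(x_i)_{i\in X}$, action $t\cdot x_i=\chi_i(t)x_{t\cdot i}$ and coaction $x_i\mapsto g_i\otimes x_i$. Let $W(q,X)$ be the Yetter–Drinfeld module over the function algebra $k^G$ with basis $(x_i)_{i\in X}$, action $\delta_t\cdot x_i=\delta_{t,g_i^{-1}}x_i$ and coaction $x_i\mapsto\sum_{t\in G}\chi_i(t^{-1})\,\delta_t\otimes x_{t^{-1}\cdot i}$. Let $\mathcal B(X,q)$ and $\mathcal B(q,X)$ be their Nichols algebras (the quotient of the braided Hopf algebra $T(V)$ by its largest Hopf ideal generated by homogeneous elements of degree at least $2$), and let $\mathcal B(X^*,q^{-*})$ and $\mathcal B(q^{-*},X^*)$ be those obtained in the same way from $(X^*,q^{-*})$ and $(\cdot,g^{-1},\{\chi_i\})$. A lifting of a Nichols algebra $\mathcal B(V)$ over a Hopf algebra $H$ is a Hopf algebra $A$ (of any dimension) whose associated graded Hopf algebra $\operatorname{gr}A$ with respect to the coradical filtration is isomorphic, as a Hopf algebra, to the bosonization $\mathcal B(V)\#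 H$. For a Hopf algebra $A$, let $A^{\mathrm{cop}}$ (resp. $A^{\mathrm{op}}$) be the bialgebra with the same underlying space and the opposite comultiplication (resp. multiplication). Then: 1. $A\mapsto A^{\mathrm{cop}}$ is a bijection from the class of liftings of $\mathcal B(X,q)$ over $kG$ onto the class of liftings of $\mathcal B(X^*,q^{-*})$ over $kG$. 2. $A\mapsto A^{\mathrm{op}}$ is a bijection from the class of liftings of $\mathcal B(q,X)$ over $k^G$ onto the class of liftings of $\mathcal B(q^{-*},X^*)$ over $k^G$. In particular, $A^{\mathrm{cop}}$ (resp. $A^{\mathrm{op}}$) is again a Hopf algebra for these $A$. Moreover, for all bialgebras $A,B$ one has $A\cong B\iff A^{\mathrm{cop}}\cong B^{\mathrm{cop}}\iff A^{\mathrm{op}}\cong B^{\mathrm{op}}$, so both maps also induce bijections on isomorphism classes. -/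

import Mathlib

universe v u w x

open TensorProduct

noncomputable section

namespace HopfLift

/-! ### Racks, cocycles and principal Yetter-Drinfeld realizations -/

section Racks

open scoped Quandles

/-- A rack 2-cocycle `q : X × X → kˣ`. -/
def IsRackCocycle {k X : Type*} [Field k] [Rack X] (q : X → X → kˣ) : Prop :=
  ∀ i j l : X, q i (j ◃ l) * q j l = q (i ◃ j) (i ◃ l) * q i l

/-- The cocycle `q*` on the dual rack. The dual rack `X* = (X, ▷⁻¹)` is Mathlib's opposite rack,
carried by the copy `Xᵐᵒᵖ` of the set `X`. -/
def starCocycle {k X : Type*} [Field k] [Rack X] (q : X → X → kˣ) : Xᵐᵒᵖ → Xᵐᵒᵖ → kˣ :=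
  fun i j => q i.unop (i ◃ j).unop

/-- The cocycle `q^{-*} = (q*)⁻¹` on the dual rack. -/
def invStarCocycle {k X : Type*} [Field k] [Rack X] (q : X → X → kˣ) : Xᵐᵒᵖ → Xᵐᵒᵖ → kˣ :=
  fun i j => (starCocycle q i j)⁻¹

/-- A principal YD-realization of `(X, q)` over the group `G`. -/
structure Realization {k X : Type*} [Field k] [Rack X] (q : X → X → kˣ)
    (G : Type*) [Group G] where
  /-- the action of `G` on `X` -/
  act : G →* Equiv.Perm X
  /-- the function `i ↦ g_i` -/
  g : X → G
  /-- the maps `χ_i` -/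
  χ : X → G → kˣ
  g_act : ∀ (h : G) (i : X), g (act h i) = h * g i * h⁻¹
  act_g : ∀ i j : X, act (g i) j = i ◃ j
  χ_mul : ∀ (i : X) (h t : G), χ i (h * t) = χ (act t i) h * χ i t
  χ_g : ∀ i j : X, χ i (g j) = q j i

namespace Realization

variable {k X G : Type*} [Field k] [Rack X] [Group G] {q : X → X → kˣ} (R : Realization q G)

/-- A realization is faithful if `i ↦ g_i` is injective. -/
def IsFaithful : Prop := Function.Injective R.g

theorem χ_one (i : X) : R.χ i 1 = 1 := by
  have h := R.χ_mul i 1 1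
  simpa using h

theorem act_g_inv (i j : X) : R.act (R.g i)⁻¹ j = i ◃⁻¹ j := by
  rw [map_inv, Equiv.Perm.inv_eq_iff_eq, R.act_g, Rack.right_inv]

/-- The realization `(·, g⁻¹, χ)` of `(X*, q^{-*})`. -/
def dual : Realization (invStarCocycle q) G where
  act :=
    { toFun := fun h => MulOpposite.opEquiv.symm.trans ((R.act h).trans MulOpposite.opEquiv)
      map_one' := by ext; simp
      map_mul' := by intros; ext; simp }
  g := fun i => (R.g i.unop)⁻¹
  χ := fun i => R.χ i.unop
  g_act := by intro h i; simp [R.g_act, mul_assoc]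
  act_g := by
    intro i j
    apply MulOpposite.unop_injective
    exact R.act_g_inv i.unop j.unop
  χ_mul := by intro i h t; exact R.χ_mul i.unop h t
  χ_g := by
    intro i j
    have h := R.χ_mul i.unop (R.g j.unop) (R.g j.unop)⁻¹
    rw [mul_inv_cancel, R.χ_one, R.act_g_inv, R.χ_g] at h
    exact (eq_inv_of_mul_eq_one_right h.symm)

end Realization

end Racks

/-! ### The function algebra `k^G` of a finite group -/

/-- The algebra `k^G` of functions on `G` (with pointwise operations). -/
def FunAlg (k G : Type*) : Type _ := G → k

namespace FunAlg

variable {k G : Type*} [Field k]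

instance : CommRing (FunAlg k G) := inferInstanceAs (CommRing (G → k))

instance : Algebra k (FunAlg k G) := inferInstanceAs (Algebra k (G → k))

/-- Evaluation at `x`, an algebra map `k^G → k`. -/
def eval (x : G) : FunAlg k G →ₐ[k] k := Pi.evalAlgHom k (fun _ : G => k) x

@[ext]
theorem ext {f f' : FunAlg k G} (h : ∀ x, eval x f = eval x f') : f = f' := funext h

/-- The function on `G` with the given values. -/
def mk : (G → k) →ₗ[k] FunAlg k G := LinearMap.id

@[simp]
theorem eval_mk (x : G) (f : G → k) : eval x (mk f) = f x := rfl

/-- Evaluation at `x` of the first tensor factor. -/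
def slice (M : Type*) [AddCommGroup M] [Module k M] (x : G) : FunAlg k G ⊗[k] M →ₗ[k] M :=
  (TensorProduct.lid k M).toLinearMap ∘ₗ (eval x).toLinearMap.rTensor M

@[simp]
theorem slice_tmul {M : Type*} [AddCommGroup M] [Module k M] (x : G) (f : FunAlg k G) (m : M) :
    slice M x (f ⊗ₜ m) = eval x f • m := by
  simp [slice]

theorem slice_mul {M : Type*} [Ring M] [Algebra k M] (x : G) (s t : FunAlg k G ⊗[k] M) :
    slice M x (s * t) = slice M x s * slice M x t := by
  induction s with
  | zero => simp
  | add a b ha hb => simp [add_mul, ha, hb]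
  | tmul f m =>
    induction t with
    | zero => simp
    | add a b ha hb => simp [mul_add, ha, hb]
    | tmul f' m' => simp [mul_smul, smul_comm (eval x f')]

/-- The basis element `δ_g` of `k^G`. -/
def δ [DecidableEq G] (g : G) : FunAlg k G := mk (Pi.single g 1)

@[simp]
theorem eval_δ [DecidableEq G] (x g : G) :
    eval x (δ g : FunAlg k G) = if x = g then 1 else 0 := by
  simp [δ, Pi.single_apply]

theorem sum_eval [Fintype G] [DecidableEq G] (f : FunAlg k G) : ∑ g, eval g f • δ g = f := by
  ext x; simp

theorem slice_ext [Fintype G] {M : Type*} [AddCommGroup M] [Module k M]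
    {s t : FunAlg k G ⊗[k] M} (h : ∀ x, slice M x s = slice M x t) : s = t := by
  classical
  have key : ∀ u : FunAlg k G ⊗[k] M, u = ∑ x, δ x ⊗ₜ[k] slice M x u := by
    intro u
    induction u with
    | zero => simp
    | add a b ha hb => simp only [map_add, tmul_add, Finset.sum_add_distrib, ← ha, ← hb]
    | tmul f m =>
      conv_lhs => rw [← sum_eval f]
      simp [sum_tmul, smul_tmul]
  rw [key s, key t]
  simp [h]

variable [Fintype G] [DecidableEq G] [Group G]

/-- The comultiplication of `k^G`, dual to the product of `G`: the tensor
`∑ f(ab) δ_a ⊗ δ_b` corresponds to the function `(a, b) ↦ f(ab)` on `G × G`. -/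
def comulLin : FunAlg k G →ₗ[k] FunAlg k G ⊗[k] FunAlg k G :=
  ∑ a : G, ∑ b : G, (eval (a * b)).toLinearMap.smulRight (δ a ⊗ₜ[k] δ b)

theorem comulLin_apply (f : FunAlg k G) :
    comulLin f = ∑ a : G, ∑ b : G, eval (a * b) f • (δ a ⊗ₜ[k] δ b) := by
  simp [comulLin]

@[simp]
theorem eval_slice_comulLin (a b : G) (f : FunAlg k G) :
    eval b (slice _ a (comulLin f)) = eval (a * b) f := by
  simp [comulLin_apply]

instance : Coalgebra k (FunAlg k G) where
  comul := comulLin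
  counit := (eval 1).toLinearMap
  coassoc := by
    apply LinearMap.ext
    intro f
    have h1 : ∀ (a b : G) (u : FunAlg k G ⊗[k] FunAlg k G),
        slice _ b (slice _ a (TensorProduct.assoc k _ _ _ (comulLin.rTensor _ u))) =
          slice _ (a * b) u := by
      intro a b u
      induction u with
      | zero => simp
      | add x y hx hy => simp [hx, hy]
      | tmul x y => simp [comulLin_apply, sum_tmul, smul_tmul']
    have h2 : ∀ (a : G) (u : FunAlg k G ⊗[k] FunAlg k G),
        slice _ a (comulLin.lTensor _ u) = comulLin (slice _ a u) := by
      intro a u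
      induction u with
      | zero => simp
      | add x y hx hy => simp [hx, hy]
      | tmul x y => simp
    refine slice_ext fun a => slice_ext fun b => ?_
    ext c
    simp [h1, h2, mul_assoc]
  rTensor_counit_comp_comul := by
    apply LinearMap.ext
    intro f
    apply (TensorProduct.lid k (FunAlg k G)).injective
    change slice _ 1 (comulLin f) = _
    ext b
    simp
  lTensor_counit_comp_comul := by
    apply LinearMap.ext
    intro f
    refine slice_ext fun a => ?_
    have h2 : ∀ (u : FunAlg k G ⊗[k] FunAlg k G),
        slice _ a ((eval (1 : G)).toLinearMap.lTensor _ u) = eval 1 (slice _ a u) := by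
      intro u
      induction u with
      | zero => simp
      | add x y hx hy => simp [hx, hy]
      | tmul x y => simp
    simp [h2]

theorem comul_eq (f : FunAlg k G) :
    Coalgebra.comul (R := k) f = ∑ a : G, ∑ b : G, eval (a * b) f • (δ a ⊗ₜ[k] δ b) :=
  comulLin_apply f

@[simp]
theorem eval_slice_comul (a b : G) (f : FunAlg k G) :
    eval b (slice _ a (Coalgebra.comul (R := k) f)) = eval (a * b) f :=
  eval_slice_comulLin a b f

@[simp]
theorem counit_eq (f : FunAlg k G) : Coalgebra.counit (R := k) f = eval 1 f := rfl

instance : Bialgebra k (FunAlg k G) :=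
  Bialgebra.mk' k (FunAlg k G) (by simp) (by simp)
    (by
      refine slice_ext fun a => ?_
      ext b
      rw [eval_slice_comul, Algebra.TensorProduct.one_def, slice_tmul]
      simp)
    (by
      intro f f'
      refine slice_ext fun a => ?_
      ext b
      simp [slice_mul])

/-- The antipode of `k^G`: `(S f)(x) = f(x⁻¹)`. -/
instance : HopfAlgebra k (FunAlg k G) where
  antipode := mk ∘ₗ LinearMap.pi fun x => (eval x⁻¹).toLinearMap
  mul_antipode_rTensor_comul := by
    ext f x
    simp [comul_eq, Algebra.algebraMap_eq_smul_one]
  mul_antipode_lTensor_comul := by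
    ext f x
    simp [comul_eq, Algebra.algebraMap_eq_smul_one]

end FunAlg

/-! ### Yetter-Drinfeld modules -/

section Flips

variable {k H M : Type*} [Field k] [Ring H] [Bialgebra k H] [AddCommGroup M] [Module k M]

/-- For maps `f : B ⊗ C → B' ⊗ C'`, the map `id ⊗ f ⊗ id` on `(A ⊗ B) ⊗ (C ⊗ D)`. -/
def applyMiddle {A B C D B' C' : Type*}
    [AddCommGroup A] [Module k A] [AddCommGroup B] [Module k B] [AddCommGroup C] [Module k C]
    [AddCommGroup D] [Module k D] [AddCommGroup B'] [Module k B'] [AddCommGroup C'] [Module k C']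
    (f : B ⊗[k] C →ₗ[k] B' ⊗[k] C') :
    (A ⊗[k] B) ⊗[k] (C ⊗[k] D) →ₗ[k] (A ⊗[k] B') ⊗[k] (C' ⊗[k] D) :=
  (TensorProduct.assoc k A B' (C' ⊗[k] D)).symm.toLinearMap ∘ₗ
    (((TensorProduct.assoc k B' C' D).toLinearMap ∘ₗ f.rTensor D ∘ₗ
      (TensorProduct.assoc k B C D).symm.toLinearMap).lTensor A) ∘ₗ
    (TensorProduct.assoc k A B (C ⊗[k] D)).toLinearMap

/-- For an action `h · m`, the map `H ⊗ M → M ⊗ H`, `h ⊗ m ↦ h₁ · m ⊗ h₂`. -/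
def actFlip (act : H →ₗ[k] M →ₗ[k] M) : H ⊗[k] M →ₗ[k] M ⊗[k] H :=
  (TensorProduct.lift act).rTensor H ∘ₗ
    (TensorProduct.assoc k H M H).symm.toLinearMap ∘ₗ
    (TensorProduct.comm k H M).toLinearMap.lTensor H ∘ₗ
    (TensorProduct.assoc k H H M).toLinearMap ∘ₗ
    (Coalgebra.comul (R := k) (A := H)).rTensor M

/-- For a coaction `m ↦ m₋₁ ⊗ m₀`, the map `M ⊗ H → H ⊗ M`, `m ⊗ h ↦ m₋₁ h ⊗ m₀`. -/
def coactFlip (coact : M →ₗ[k] H ⊗[k] M) : M ⊗[k] H →ₗ[k] H ⊗[k] M :=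
  (LinearMap.mul' k H).rTensor M ∘ₗ
    (TensorProduct.assoc k H H M).symm.toLinearMap ∘ₗ
    (TensorProduct.comm k M H).toLinearMap.lTensor H ∘ₗ
    (TensorProduct.assoc k H M H).toLinearMap ∘ₗ
    coact.rTensor H

theorem actFlip_tmul (act : H →ₗ[k] M →ₗ[k] M) (h : H) (m : M) :
    actFlip act (h ⊗ₜ m) = (act.flip m).rTensor H (Coalgebra.comul (R := k) h) := by
  simp only [actFlip, LinearMap.comp_apply, LinearMap.rTensor_tmul, LinearEquiv.coe_coe]
  generalize Coalgebra.comul (R := k) h = t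
  induction t with
  | zero => simp
  | add x y hx hy => simp only [map_add, add_tmul, hx, hy]
  | tmul a b => simp

theorem coactFlip_tmul (coact : M →ₗ[k] H ⊗[k] M) (m : M) (h : H) :
    coactFlip coact (m ⊗ₜ h) = (LinearMap.mulRight k h).rTensor M (coact m) := by
  simp only [coactFlip, LinearMap.comp_apply, LinearMap.rTensor_tmul, LinearEquiv.coe_coe]
  generalize coact m = t
  induction t with
  | zero => simp
  | add x y hx hy => simp only [map_add, add_tmul, hx, hy]
  | tmul a b => simp

end Flips

/-- A (left-left) Yetter-Drinfeld module structure over the Hopf algebra `H` on the vector space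
`M`: a left action and a left coaction such that
`h₁ m₋₁ ⊗ h₂ · m₀ = (h₁ · m)₋₁ h₂ ⊗ (h₁ · m)₀`, an equality of maps `H ⊗ M → H ⊗ M`. -/
structure YDModule (k H M : Type*) [Field k] [Ring H] [HopfAlgebra k H]
    [AddCommGroup M] [Module k M] where
  /-- the action -/
  act : H →ₐ[k] Module.End k M
  /-- the coaction -/
  coact : M →ₗ[k] H ⊗[k] M
  coassoc : (TensorProduct.assoc k H H M).toLinearMap ∘ₗ
      (Coalgebra.comul (R := k) (A := H)).rTensor M ∘ₗ coact = coact.lTensor H ∘ₗ coact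
  counit_coact : (TensorProduct.lid k M).toLinearMap ∘ₗ
      (Coalgebra.counit (R := k) (A := H)).rTensor M ∘ₗ coact = LinearMap.id
  compat : TensorProduct.map (LinearMap.mul' k H) (TensorProduct.lift act.toLinearMap) ∘ₗ
      (TensorProduct.tensorTensorTensorComm k H H H M).toLinearMap ∘ₗ
      TensorProduct.map (Coalgebra.comul (R := k)) coact =
    coactFlip coact ∘ₗ actFlip act.toLinearMap

namespace YDModule

variable {k H M : Type*} [Field k] [Ring H] [HopfAlgebra k H] [AddCommGroup M] [Module k M]
  (V : YDModule k H M)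

/-! ### The braided Hopf algebra `T(V)` -/

/-- The action of `H` on `T(V)` making it an `H`-module algebra. It is built as the algebra map
from `T(V)` to the convolution algebra `Hom(H, T(V))` that sends `v` to `h ↦ h · v`; so
`h · 1 = ε(h) 1` and `h · (x y) = (h₁ · x) (h₂ · y)`. -/
def tensorActHom : TensorAlgebra k M →ₐ[k] WithConv (H →ₗ[k] TensorAlgebra k M) :=
  TensorAlgebra.lift k
    ((WithConv.linearEquiv k (H →ₗ[k] TensorAlgebra k M)).symm.toLinearMap ∘ₗ
      (V.act.toLinearMap.compr₂ (TensorAlgebra.ι k)).flip)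

/-- The action of `H` on `T(V)`, as a bilinear map. -/
def tensorAct : H →ₗ[k] TensorAlgebra k M →ₗ[k] TensorAlgebra k M :=
  ((WithConv.linearEquiv k (H →ₗ[k] TensorAlgebra k M)).toLinearMap ∘ₗ
    V.tensorActHom.toLinearMap).flip

/-- The coaction of `H` on `T(V)`, an algebra map extending the coaction on `V`. -/
def tensorCoact : TensorAlgebra k M →ₐ[k] H ⊗[k] TensorAlgebra k M :=
  TensorAlgebra.lift k ((TensorAlgebra.ι k).lTensor H ∘ₗ V.coact)

/-- Left multiplication by `v ⊗ 1 + 1 ⊗ v` in the braided tensor product algebra `T(V) ⊗ T(V)`,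
whose product is `(m ⊗ m) (id ⊗ c ⊗ id)` with `c(x ⊗ y) = x₋₁ · y ⊗ x₀`:
`a ⊗ b ↦ v a ⊗ b + v₋₁ · a ⊗ v₀ b`. -/
def braidedMulPrimitive : M →ₗ[k] Module.End k (TensorAlgebra k M ⊗[k] TensorAlgebra k M) :=
  LinearMap.rTensorHom (TensorAlgebra k M) ∘ₗ
      LinearMap.mul k (TensorAlgebra k M) ∘ₗ TensorAlgebra.ι k +
    TensorProduct.homTensorHomMap (RingHom.id k) (TensorAlgebra k M) (TensorAlgebra k M)
        (TensorAlgebra k M) (TensorAlgebra k M) ∘ₗ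
      TensorProduct.map V.tensorAct
        (LinearMap.mul k (TensorAlgebra k M) ∘ₗ TensorAlgebra.ι k) ∘ₗ
      V.coact

/-- The braided comultiplication of `T(V)`: the algebra map from `T(V)` to the braided tensor
product algebra `T(V) ⊗ T(V)` with `v ↦ v ⊗ 1 + 1 ⊗ v`, that is
`v₁ ⋯ vₙ ↦ (v₁ ⊗ 1 + 1 ⊗ v₁) ⋯ (vₙ ⊗ 1 + 1 ⊗ vₙ)`. -/
def tensorComul : TensorAlgebra k M →ₗ[k] TensorAlgebra k M ⊗[k] TensorAlgebra k M :=
  (TensorAlgebra.lift k V.braidedMulPrimitive).toLinearMap.flip (1 ⊗ₜ 1)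

/-! ### The Nichols algebra -/

/-- The two-sided ideals `I` of `T(V)` that are generated by homogeneous elements of degree at
least 2 and are Hopf ideals in the category of Yetter-Drinfeld modules: `I` is stable under the
action and the coaction of `H` and is a coideal. (`ε(I) = 0` follows from the first condition, and
stability under the antipode of `T(V)` is then automatic, since `T(V)/I` is graded and
connected.) -/
structure IsHopfIdeal (I : Ideal (TensorAlgebra k M)) : Prop where
  generated : ∃ S : Set (TensorAlgebra k M),
    (∀ s ∈ S, ∃ n : ℕ, 2 ≤ n ∧ s ∈ (LinearMap.range (TensorAlgebra.ι k (M := M))) ^ n) ∧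
      I = Ideal.span {x | ∃ a b, ∃ s ∈ S, x = a * s * b}
  act_mem : ∀ (h : H), ∀ x ∈ I, V.tensorAct h x ∈ I
  coact_mem : ∀ x ∈ I, V.tensorCoact x ∈
    LinearMap.range ((I.restrictScalars k).subtype.lTensor H)
  comul_mem : ∀ x ∈ I, V.tensorComul x ∈
    LinearMap.range ((I.restrictScalars k).subtype.rTensor (TensorAlgebra k M)) ⊔
      LinearMap.range ((I.restrictScalars k).subtype.lTensor (TensorAlgebra k M))

/-- The defining ideal `J(V)` of the Nichols algebra: the largest of these ideals (see
`nicholsIdeal_isHopfIdeal`). -/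
def nicholsIdeal : Ideal (TensorAlgebra k M) := sSup {I | V.IsHopfIdeal I}

theorem le_nicholsIdeal {I : Ideal (TensorAlgebra k M)} (h : V.IsHopfIdeal I) :
    I ≤ V.nicholsIdeal := le_sSup h

theorem nicholsIdeal_induction {p : TensorAlgebra k M → Prop} (zero : p 0)
    (add : ∀ x y, p x → p y → p (x + y)) (mem : ∀ I, V.IsHopfIdeal I → ∀ x ∈ I, p x)
    {x : TensorAlgebra k M} (hx : x ∈ V.nicholsIdeal) : p x := by
  rw [nicholsIdeal, sSup_eq_iSup'] at hx
  exact Submodule.iSup_induction _ (motive := p) hx (fun I x hx => mem I.1 I.2 x hx) zero add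

theorem nicholsIdeal_isHopfIdeal : V.IsHopfIdeal V.nicholsIdeal where
  generated := by
    refine ⟨{s | s ∈ V.nicholsIdeal ∧
      ∃ n : ℕ, 2 ≤ n ∧ s ∈ (LinearMap.range (TensorAlgebra.ι k (M := M))) ^ n},
      fun s hs => hs.2, le_antisymm ?_ ?_⟩
    · refine sSup_le ?_
      intro I hI
      obtain ⟨S, hS, hI'⟩ := hI.generated
      rw [hI']
      refine Ideal.span_mono ?_
      rintro x ⟨a, b, s, hs, rfl⟩
      refine ⟨a, b, s, ⟨V.le_nicholsIdeal hI ?_, hS s hs⟩, rfl⟩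
      rw [hI']
      exact Ideal.subset_span ⟨1, 1, s, hs, by simp⟩
    · rw [Ideal.span_le]
      rintro x ⟨a, b, s, ⟨hs, -⟩, rfl⟩
      have : s * b ∈ V.nicholsIdeal := by
        refine V.nicholsIdeal_induction (p := fun s => s * b ∈ V.nicholsIdeal) (by simp)
          (fun x y hx hy => by simpa [add_mul] using Ideal.add_mem _ hx hy) ?_ hs
        intro I hI x hx
        obtain ⟨S, hS, hI'⟩ := hI.generated
        refine V.le_nicholsIdeal hI ?_
        rw [hI'] at hx ⊢
        refine Submodule.span_induction (p := fun x _ => x * b ∈ _) ?_ (by simp) ?_ ?_ hx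
        · rintro _ ⟨a, c, s, hs, rfl⟩
          exact Ideal.subset_span ⟨a, c * b, s, hs, by simp [mul_assoc]⟩
        · intro x y _ _ hx hy
          simpa [add_mul] using Ideal.add_mem _ hx hy
        · intro a x _ hx
          simpa [mul_assoc] using Ideal.mul_mem_left _ a hx
      simpa [mul_assoc] using Ideal.mul_mem_left _ a this
  act_mem := by
    intro h x hx
    refine V.nicholsIdeal_induction (p := fun x => V.tensorAct h x ∈ V.nicholsIdeal) (by simp)
      (fun x y hx hy => by simpa using Ideal.add_mem _ hx hy) ?_ hx
    exact fun I hI x hx => V.le_nicholsIdeal hI (hI.act_mem h x hx)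
  coact_mem := by
    intro x hx
    refine V.nicholsIdeal_induction (p := fun x => V.tensorCoact x ∈
      LinearMap.range ((V.nicholsIdeal.restrictScalars k).subtype.lTensor H)) (by simp)
      (fun x y hx hy => by simpa using Submodule.add_mem _ hx hy) ?_ hx
    intro I hI x hx
    obtain ⟨t, ht⟩ := hI.coact_mem x hx
    refine ⟨(Submodule.inclusion (p := I.restrictScalars k)
      (p' := V.nicholsIdeal.restrictScalars k) (V.le_nicholsIdeal hI)).lTensor H t, ?_⟩
    rw [← ht, ← LinearMap.comp_apply, ← LinearMap.lTensor_comp]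
    rfl
  comul_mem := by
    intro x hx
    refine V.nicholsIdeal_induction (p := fun x => V.tensorComul x ∈
      LinearMap.range ((V.nicholsIdeal.restrictScalars k).subtype.rTensor (TensorAlgebra k M)) ⊔
      LinearMap.range ((V.nicholsIdeal.restrictScalars k).subtype.lTensor (TensorAlgebra k M)))
      (by simp) (fun x y hx hy => by simpa using Submodule.add_mem _ hx hy) ?_ hx
    intro I hI x hx
    refine SetLike.le_def.1 (sup_le_sup ?_ ?_) (hI.comul_mem x hx)
    · rintro _ ⟨t, rfl⟩
      refine ⟨(Submodule.inclusion (p := I.restrictScalars k)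
        (p' := V.nicholsIdeal.restrictScalars k) (V.le_nicholsIdeal hI)).rTensor _ t, ?_⟩
      rw [← LinearMap.comp_apply, ← LinearMap.rTensor_comp]
      rfl
    · rintro _ ⟨t, rfl⟩
      refine ⟨(Submodule.inclusion (p := I.restrictScalars k)
        (p' := V.nicholsIdeal.restrictScalars k) (V.le_nicholsIdeal hI)).lTensor _ t, ?_⟩
      rw [← LinearMap.comp_apply, ← LinearMap.lTensor_comp]
      rfl

instance : V.nicholsIdeal.IsTwoSided where
  mul_mem_of_left := by
    intro x b hx
    obtain ⟨S, hS, hI'⟩ := V.nicholsIdeal_isHopfIdeal.generated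
    rw [hI'] at hx ⊢
    refine Submodule.span_induction (p := fun x _ => x * b ∈ _) ?_ (by simp) ?_ ?_ hx
    · rintro _ ⟨a, c, s, hs, rfl⟩
      exact Ideal.subset_span ⟨a, c * b, s, hs, by simp [mul_assoc]⟩
    · intro x y _ _ hx hy
      simpa [add_mul] using Ideal.add_mem _ hx hy
    · intro a x _ hx
      simpa [mul_assoc] using Ideal.mul_mem_left _ a hx

/-- The Nichols algebra `B(V) = T(V)/J(V)`. -/
def Nichols : Type _ := TensorAlgebra k M ⧸ V.nicholsIdeal

instance : Ring V.Nichols := inferInstanceAs (Ring (TensorAlgebra k M ⧸ V.nicholsIdeal))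

instance : Algebra k V.Nichols :=
  inferInstanceAs (Algebra k (TensorAlgebra k M ⧸ V.nicholsIdeal))

/-- The projection `T(V) → B(V)`. -/
def proj : TensorAlgebra k M →ₐ[k] V.Nichols := Ideal.Quotient.mkₐ k V.nicholsIdeal

theorem proj_surjective : Function.Surjective V.proj := Ideal.Quotient.mk_surjective

theorem proj_eq_zero {x : TensorAlgebra k M} (hx : x ∈ V.nicholsIdeal) : V.proj x = 0 :=
  Ideal.Quotient.eq_zero_iff_mem.2 hx

/-- The linear map on `B(V)` induced by a linear map on `T(V)` that vanishes on `J(V)`. -/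
def descend {P : Type*} [AddCommGroup P] [Module k P] (f : TensorAlgebra k M →ₗ[k] P)
    (hf : ∀ x ∈ V.nicholsIdeal, f x = 0) : V.Nichols →ₗ[k] P :=
  (V.nicholsIdeal.restrictScalars k).liftQ f (fun x hx => hf x hx) ∘ₗ
    (Submodule.Quotient.restrictScalarsEquiv k V.nicholsIdeal).symm.toLinearMap

theorem descend_proj {P : Type*} [AddCommGroup P] [Module k P] (f : TensorAlgebra k M →ₗ[k] P)
    (hf : ∀ x ∈ V.nicholsIdeal, f x = 0) (x : TensorAlgebra k M) :
    V.descend f hf (V.proj x) = f x := rfl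

/-- The action of `H` on `B(V)`: `h · [x] = [h · x]`. -/
def nicholsAct : H →ₗ[k] V.Nichols →ₗ[k] V.Nichols :=
  (V.descend (V.tensorAct.flip.compr₂ V.proj.toLinearMap) (by
    intro x hx
    ext h
    exact V.proj_eq_zero (V.nicholsIdeal_isHopfIdeal.act_mem h x hx))).flip

/-- The coaction of `H` on `B(V)`: `[x] ↦ x₋₁ ⊗ [x₀]`. -/
def nicholsCoact : V.Nichols →ₗ[k] H ⊗[k] V.Nichols :=
  V.descend (V.proj.toLinearMap.lTensor H ∘ₗ V.tensorCoact.toLinearMap) (by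
    intro x hx
    obtain ⟨t, ht⟩ := V.nicholsIdeal_isHopfIdeal.coact_mem x hx
    simp only [LinearMap.comp_apply, AlgHom.toLinearMap_apply]
    rw [← ht, ← LinearMap.comp_apply, ← LinearMap.lTensor_comp]
    have : V.proj.toLinearMap ∘ₗ (V.nicholsIdeal.restrictScalars k).subtype = 0 := by
      ext y
      exact V.proj_eq_zero y.2
    simp [this])

/-- The counit of `B(V)`, induced by the augmentation of `T(V)`. -/
def nicholsCounit : V.Nichols →ₗ[k] k :=
  V.descend (TensorAlgebra.algebraMapInv (R := k) (M := M)).toLinearMap (by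
    intro x hx
    obtain ⟨S, hS, hI'⟩ := V.nicholsIdeal_isHopfIdeal.generated
    rw [hI'] at hx
    refine Submodule.span_induction
      (p := fun x _ => (TensorAlgebra.algebraMapInv (R := k) (M := M)).toLinearMap x = 0)
      ?_ (by simp) ?_ ?_ hx
    · rintro _ ⟨a, b, s, hs, rfl⟩
      obtain ⟨n, hn, hs⟩ := hS s hs
      have : ∀ y ∈ (LinearMap.range (TensorAlgebra.ι k (M := M))) ^ n,
          TensorAlgebra.algebraMapInv (R := k) (M := M) y = 0 := by
        obtain ⟨m, rfl⟩ : ∃ m, n = m + 1 := ⟨n - 1, by omega⟩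
        intro y hy
        rw [pow_succ] at hy
        refine Submodule.mul_induction_on hy ?_ ?_
        · rintro y _ z ⟨v, rfl⟩
          simp [TensorAlgebra.algebraMapInv]
        · intro y z hy hz
          simp [hy, hz]
      simp [this s hs]
    · intro x y _ _ hx hy
      simp [map_add, hx, hy]
    · intro a x _ hx
      simp only [AlgHom.toLinearMap_apply] at hx
      simp [hx])

/-- The braided comultiplication of `B(V)`. -/
def nicholsComul : V.Nichols →ₗ[k] V.Nichols ⊗[k] V.Nichols :=
  V.descend (TensorProduct.map V.proj.toLinearMap V.proj.toLinearMap ∘ₗ V.tensorComul) (by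
    intro x hx
    have : V.proj.toLinearMap ∘ₗ (V.nicholsIdeal.restrictScalars k).subtype = 0 := by
      ext y
      exact V.proj_eq_zero y.2
    have h : LinearMap.range
          ((V.nicholsIdeal.restrictScalars k).subtype.rTensor (TensorAlgebra k M)) ⊔
        LinearMap.range
          ((V.nicholsIdeal.restrictScalars k).subtype.lTensor (TensorAlgebra k M)) ≤
        LinearMap.ker (TensorProduct.map V.proj.toLinearMap V.proj.toLinearMap) := by
      refine sup_le ?_ ?_
      · rw [LinearMap.range_le_ker_iff, LinearMap.map_comp_rTensor, this,
          TensorProduct.map_zero_left]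
      · rw [LinearMap.range_le_ker_iff, LinearMap.map_comp_lTensor, this,
          TensorProduct.map_zero_right]
    exact h (V.nicholsIdeal_isHopfIdeal.comul_mem x hx))

end YDModule

/-! ### Bialgebra operations, isomorphisms and the bosonization `B(V) # H` -/

/-- The operations of a bialgebra on a vector space, listed without the axioms. It is used for
concrete operations only. -/
structure BialgOps (k E : Type*) [Field k] [AddCommGroup E] [Module k E] where
  /-- the unit element -/
  one : E
  /-- the product -/
  mul : E ⊗[k] E →ₗ[k] E
  /-- the counit -/
  counit : E →ₗ[k] k
  /-- the comultiplication -/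
  comul : E →ₗ[k] E ⊗[k] E

/-- A linear isomorphism that respects all the bialgebra operations. For Hopf algebras this is the
same as an isomorphism of Hopf algebras. -/
structure BialgOps.IsIso {k E E' : Type*} [Field k] [AddCommGroup E] [Module k E]
    [AddCommGroup E'] [Module k E'] (D : BialgOps k E) (D' : BialgOps k E')
    (φ : E ≃ₗ[k] E') : Prop where
  map_one : φ D.one = D'.one
  map_mul : φ.toLinearMap ∘ₗ D.mul =
    D'.mul ∘ₗ TensorProduct.map φ.toLinearMap φ.toLinearMap
  map_counit : D'.counit ∘ₗ φ.toLinearMap = D.counit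
  map_comul : TensorProduct.map φ.toLinearMap φ.toLinearMap ∘ₗ D.comul =
    D'.comul ∘ₗ φ.toLinearMap

/-- The Radford biproduct (bosonization) `B(V) # H` on `B(V) ⊗ H`:
`(r # h)(s # f) = r (h₁ · s) # h₂ f`,
`Δ(r # h) = (r⁽¹⁾ # (r⁽²⁾)₋₁ h₁) ⊗ ((r⁽²⁾)₀ # h₂)`, `ε(r # h) = ε(r) ε(h)`. -/
def YDModule.bosonization {k H M : Type*} [Field k] [Ring H] [HopfAlgebra k H]
    [AddCommGroup M] [Module k M] (V : YDModule k H M) : BialgOps k (V.Nichols ⊗[k] H) where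
  one := 1 ⊗ₜ 1
  mul := TensorProduct.map (LinearMap.mul' k V.Nichols) (LinearMap.mul' k H) ∘ₗ
    applyMiddle (actFlip V.nicholsAct)
  counit := (TensorProduct.lid k k).toLinearMap ∘ₗ
    TensorProduct.map V.nicholsCounit (Coalgebra.counit (R := k))
  comul := applyMiddle (coactFlip V.nicholsCoact) ∘ₗ
    TensorProduct.map V.nicholsComul (Coalgebra.comul (R := k))

/-! ### The coradical filtration and the associated graded Hopf algebra -/

section Coradical

variable (k A : Type*) [Field k] [AddCommGroup A] [Module k A] [Coalgebra k A]

variable {A} in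
/-- `C` is a subcoalgebra: `Δ(C) ⊆ C ⊗ C`. -/
def IsSubcoalgebra (C : Submodule k A) : Prop :=
  ∀ x ∈ C, Coalgebra.comul (R := k) x ∈ LinearMap.range (TensorProduct.mapIncl C C)

variable {A} in
/-- `C` is a simple subcoalgebra. -/
def IsSimpleSubcoalgebra (C : Submodule k A) : Prop :=
  IsSubcoalgebra k C ∧ C ≠ ⊥ ∧ ∀ D ≤ C, IsSubcoalgebra k D → D = ⊥ ∨ D = C

/-- The coradical: the sum of the simple subcoalgebras. -/
def coradical : Submodule k A := sSup {C | IsSimpleSubcoalgebra k C}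

/-- The coradical filtration: `A_[0]` is the coradical and
`A_[n+1] = Δ⁻¹(A ⊗ A_[n] + A_[0] ⊗ A)`. -/
def coradFil : ℕ → Submodule k A
  | 0 => coradical k A
  | n + 1 => (LinearMap.range (TensorProduct.mapIncl (⊤ : Submodule k A) (coradFil n)) ⊔
      LinearMap.range (TensorProduct.mapIncl (coradical k A) (⊤ : Submodule k A))).comap
        (Coalgebra.comul (R := k))

/-- `A_[n-1]`, with `A_[-1] = 0`. -/
def coradFilPrev : ℕ → Submodule k A
  | 0 => ⊥
  | n + 1 => coradFil k A n

/-- `gr A = ⨁ A_[n] / A_[n-1]`. -/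
abbrev Gr : Type _ :=
  DirectSum ℕ fun n => coradFil k A n ⧸ (coradFilPrev k A n).submoduleOf (coradFil k A n)

/-- The class in `gr A` of an element of `A_[n]`. -/
def symb (n : ℕ) : coradFil k A n →ₗ[k] Gr k A :=
  DirectSum.lof k ℕ
      (fun n => coradFil k A n ⧸ (coradFilPrev k A n).submoduleOf (coradFil k A n)) n ∘ₗ
    ((coradFilPrev k A n).submoduleOf (coradFil k A n)).mkQ

end Coradical

section Lifting

variable (k A : Type*) [Field k] [Ring A] [Bialgebra k A]

/-- The operations `D` on `gr A` are those induced by the operations of `A` along the coradical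
filtration. In particular the filtration is compatible with the operations of `A`:
`A_[m] A_[n] ⊆ A_[m+n]` and `Δ(A_[n]) ⊆ ∑ A_[i] ⊗ A_[n-i]`. There is at most one such `D`. -/
structure IsInducedOnGr (D : BialgOps k (Gr k A)) : Prop where
  one : ∃ h : (1 : A) ∈ coradFil k A 0, D.one = symb k A 0 ⟨1, h⟩
  mul : ∀ (m n : ℕ) (a : coradFil k A m) (b : coradFil k A n),
    ∃ h : (a * b : A) ∈ coradFil k A (m + n),
      D.mul (symb k A m a ⊗ₜ symb k A n b) = symb k A (m + n) ⟨a * b, h⟩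
  counit : ∀ (n : ℕ) (a : coradFil k A n),
    D.counit (symb k A n a) = if n = 0 then Coalgebra.counit (R := k) (a : A) else 0
  comul : ∀ (n : ℕ) (a : coradFil k A n),
    ∃ t : (p : ℕ × ℕ) → coradFil k A p.1 ⊗[k] coradFil k A p.2,
      Coalgebra.comul (R := k) (a : A) =
        ∑ p ∈ Finset.HasAntidiagonal.antidiagonal n,
          TensorProduct.mapIncl (coradFil k A p.1) (coradFil k A p.2) (t p) ∧
      D.comul (symb k A n a) =
        ∑ p ∈ Finset.HasAntidiagonal.antidiagonal n, TensorProduct.map (symb k A p.1) (symb k A p.2) (t p)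

/-- The bialgebra `A` is a Hopf algebra, that is, it has a (necessarily unique) antipode. -/
def IsHopf : Prop :=
  ∃ S : A →ₗ[k] A,
    LinearMap.mul' k A ∘ₗ S.rTensor A ∘ₗ Coalgebra.comul =
      Algebra.linearMap k A ∘ₗ Coalgebra.counit ∧
    LinearMap.mul' k A ∘ₗ S.lTensor A ∘ₗ Coalgebra.comul =
      Algebra.linearMap k A ∘ₗ Coalgebra.counit

end Lifting

/-- `A` is a lifting of `B(V)` over `H`: a Hopf algebra such that `gr A ≃ B(V) # H` as Hopf
algebras. -/
def IsLifting {k H M : Type*} [Field k] [Ring H] [HopfAlgebra k H]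
    [AddCommGroup M] [Module k M] (V : YDModule k H M)
    (A : Type*) [Ring A] [Bialgebra k A] : Prop :=
  IsHopf k A ∧ ∃ D : BialgOps k (Gr k A), IsInducedOnGr k A D ∧
    ∃ φ : Gr k A ≃ₗ[k] V.Nichols ⊗[k] H, D.IsIso V.bosonization φ

/-- The class of all liftings of `B(V)` over `H`. -/
def liftings {k : Type u} {H : Type w} {M : Type x} [Field k] [Ring H]
    [HopfAlgebra k H] [AddCommGroup M] [Module k M] (V : YDModule k H M) :
    Set (BialgCat.{v} k) :=
  {A | IsLifting V A}

/-! ### The bialgebras `A^cop` and `A^op` -/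

/-- The copy of `A` that carries the structure of `A^cop`. -/
def Cop (A : Type*) : Type _ := A

/-- The copy of `A` that carries the structure of `A^op`. -/
def Op (A : Type*) : Type _ := A

namespace Cop

variable {k A : Type*} [Field k] [Ring A]

instance : Ring (Cop A) := inferInstanceAs (Ring A)

instance [Algebra k A] : Algebra k (Cop A) := inferInstanceAs (Algebra k A)

variable (k A) in
/-- The identity map `A → A^cop`, an algebra isomorphism. -/
def equiv [Algebra k A] : A ≃ₐ[k] Cop A := (AlgEquiv.refl : A ≃ₐ[k] A)

variable [Bialgebra k A]

/-- The comultiplication of `A^cop`: `a ↦ a₂ ⊗ a₁`. -/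
instance : Coalgebra k (Cop A) where
  comul := TensorProduct.map (equiv k A).toLinearMap (equiv k A).toLinearMap ∘ₗ
    (TensorProduct.comm k A A).toLinearMap ∘ₗ Coalgebra.comul ∘ₗ (equiv k A).symm.toLinearMap
  counit := Coalgebra.counit ∘ₗ (equiv k A).symm.toLinearMap
  coassoc := by
    let e := (equiv k A).toLinearMap
    let r : A ⊗[k] (A ⊗[k] A) →ₗ[k] Cop A ⊗[k] (Cop A ⊗[k] Cop A) :=
      TensorProduct.map e (TensorProduct.map e e) ∘ₗ (TensorProduct.assoc k A A A).toLinearMap ∘ₗ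
        (TensorProduct.comm k A A).toLinearMap.rTensor A ∘ₗ
        (TensorProduct.comm k A (A ⊗[k] A)).toLinearMap
    apply LinearMap.ext
    intro x
    have h1 : ∀ t : A ⊗[k] A, TensorProduct.assoc k _ _ _
        ((TensorProduct.map e e ∘ₗ (TensorProduct.comm k A A).toLinearMap ∘ₗ
          Coalgebra.comul ∘ₗ (equiv k A).symm.toLinearMap).rTensor (Cop A)
          (TensorProduct.map e e (TensorProduct.comm k A A t))) =
        r (Coalgebra.comul.lTensor A t) := by
      intro t
      induction t with
      | zero => simp
      | add x y hx hy => simp only [map_add, hx, hy]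
      | tmul a b =>
        simp only [comm_tmul, map_tmul, LinearMap.rTensor_tmul, LinearMap.lTensor_tmul, e, r,
          LinearMap.comp_apply, AlgEquiv.toLinearMap_apply, AlgEquiv.symm_apply_apply,
          LinearEquiv.coe_coe]
        generalize Coalgebra.comul (R := k) b = u
        induction u with
        | zero => simp
        | add x y hx hy => simp only [map_add, add_tmul, hx, hy]
        | tmul c d => simp
    have h2 : ∀ t : A ⊗[k] A,
        ((TensorProduct.map e e ∘ₗ (TensorProduct.comm k A A).toLinearMap ∘ₗ
          Coalgebra.comul ∘ₗ (equiv k A).symm.toLinearMap).lTensor (Cop A)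
          (TensorProduct.map e e (TensorProduct.comm k A A t))) =
        r (TensorProduct.assoc k A A A (Coalgebra.comul.rTensor A t)) := by
      intro t
      induction t with
      | zero => simp
      | add x y hx hy => simp only [map_add, hx, hy]
      | tmul a b =>
        simp only [comm_tmul, map_tmul, LinearMap.rTensor_tmul, LinearMap.lTensor_tmul, e, r,
          LinearMap.comp_apply, AlgEquiv.toLinearMap_apply, AlgEquiv.symm_apply_apply,
          LinearEquiv.coe_coe]
        generalize Coalgebra.comul (R := k) a = u
        induction u with
        | zero => simp
        | add x y hx hy => simp only [map_add, add_tmul, tmul_add, hx, hy]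
        | tmul c d => simp
    refine (h1 _).trans (Eq.trans ?_ (h2 _).symm)
    change r (Coalgebra.comul.lTensor A (Coalgebra.comul ((equiv k A).symm x))) = _
    rw [← Coalgebra.coassoc_apply]
    rfl
  rTensor_counit_comp_comul := by
    apply LinearMap.ext
    intro x
    have h : ∀ t : A ⊗[k] A,
        (Coalgebra.counit ∘ₗ (equiv k A).symm.toLinearMap).rTensor (Cop A)
          (TensorProduct.map (equiv k A).toLinearMap (equiv k A).toLinearMap
            (TensorProduct.comm k A A t)) =
        TensorProduct.map LinearMap.id (equiv k A).toLinearMap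
          (TensorProduct.comm k A k (Coalgebra.counit.lTensor A t)) := by
      intro t
      induction t with
      | zero => simp
      | add x y hx hy => simp only [map_add, hx, hy]
      | tmul a b => simp
    refine (h _).trans ?_
    simp
  lTensor_counit_comp_comul := by
    apply LinearMap.ext
    intro x
    have h : ∀ t : A ⊗[k] A,
        (Coalgebra.counit ∘ₗ (equiv k A).symm.toLinearMap).lTensor (Cop A)
          (TensorProduct.map (equiv k A).toLinearMap (equiv k A).toLinearMap
            (TensorProduct.comm k A A t)) =
        TensorProduct.map (equiv k A).toLinearMap LinearMap.id
          (TensorProduct.comm k k A (Coalgebra.counit.rTensor A t)) := by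
      intro t
      induction t with
      | zero => simp
      | add x y hx hy => simp only [map_add, hx, hy]
      | tmul a b => simp
    refine (h _).trans ?_
    simp

theorem comul_def (a : A) : Coalgebra.comul (R := k) (equiv k A a) =
    TensorProduct.map (equiv k A).toLinearMap (equiv k A).toLinearMap
      (TensorProduct.comm k A A (Coalgebra.comul a)) := rfl

theorem counit_def (a : A) :
    Coalgebra.counit (R := k) (equiv k A a) = Coalgebra.counit (R := k) a := rfl

instance : Bialgebra k (Cop A) :=
  Bialgebra.mk' k (Cop A)
    (Bialgebra.counit_one (R := k) (A := A))
    (fun {a b} => Bialgebra.counit_mul (R := k) (A := A) a b)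
    (by
      refine (comul_def (k := k) (1 : A)).trans ?_
      simp [Algebra.TensorProduct.one_def])
    (by
      intro a b
      obtain ⟨a, rfl⟩ := (equiv k A).surjective a
      obtain ⟨b, rfl⟩ := (equiv k A).surjective b
      rw [← map_mul, comul_def, comul_def, comul_def, Bialgebra.comul_mul]
      generalize Coalgebra.comul (R := k) a = s
      generalize Coalgebra.comul (R := k) b = t
      induction s with
      | zero => simp
      | add x y hx hy => simp only [map_add, add_mul, hx, hy]
      | tmul c d =>
        induction t with
        | zero => simp
        | add x y hx hy => simp only [map_add, mul_add, hx, hy]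
        | tmul c' d' => simp)

end Cop

namespace Op

variable {k A : Type*} [Field k] [Ring A]

variable (A) in
/-- The identity map `A → A^op`. -/
def equiv : A ≃ Op A := Equiv.refl A

instance : AddCommGroup (Op A) := inferInstanceAs (AddCommGroup A)

/-- The product of `A^op`: `a · b = b a`. -/
instance : Ring (Op A) where
  __ := (inferInstance : AddCommGroup (Op A))
  one := equiv A 1
  mul a b := equiv A ((equiv A).symm b * (equiv A).symm a)
  left_distrib a b c := add_mul (R := A) b c a
  right_distrib a b c := mul_add (R := A) c a b
  zero_mul a := mul_zero (M₀ := A) a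
  mul_zero a := zero_mul (M₀ := A) a
  mul_assoc a b c := (mul_assoc (G := A) c b a).symm
  one_mul a := mul_one (M := A) a
  mul_one a := one_mul (M := A) a

instance [Algebra k A] : Algebra k (Op A) where
  smul c a := equiv A (c • (equiv A).symm a)
  algebraMap :=
    { toFun := fun c => equiv A (algebraMap k A c)
      map_one' := map_one (algebraMap k A)
      map_mul' := fun x y => by
        rw [mul_comm]; exact map_mul (algebraMap k A) y x
      map_zero' := map_zero (algebraMap k A)
      map_add' := map_add (algebraMap k A) }
  commutes' c a := (Algebra.commutes (A := A) c a).symm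
  smul_def' c a := (Algebra.smul_def (A := A) c a).trans (Algebra.commutes (A := A) c a)

variable (k A) in
/-- The identity map `A → A^op`, as a linear isomorphism. -/
def linearEquiv [Algebra k A] : A ≃ₗ[k] Op A where
  toFun := equiv A
  invFun := (equiv A).symm
  map_add' _ _ := rfl
  map_smul' _ _ := rfl
  left_inv _ := rfl
  right_inv _ := rfl

theorem linearEquiv_mul [Algebra k A] (a b : A) :
    linearEquiv k A (a * b) = linearEquiv k A b * linearEquiv k A a := rfl

theorem linearEquiv_one [Algebra k A] : linearEquiv k A 1 = 1 := rfl

variable [Bialgebra k A]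

/-- The comultiplication of `A^op` is that of `A`. -/
instance : Coalgebra k (Op A) where
  comul := TensorProduct.map (linearEquiv k A).toLinearMap (linearEquiv k A).toLinearMap ∘ₗ
    Coalgebra.comul ∘ₗ (linearEquiv k A).symm.toLinearMap
  counit := Coalgebra.counit ∘ₗ (linearEquiv k A).symm.toLinearMap
  coassoc := by
    let e := (linearEquiv k A).toLinearMap
    apply LinearMap.ext
    intro x
    have h1 : ∀ t : A ⊗[k] A, TensorProduct.assoc k _ _ _
        ((TensorProduct.map e e ∘ₗ Coalgebra.comul ∘ₗ
          (linearEquiv k A).symm.toLinearMap).rTensor (Op A) (TensorProduct.map e e t)) =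
        TensorProduct.map e (TensorProduct.map e e)
          (TensorProduct.assoc k A A A (Coalgebra.comul.rTensor A t)) := by
      intro t
      induction t with
      | zero => simp
      | add x y hx hy => simp only [map_add, hx, hy]
      | tmul a b =>
        simp only [map_tmul, LinearMap.rTensor_tmul, e,
          LinearMap.comp_apply, LinearEquiv.symm_apply_apply, LinearEquiv.coe_coe]
        generalize Coalgebra.comul (R := k) a = u
        induction u with
        | zero => simp
        | add x y hx hy => simp only [map_add, add_tmul, hx, hy]
        | tmul c d => simp
    have h2 : ∀ t : A ⊗[k] A,
        ((TensorProduct.map e e ∘ₗ Coalgebra.comul ∘ₗ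
          (linearEquiv k A).symm.toLinearMap).lTensor (Op A) (TensorProduct.map e e t)) =
        TensorProduct.map e (TensorProduct.map e e) (Coalgebra.comul.lTensor A t) := by
      intro t
      induction t with
      | zero => simp
      | add x y hx hy => simp only [map_add, hx, hy]
      | tmul a b =>
        simp only [map_tmul, LinearMap.lTensor_tmul, e,
          LinearMap.comp_apply, LinearEquiv.symm_apply_apply, LinearEquiv.coe_coe]
    refine (h1 _).trans (Eq.trans ?_ (h2 _).symm)
    rw [LinearMap.comp_apply, Coalgebra.coassoc_apply]
  rTensor_counit_comp_comul := by
    apply LinearMap.ext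
    intro x
    have h : ∀ t : A ⊗[k] A,
        (Coalgebra.counit ∘ₗ (linearEquiv k A).symm.toLinearMap).rTensor (Op A)
          (TensorProduct.map (linearEquiv k A).toLinearMap (linearEquiv k A).toLinearMap t) =
        TensorProduct.map LinearMap.id (linearEquiv k A).toLinearMap
          (Coalgebra.counit.rTensor A t) := by
      intro t
      induction t with
      | zero => simp
      | add x y hx hy => simp only [map_add, hx, hy]
      | tmul a b => simp
    refine (h _).trans ?_
    simp
  lTensor_counit_comp_comul := by
    apply LinearMap.ext
    intro x
    have h : ∀ t : A ⊗[k] A,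
        (Coalgebra.counit ∘ₗ (linearEquiv k A).symm.toLinearMap).lTensor (Op A)
          (TensorProduct.map (linearEquiv k A).toLinearMap (linearEquiv k A).toLinearMap t) =
        TensorProduct.map (linearEquiv k A).toLinearMap LinearMap.id
          (Coalgebra.counit.lTensor A t) := by
      intro t
      induction t with
      | zero => simp
      | add x y hx hy => simp only [map_add, hx, hy]
      | tmul a b => simp
    refine (h _).trans ?_
    simp

theorem comul_def (a : A) : Coalgebra.comul (R := k) (linearEquiv k A a) =
    TensorProduct.map (linearEquiv k A).toLinearMap (linearEquiv k A).toLinearMap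
      (Coalgebra.comul a) := rfl

theorem counit_def (a : A) :
    Coalgebra.counit (R := k) (linearEquiv k A a) = Coalgebra.counit (R := k) a := rfl

instance : Bialgebra k (Op A) :=
  Bialgebra.mk' k (Op A)
    (Bialgebra.counit_one (R := k) (A := A))
    (fun {a b} => (Bialgebra.counit_mul (R := k) (A := A) b a).trans (mul_comm _ _))
    (by
      rw [← linearEquiv_one (k := k), comul_def, Bialgebra.comul_one,
        Algebra.TensorProduct.one_def, Algebra.TensorProduct.one_def, map_tmul]
      rfl)
    (by
      intro a b
      obtain ⟨a, rfl⟩ := (linearEquiv k A).surjective a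
      obtain ⟨b, rfl⟩ := (linearEquiv k A).surjective b
      rw [← linearEquiv_mul, comul_def, comul_def, comul_def, Bialgebra.comul_mul]
      generalize Coalgebra.comul (R := k) a = s
      generalize Coalgebra.comul (R := k) b = t
      induction s with
      | zero => simp
      | add x y hx hy => simp only [map_add, add_mul, mul_add, hx, hy]
      | tmul c d =>
        induction t with
        | zero => simp
        | add x y hx hy => simp only [map_add, add_mul, mul_add, hx, hy]
        | tmul c' d' => simp [linearEquiv_mul])

end Op

/-- The bialgebra `A^cop`. -/
def cop {k : Type u} [Field k] (A : BialgCat.{v} k) : BialgCat.{v} k :=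
  BialgCat.of k (Cop A)

/-- The bialgebra `A^op`. -/
def op {k : Type u} [Field k] (A : BialgCat.{v} k) : BialgCat.{v} k :=
  BialgCat.of k (Op A)

/-! ### The Yetter-Drinfeld modules of a realization -/

namespace Realization

variable {k X G : Type*} [Field k] [Rack X] [Group G] {q : X → X → kˣ} (R : Realization q G)

/-- The Yetter-Drinfeld module `V(X, q)` over `kG` with basis `(x_i)`, `t · x_i = χ_i(t) x_{t · i}`
and coaction `x_i ↦ g_i ⊗ x_i`. -/
def V : YDModule k (MonoidAlgebra k G) (X →₀ k) where
  act := MonoidAlgebra.lift k (Module.End k (X →₀ k)) G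
    { toFun := fun t => Finsupp.lsum k fun i =>
        LinearMap.toSpanSingleton k _ (Finsupp.single (R.act t i) (R.χ i t : k))
      map_one' := by
        ext i : 2
        simp [R.χ_one]
      map_mul' := by
        intro s t
        ext i : 2
        simp [R.χ_mul, mul_comm] }
  coact := Finsupp.lsum k fun i =>
    LinearMap.toSpanSingleton k _ (MonoidAlgebra.single (R.g i) (1 : k) ⊗ₜ Finsupp.single i 1)
  coassoc := by
    ext i : 2
    simp
  counit_coact := by
    ext i : 2
    simp
  compat := by
    ext t i : 6
    simp [actFlip_tmul, coactFlip_tmul, R.g_act, MonoidAlgebra.single_mul_single,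
      ← tmul_smul]

/-- The action of `k^G` on `W(q, X)`. -/
def wAct : FunAlg k G →ₐ[k] Module.End k (X →₀ k) where
  toFun := fun f => Finsupp.lsum k fun i =>
    LinearMap.toSpanSingleton k _ (Finsupp.single i (FunAlg.eval (R.g i)⁻¹ f))
  map_one' := by ext i : 2; simp
  map_mul' := by intro f f'; ext i : 2; simp [mul_comm]
  map_zero' := by ext i : 2; simp
  map_add' := by intro f f'; ext i : 2; simp
  commutes' := by
    intro c; ext i : 2
    simp [Algebra.algebraMap_eq_smul_one]

theorem wAct_single (f : FunAlg k G) (i : X) (c : k) :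
    R.wAct f (Finsupp.single i c) = (c * FunAlg.eval (R.g i)⁻¹ f) • Finsupp.single i 1 := by
  simp [wAct]

section

variable [Fintype G] [DecidableEq G]

/-- The coaction of `k^G` on `W(q, X)`. -/
def wCoact : (X →₀ k) →ₗ[k] FunAlg k G ⊗[k] (X →₀ k) :=
  Finsupp.lsum k fun i =>
    LinearMap.toSpanSingleton k _ (∑ t : G, (R.χ i t⁻¹ : k) •
      (FunAlg.δ t ⊗ₜ[k] Finsupp.single (R.act t⁻¹ i) (1 : k)))

theorem wCoact_single (i : X) : R.wCoact (Finsupp.single i (1 : k)) =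
    ∑ t : G, (R.χ i t⁻¹ : k) •
      (FunAlg.δ t ⊗ₜ[k] Finsupp.single (R.act t⁻¹ i) (1 : k)) := by
  simp [wCoact]

theorem slice_wCoact (i : X) (a : G) : FunAlg.slice _ a (R.wCoact (Finsupp.single i (1 : k))) =
    (R.χ i a⁻¹ : k) • Finsupp.single (R.act a⁻¹ i) (1 : k) := by
  rw [wCoact_single, map_sum, Finset.sum_eq_single a]
  · simp
  · intro b _ hb
    simp [hb.symm]
  · simp

/-- The Yetter-Drinfeld module `W(q, X)` over `k^G` with basis `(x_i)`, `δ_t · x_i = x_i` if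
`t = g_i⁻¹` and `0` otherwise, that is `f · x_i = f(g_i⁻¹) x_i`, and coaction
`x_i ↦ ∑ t, χ_i(t⁻¹) δ_t ⊗ x_{t⁻¹ · i}`. -/
def W : YDModule k (FunAlg k G) (X →₀ k) where
  act := R.wAct
  coact := R.wCoact
  coassoc := by
    have h1 : ∀ (a b : G) (u : FunAlg k G ⊗[k] (X →₀ k)),
        FunAlg.slice _ b (FunAlg.slice _ a (TensorProduct.assoc k _ _ _
          ((Coalgebra.comul (R := k) (A := FunAlg k G)).rTensor _ u))) =
          FunAlg.slice _ (a * b) u := by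
      intro a b u
      induction u with
      | zero => simp
      | add x y hx hy => simp [hx, hy]
      | tmul x y => simp [FunAlg.comul_eq, sum_tmul, ← smul_tmul']
    have h2 : ∀ (a : G) (u : FunAlg k G ⊗[k] (X →₀ k)),
        FunAlg.slice _ a (R.wCoact.lTensor _ u) = R.wCoact (FunAlg.slice _ a u) := by
      intro a u
      induction u with
      | zero => simp
      | add x y hx hy => simp [hx, hy]
      | tmul x y => simp
    ext i : 2
    refine FunAlg.slice_ext fun a => FunAlg.slice_ext fun b => ?_
    simp only [LinearMap.comp_apply, LinearEquiv.coe_coe, h1, h2, Finsupp.lsingle_apply,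
      slice_wCoact, map_smul]
    rw [mul_inv_rev, R.χ_mul, smul_smul, map_mul, Equiv.Perm.mul_apply, mul_comm]
    rfl
  counit_coact := by
    ext i : 2
    change FunAlg.slice _ 1 (R.wCoact (Finsupp.single i 1)) = _
    rw [slice_wCoact]
    simp [R.χ_one]
  compat := by
    have h1 : ∀ (a : G) (u : FunAlg k G ⊗[k] FunAlg k G) (v : FunAlg k G ⊗[k] (X →₀ k)),
        FunAlg.slice _ a (TensorProduct.map (LinearMap.mul' k (FunAlg k G))
          (TensorProduct.lift R.wAct.toLinearMap)
          (TensorProduct.tensorTensorTensorComm k _ _ _ _ (u ⊗ₜ v))) =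
        R.wAct (FunAlg.slice _ a u) (FunAlg.slice _ a v) := by
      intro a u v
      induction u with
      | zero => simp
      | add x y hx hy => simp [add_tmul, hx, hy]
      | tmul x y =>
        induction v with
        | zero => simp
        | add x y hx hy => simp [tmul_add, hx, hy]
        | tmul z w => simp [smul_smul, mul_comm]
    have h2 : ∀ (a : G) (f : FunAlg k G) (v : FunAlg k G ⊗[k] (X →₀ k)),
        FunAlg.slice _ a ((LinearMap.mulRight k f).rTensor _ v) =
          FunAlg.eval a f • FunAlg.slice _ a v := by
      intro a f v
      induction v with
      | zero => simp
      | add x y hx hy => simp [hx, hy]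
      | tmul x y => simp [smul_smul, mul_comm]
    have h3 : ∀ (i : X) (u : FunAlg k G ⊗[k] FunAlg k G),
        (R.wAct.toLinearMap.flip (Finsupp.single i 1)).rTensor (FunAlg k G) u =
          Finsupp.single i 1 ⊗ₜ FunAlg.slice _ (R.g i)⁻¹ u := by
      intro i u
      induction u with
      | zero => simp
      | add x y hx hy => simp [tmul_add, hx, hy]
      | tmul x y =>
        change R.wAct x (Finsupp.single i 1) ⊗ₜ y = _
        rw [FunAlg.slice_tmul, wAct_single, one_mul, tmul_smul, smul_tmul']
    refine TensorProduct.ext ?_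
    apply LinearMap.ext
    intro f
    ext i : 2
    refine FunAlg.slice_ext fun a => ?_
    change FunAlg.slice _ a (TensorProduct.map _ _ (TensorProduct.tensorTensorTensorComm k _ _ _ _
      (Coalgebra.comul (R := k) f ⊗ₜ R.wCoact (Finsupp.single i 1)))) =
      FunAlg.slice _ a (coactFlip R.wCoact (actFlip R.wAct.toLinearMap (f ⊗ₜ Finsupp.single i 1)))
    rw [h1, actFlip_tmul, h3, coactFlip_tmul, h2, slice_wCoact, map_smul, wAct_single, one_mul,
      FunAlg.eval_slice_comul, FunAlg.eval_slice_comul, smul_comm, R.g_act]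
    simp [mul_assoc]

end

end Realization

end HopfLift

/-! The coradical filtration depends only on the coalgebra, so gr(A^op) = (gr A)^op. Three things
remain: the opposite of B(V) # H is B(V') # H, where V' comes from the dual realization; A^op is a
Hopf algebra; and the case of A^cop reduces to that of A^op.

Bosonizations. Let σ be an involution of H that reverses products and preserves coproducts, and τ an
involution that reverses coproducts, with σ(h₂) τ(h₁) = ε(h) = τ(h₂) σ(h₁). Suppose that V and V'
differ by σ in the coaction and by τ in the action (`OpTwist`). Then v ↦ v, h ↦ σ(h) extends to an
antimultiplicative and comultiplicative bijection T(V') # H → T(V) # H (`flip`, `comulHom_flip`). It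
carries the defining ideal of B(V') to a Hopf ideal of T(V), which lies in the defining ideal of
B(V) by maximality. The situation is symmetric in V and V', so the map descends to an isomorphism
(B(V') # H)^op ≃ B(V) # H (`isIso_flipEquiv`). Over kG, dualizing inverts g_i in the coaction: σ is
the antipode and τ = id. Over k^G it inverts g_i in the action: σ = id and τ is the antipode.

The opposite is Hopf. By an argument of Takeuchi, an antipode on the coradical is enough
(`isHopf_of_coradical`): if u vanishes on the coradical, its convolution powers vanish locally, so 1
- u is invertible. This uses that the coradical filtration is exhaustive (`exists_mem_coradFil`),
which follows from a composition series of the finite-dimensional module of all f(a₁) a₂. The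
coradical of a lifting embeds into H (`exists_retraction`), because a simple subcoalgebra lies in
the lowest step of any exhaustive coalgebra filtration (`map_mem_of_isSimpleSubcoalgebra`). The skew
antipode τσ of H then gives the required antipode on the coradical of A^op.

Co-opposites. When A and A^op are both Hopf algebras, the antipode of A is bijective and is an
isomorphism A^cop ≃ A^op (`nonempty_cop_equiv_op`). Finally `cop` and `op` are involutions on
bialgebras, and the symmetric twist supplies preimages. -/

namespace HopfLift

/-! ### Tensor products of vector spaces -/

section TensorHelpers

variable {k P Q P' Q' : Type*} [Field k] [AddCommGroup P] [Module k P] [AddCommGroup Q]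
  [Module k Q] [AddCommGroup P'] [Module k P'] [AddCommGroup Q'] [Module k Q']

/-- The map `p ⊗ q ↦ f(p) q`. -/
def contractLeft (Q : Type*) [AddCommGroup Q] [Module k Q] (f : P →ₗ[k] k) : P ⊗[k] Q →ₗ[k] Q :=
  (TensorProduct.lid k Q).toLinearMap ∘ₗ f.rTensor Q

@[simp]
theorem contractLeft_tmul (f : P →ₗ[k] k) (p : P) (q : Q) :
    contractLeft Q f (p ⊗ₜ q) = f p • q := by
  simp [contractLeft]

/-- The coordinate functionals of a basis of `P` identify P ⊗ Q with finitely supported families in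
`Q`, so functionals on one factor separate tensors. -/
theorem eq_zero_of_contractLeft {t : P ⊗[k] Q} (h : ∀ f : P →ₗ[k] k, contractLeft Q f t = 0) :
    t = 0 := by
  classical
  let b := Module.Basis.ofVectorSpace k P
  apply (TensorProduct.equivFinsuppOfBasisLeft (N := Q) b).injective
  rw [map_zero]
  refine Finsupp.ext fun i => ?_
  have : ∀ s : P ⊗[k] Q, TensorProduct.equivFinsuppOfBasisLeft b s i =
      contractLeft Q (b.coord i) s := by
    intro s
    induction s with
    | zero => simp
    | add x y hx hy => simp [hx, hy]
    | tmul p q => simp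
  rw [this, h]
  rfl

theorem contractLeft_map (f : P' →ₗ[k] k) (u : P →ₗ[k] P') (v : Q →ₗ[k] Q') (t : P ⊗[k] Q) :
    contractLeft Q' f (TensorProduct.map u v t) = v (contractLeft Q (f ∘ₗ u) t) := by
  induction t with
  | zero => simp
  | add x y hx hy => simp only [map_add, hx, hy]
  | tmul p q => simp

theorem mem_range_lTensor_iff (N : Submodule k Q) (t : P ⊗[k] Q) :
    t ∈ LinearMap.range (N.subtype.lTensor P) ↔ N.mkQ.lTensor P t = 0 := by
  rw [← LinearMap.mem_ker, lTensor_mkQ]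

theorem mem_range_rTensor_iff (N : Submodule k P) (t : P ⊗[k] Q) :
    t ∈ LinearMap.range (N.subtype.rTensor Q) ↔ N.mkQ.rTensor Q t = 0 := by
  rw [← LinearMap.mem_ker, rTensor_mkQ]

/-- Modulo `N` every slice of the tensor vanishes, and slices separate tensors. Subcoalgebras are
detected through this criterion. -/
theorem mem_range_lTensor_of_contractLeft {N : Submodule k Q} {t : P ⊗[k] Q}
    (h : ∀ f : P →ₗ[k] k, contractLeft Q f t ∈ N) :
    t ∈ LinearMap.range (N.subtype.lTensor P) := by
  rw [mem_range_lTensor_iff]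
  refine eq_zero_of_contractLeft fun f => ?_
  rw [LinearMap.lTensor, contractLeft_map]
  simpa using h f

theorem contractLeft_mem {N : Submodule k Q} {t : P ⊗[k] Q}
    (h : t ∈ LinearMap.range (N.subtype.lTensor P)) (f : P →ₗ[k] k) : contractLeft Q f t ∈ N := by
  obtain ⟨s, rfl⟩ := h
  rw [LinearMap.lTensor, contractLeft_map]
  exact Subtype.prop _

/-- Everything is flat over a field: exactness of - ⊗ Q puts the tensor in ker u ⊗ Q, and exactness
of ker u ⊗ - then puts it in ker u ⊗ ker v. -/
theorem mem_range_mapIncl_of_ker {u : P →ₗ[k] P'} {v : Q →ₗ[k] Q'} {t : P ⊗[k] Q}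
    (hu : u.rTensor Q t = 0) (hv : v.lTensor P t = 0) :
    t ∈ LinearMap.range (TensorProduct.mapIncl (LinearMap.ker u) (LinearMap.ker v)) := by
  have h1 : Function.Exact ((LinearMap.ker u).subtype.rTensor Q) (u.rTensor Q) := by
    apply Module.Flat.rTensor_exact
    exact LinearMap.exact_subtype_ker_map u
  obtain ⟨s, rfl⟩ := (h1 t).1 hu
  have h2 : Function.Exact ((LinearMap.ker v).subtype.lTensor (LinearMap.ker u))
      (v.lTensor (LinearMap.ker u)) := by
    apply Module.Flat.lTensor_exact
    exact LinearMap.exact_subtype_ker_map v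
  have h3 : v.lTensor (LinearMap.ker u) s = 0 := by
    have : Function.Injective ((LinearMap.ker u).subtype.rTensor Q') :=
      Module.Flat.rTensor_preserves_injective_linearMap _ (Submodule.subtype_injective _)
    apply this
    rw [map_zero, ← hv, ← LinearMap.comp_apply, ← LinearMap.comp_apply,
      LinearMap.rTensor_comp_lTensor, LinearMap.lTensor_comp_rTensor]
  obtain ⟨r, rfl⟩ := (h2 s).1 h3
  refine ⟨r, ?_⟩
  rw [← LinearMap.comp_apply, LinearMap.rTensor_comp_lTensor]

theorem range_mapIncl_le_rTensor (N : Submodule k P) (N' : Submodule k Q) :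
    LinearMap.range (TensorProduct.mapIncl N N') ≤ LinearMap.range (N.subtype.rTensor Q) := by
  rw [TensorProduct.mapIncl, ← LinearMap.rTensor_comp_lTensor]
  exact LinearMap.range_comp_le_range _ _

theorem range_mapIncl_le_lTensor (N : Submodule k P) (N' : Submodule k Q) :
    LinearMap.range (TensorProduct.mapIncl N N') ≤ LinearMap.range (N'.subtype.lTensor P) := by
  rw [TensorProduct.mapIncl, ← LinearMap.lTensor_comp_rTensor]
  exact LinearMap.range_comp_le_range _ _

theorem range_mapIncl_mono {N N₁ : Submodule k P} {N' N₁' : Submodule k Q} (h : N ≤ N₁)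
    (h' : N' ≤ N₁') : LinearMap.range (TensorProduct.mapIncl N N') ≤
      LinearMap.range (TensorProduct.mapIncl N₁ N₁') := by
  rintro _ ⟨t, rfl⟩
  refine ⟨TensorProduct.map (Submodule.inclusion h) (Submodule.inclusion h') t, ?_⟩
  rw [TensorProduct.mapIncl, TensorProduct.mapIncl, ← LinearMap.comp_apply,
    ← TensorProduct.map_comp]
  rfl

theorem mem_range_mapIncl {N : Submodule k P} {N' : Submodule k Q} {t : P ⊗[k] Q}
    (h : t ∈ LinearMap.range (N.subtype.rTensor Q))
    (h' : t ∈ LinearMap.range (N'.subtype.lTensor P)) :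
    t ∈ LinearMap.range (TensorProduct.mapIncl N N') := by
  rw [mem_range_rTensor_iff] at h
  rw [mem_range_lTensor_iff] at h'
  exact range_mapIncl_mono N.ker_mkQ.le N'.ker_mkQ.le (mem_range_mapIncl_of_ker h h')

theorem tmul_mem_range_mapIncl {N : Submodule k P} {N' : Submodule k Q} {p : P} {q : Q}
    (hp : p ∈ N) (hq : q ∈ N') : p ⊗ₜ q ∈ LinearMap.range (TensorProduct.mapIncl N N') :=
  ⟨⟨p, hp⟩ ⊗ₜ ⟨q, hq⟩, rfl⟩

/-- To check that `N ⊗ N'` is contained in a subspace it suffices to look at pure tensors. -/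
theorem range_mapIncl_le {N : Submodule k P} {N' : Submodule k Q} {S : Submodule k (P ⊗[k] Q)}
    (h : ∀ p ∈ N, ∀ q ∈ N', p ⊗ₜ q ∈ S) : LinearMap.range (TensorProduct.mapIncl N N') ≤ S := by
  rintro _ ⟨t, rfl⟩
  induction t with
  | zero => simp
  | add x y hx hy => rw [map_add]; exact S.add_mem hx hy
  | tmul p q => exact h p p.2 q q.2

theorem map_mem_range_mapIncl {N : Submodule k P} {N' : Submodule k Q} {N₁ : Submodule k P'}
    {N₁' : Submodule k Q'} {u : P →ₗ[k] P'} {v : Q →ₗ[k] Q'} (hu : ∀ p ∈ N, u p ∈ N₁)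
    (hv : ∀ q ∈ N', v q ∈ N₁') {t : P ⊗[k] Q}
    (ht : t ∈ LinearMap.range (TensorProduct.mapIncl N N')) :
    TensorProduct.map u v t ∈ LinearMap.range (TensorProduct.mapIncl N₁ N₁') :=
  range_mapIncl_le (S := (LinearMap.range (TensorProduct.mapIncl N₁ N₁')).comap
    (TensorProduct.map u v)) (fun p hp q hq => by
      simpa using tmul_mem_range_mapIncl (hu p hp) (hv q hq)) ht

theorem range_mapIncl_top_left (N' : Submodule k Q) :
    LinearMap.range (TensorProduct.mapIncl (⊤ : Submodule k P) N') =
      LinearMap.range (N'.subtype.lTensor P) := by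
  refine le_antisymm (range_mapIncl_le_lTensor _ _) ?_
  rintro _ ⟨t, rfl⟩
  induction t with
  | zero => simp
  | add x y hx hy => rw [map_add]; exact Submodule.add_mem _ hx hy
  | tmul p q => exact tmul_mem_range_mapIncl trivial q.2

theorem range_mapIncl_top_right (N : Submodule k P) :
    LinearMap.range (TensorProduct.mapIncl N (⊤ : Submodule k Q)) =
      LinearMap.range (N.subtype.rTensor Q) := by
  refine le_antisymm (range_mapIncl_le_rTensor _ _) ?_
  rintro _ ⟨t, rfl⟩
  induction t with
  | zero => simp
  | add x y hx hy => rw [map_add]; exact Submodule.add_mem _ hx hy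
  | tmul p q => exact tmul_mem_range_mapIncl p.2 trivial

end TensorHelpers
end HopfLift
namespace HopfLift

/-! ### The coradical filtration is exhaustive -/

section Exhaustive

variable {k A : Type*} [Field k] [AddCommGroup A] [Module k A] [Coalgebra k A]

/-- The map `a ↦ f(a₁) a₂`. -/
def leftHit (f : A →ₗ[k] k) : A →ₗ[k] A := contractLeft A f ∘ₗ Coalgebra.comul

/-- The map `a ↦ f(a₂) a₁`. -/
def rightHit (f : A →ₗ[k] k) : A →ₗ[k] A :=
  contractLeft A f ∘ₗ (TensorProduct.comm k A A).toLinearMap ∘ₗ Coalgebra.comul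

/-- Both sides are f(a₁) ξ(a₂). Since functionals separate points, this adjunction reduces the
identities for right hits below to `leftHit_leftHit`, the only one that invokes coassociativity
directly. -/
theorem apply_rightHit (f ξ : A →ₗ[k] k) (a : A) : f (rightHit ξ a) = ξ (leftHit f a) := by
  simp only [rightHit, leftHit, LinearMap.comp_apply, LinearEquiv.coe_coe]
  generalize Coalgebra.comul (R := k) a = t
  induction t with
  | zero => simp
  | add x y hx hy => simp only [map_add, hx, hy]
  | tmul p q => simp [mul_comm]

theorem leftHit_counit (a : A) : leftHit (Coalgebra.counit (R := k)) a = a := by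
  simp only [leftHit, contractLeft, LinearMap.comp_apply, Coalgebra.rTensor_counit_comul]
  simp

theorem leftHit_leftHit (f g : A →ₗ[k] k) (a : A) :
    leftHit g (leftHit f a) = leftHit (g ∘ₗ leftHit f) a := by
  have h1 : ∀ t : A ⊗[k] A, leftHit g (contractLeft A f t) =
      contractLeft A g (contractLeft (A ⊗[k] A) f (Coalgebra.comul.lTensor A t)) := by
    intro t
    induction t with
    | zero => simp
    | add x y hx hy => simp only [map_add, hx, hy]
    | tmul p q => simp [leftHit]
  have h2 : ∀ t : A ⊗[k] A, contractLeft A (g ∘ₗ leftHit f) t =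
      contractLeft A g (contractLeft (A ⊗[k] A) f
        (TensorProduct.assoc k A A A (Coalgebra.comul.rTensor A t))) := by
    intro t
    induction t with
    | zero => simp
    | add x y hx hy => simp only [map_add, hx, hy]
    | tmul p q =>
      simp only [leftHit, contractLeft_tmul, LinearMap.comp_apply, LinearMap.rTensor_tmul]
      generalize Coalgebra.comul (R := k) p = s
      induction s with
      | zero => simp
      | add x y hx hy => simp only [map_add, add_smul, add_tmul, hx, hy]
      | tmul p q => simp [smul_smul]
  refine (h1 _).trans (Eq.trans ?_ (h2 _).symm)
  rw [Coalgebra.coassoc_apply]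

omit [Coalgebra k A] in
theorem eq_of_forall_dual {a b : A} (h : ∀ f : A →ₗ[k] k, f a = f b) : a = b :=
  (Module.forall_dual_apply_eq_zero_iff k (a - b)).1 (fun f => by simp [h f]) |> sub_eq_zero.1

/-- Both sides are f(a₁) ξ(a₃) a₂. Consequently `rightHit ξ` is an endomorphism of the
`HitAlgebra`-module `A`. -/
theorem leftHit_rightHit (f ξ : A →ₗ[k] k) (a : A) :
    leftHit f (rightHit ξ a) = rightHit ξ (leftHit f a) :=
  eq_of_forall_dual (k := k) fun g => by
    rw [apply_rightHit, ← LinearMap.comp_apply g, leftHit_leftHit, apply_rightHit]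

theorem rightHit_rightHit (η ξ : A →ₗ[k] k) (a : A) :
    rightHit η (rightHit ξ a) = rightHit (ξ ∘ₗ leftHit η) a := by
  refine eq_of_forall_dual (k := k) fun f => ?_
  rw [apply_rightHit, apply_rightHit, leftHit_rightHit, apply_rightHit, LinearMap.comp_apply]

variable (k A) in
/-- The algebra of endomorphisms of `A` generated by the maps `a ↦ f(a₁) a₂`. -/
def hitAlgebra : Subalgebra k (Module.End k A) :=
  Algebra.adjoin k (Set.range fun f : A →ₗ[k] k => (leftHit f : Module.End k A))

variable (k A) in
/-- The algebra `hitAlgebra k A`, as a type. -/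
def HitAlgebra : Type _ := hitAlgebra k A

instance : Ring (HitAlgebra k A) := inferInstanceAs (Ring (hitAlgebra k A))

instance : Algebra k (HitAlgebra k A) := inferInstanceAs (Algebra k (hitAlgebra k A))

instance : Module (HitAlgebra k A) A := inferInstanceAs (Module (hitAlgebra k A) A)

instance : IsScalarTower k (HitAlgebra k A) A :=
  inferInstanceAs (IsScalarTower k (hitAlgebra k A) A)

/-- The map `a ↦ f(a₁) a₂` as an element of `HitAlgebra k A`. -/
def hit (f : A →ₗ[k] k) : HitAlgebra k A := ⟨leftHit f, Algebra.subset_adjoin ⟨f, rfl⟩⟩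

/-- A subspace stable under all `leftHit f`, as a module over `hitAlgebra`. -/
def hitSubmodule (N : Submodule k A) (h : ∀ f : A →ₗ[k] k, ∀ a ∈ N, leftHit f a ∈ N) :
    Submodule (HitAlgebra k A) A where
  __ := N.toAddSubmonoid
  smul_mem' := by
    rintro ⟨r, hr⟩ a ha
    change r a ∈ N
    induction hr using Algebra.adjoin_induction generalizing a with
    | mem x hx => obtain ⟨f, rfl⟩ := hx; exact h f a ha
    | algebraMap c => exact N.smul_mem c ha
    | add x y _ _ hx hy => exact N.add_mem (hx ha) (hy ha)
    | mul x y _ _ hx hy => exact hx (hy ha)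

theorem leftHit_mem (N : Submodule (HitAlgebra k A) A) (f : A →ₗ[k] k) {a : A} (ha : a ∈ N) :
    leftHit f a ∈ N :=
  N.smul_mem (hit f) ha

theorem map_leftHit {M : Submodule (HitAlgebra k A) A} (θ : M →ₗ[HitAlgebra k A] A)
    (f : A →ₗ[k] k) (m : M) : θ ⟨leftHit f m, leftHit_mem M f m.2⟩ = leftHit f (θ m) :=
  θ.map_smul (hit f) m

/-- A linear map `A → A` that commutes with the maps `leftHit f`. -/
def hitHom (θ : A →ₗ[k] A) (h : ∀ (f : A →ₗ[k] k) (a : A), leftHit f (θ a) = θ (leftHit f a)) :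
    A →ₗ[HitAlgebra k A] A where
  toFun := θ
  map_add' := θ.map_add
  map_smul' := by
    rintro ⟨r, hr⟩ a
    change θ (r a) = r (θ a)
    induction hr using Algebra.adjoin_induction generalizing a with
    | mem x hx => obtain ⟨f, rfl⟩ := hx; exact (h f a).symm
    | algebraMap c => exact θ.map_smul c a
    | add x y _ _ hx hy => simp [hx, hy]
    | mul x y _ _ hx hy => simp [hx, hy]

/-- The span of the elements `ξ(m₂) m₁` with `m ∈ M` and `ξ` vanishing on `N`. -/
def coeffSpace (M N : Submodule k A) : Submodule k A :=
  Submodule.span k {a | ∃ ξ : A →ₗ[k] k, (∀ n ∈ N, ξ n = 0) ∧ ∃ m ∈ M, a = rightHit ξ m}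

/-- The two stabilities put Δ(a) in A ⊗ D and in D ⊗ A, and over a field these meet in D ⊗ D. -/
theorem isSubcoalgebra_of_hit {D : Submodule k A} (h : ∀ (f : A →ₗ[k] k), ∀ a ∈ D, leftHit f a ∈ D)
    (h' : ∀ (f : A →ₗ[k] k), ∀ a ∈ D, rightHit f a ∈ D) : IsSubcoalgebra k D := by
  intro a ha
  refine mem_range_mapIncl ?_ (mem_range_lTensor_of_contractLeft fun f => h f a ha)
  have := mem_range_lTensor_of_contractLeft
    (t := TensorProduct.comm k A A (Coalgebra.comul (R := k) a)) fun f => h' f a ha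
  obtain ⟨s, hs⟩ := this
  refine ⟨TensorProduct.comm k A D s, ?_⟩
  apply (TensorProduct.comm k A A).injective
  rw [← hs, ← LinearMap.comm_comp_lTensor_comp_comm_eq]
  simp

theorem IsSubcoalgebra.leftHit_mem {D : Submodule k A} (h : IsSubcoalgebra k D) (f : A →ₗ[k] k)
    {a : A} (ha : a ∈ D) : leftHit f a ∈ D :=
  contractLeft_mem (range_mapIncl_le_lTensor _ _ (h a ha)) f

theorem IsSubcoalgebra.rightHit_mem {D : Submodule k A} (h : IsSubcoalgebra k D) (f : A →ₗ[k] k)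
    {a : A} (ha : a ∈ D) : rightHit f a ∈ D := by
  refine contractLeft_mem ?_ f
  obtain ⟨s, hs⟩ := range_mapIncl_le_rTensor _ _ (h a ha)
  refine ⟨TensorProduct.comm k D A s, ?_⟩
  simp only [LinearMap.comp_apply, LinearEquiv.coe_coe]
  rw [← hs, ← LinearMap.comm_comp_lTensor_comp_comm_eq]
  simp

/-- A left hit commutes with `rightHit ξ` and acts on `M`; a right hit by f replaces ξ by ξ ∘
`leftHit f`, which still vanishes on `N`. -/
theorem coeffSpace_isSubcoalgebra {M N : Submodule k A}
    (hM : ∀ (f : A →ₗ[k] k), ∀ a ∈ M, leftHit f a ∈ M)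
    (hN : ∀ (f : A →ₗ[k] k), ∀ a ∈ N, leftHit f a ∈ N) : IsSubcoalgebra k (coeffSpace M N) := by
  refine isSubcoalgebra_of_hit (fun f a ha => ?_) (fun f a ha => ?_)
  · refine Submodule.span_induction (p := fun a _ => leftHit f a ∈ coeffSpace M N) ?_ (by simp)
      (fun x y _ _ hx hy => by rw [map_add]; exact add_mem hx hy)
      (fun c x _ hx => by rw [map_smul]; exact Submodule.smul_mem _ _ hx) ha
    rintro _ ⟨ξ, hξ, m, hm, rfl⟩
    exact Submodule.subset_span ⟨ξ, hξ, _, hM f m hm, leftHit_rightHit f ξ m⟩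
  · refine Submodule.span_induction (p := fun a _ => rightHit f a ∈ coeffSpace M N) ?_ (by simp)
      (fun x y _ _ hx hy => by rw [map_add]; exact add_mem hx hy)
      (fun c x _ hx => by rw [map_smul]; exact Submodule.smul_mem _ _ hx) ha
    rintro _ ⟨ξ, hξ, m, hm, rfl⟩
    exact Submodule.subset_span ⟨ξ ∘ₗ leftHit f, fun n hn => hξ _ (hN f n hn), m, hm,
      rightHit_rightHit f ξ m⟩

/-- Slicing the second factor by a functional on A / N produces a generator of `coeffSpace M N`. The
vanishing expresses Δ(M) ⊆ `coeffSpace M N` ⊗ A + A ⊗ N, the shape of one step of the coradical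
filtration. -/
theorem comul_mem_coeffSpace (M N : Submodule k A) {m : A} (hm : m ∈ M) :
    TensorProduct.map (coeffSpace M N).mkQ N.mkQ (Coalgebra.comul m) = 0 := by
  apply (TensorProduct.comm k _ _).injective
  rw [map_zero]
  refine eq_zero_of_contractLeft fun g => ?_
  rw [← TensorProduct.map_comm, contractLeft_map]
  refine (Submodule.Quotient.mk_eq_zero _).2 (Submodule.subset_span ⟨g ∘ₗ N.mkQ, ?_, m, hm, rfl⟩)
  intro n hn
  simp [(Submodule.Quotient.mk_eq_zero N).2 hn]

/-- The kernel of a tensor product of two quotient maps is D ⊗ A + A ⊗ N, contained in the subspace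
that defines the next step. -/
theorem mem_coradFil_succ {D N : Submodule k A} {n : ℕ} (hD : D ≤ coradical k A)
    (hN : N ≤ coradFil k A n) {a : A}
    (h : TensorProduct.map D.mkQ N.mkQ (Coalgebra.comul a) = 0) : a ∈ coradFil k A (n + 1) := by
  have h1 := TensorProduct.map_ker (f := D.subtype) (g := D.mkQ) (f' := N.subtype) (g' := N.mkQ)
    (by rw [LinearMap.exact_iff]; simp) D.mkQ_surjective (by rw [LinearMap.exact_iff]; simp)
    N.mkQ_surjective
  rw [← LinearMap.mem_ker, h1, ← range_mapIncl_top_left, ← range_mapIncl_top_right] at h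
  exact sup_le_sup (range_mapIncl_mono le_rfl hN) (range_mapIncl_mono hD le_rfl) h

/-- The coefficients of a simple comodule M / N span a simple subcoalgebra, unless they all vanish.
Right hits factor through M / N, so the span is an isotypic submodule. A nonzero subcoalgebra of it
contains a copy of M / N, and with that copy all the coefficients of M / N. -/
theorem coeffSpace_le_coradical (M : Submodule (HitAlgebra k A) A)
    (N : Submodule (HitAlgebra k A) M) [IsSimpleModule (HitAlgebra k A) (M ⧸ N)] :
    coeffSpace (M.restrictScalars k) ((N.map M.subtype).restrictScalars k) ≤ coradical k A := by
  set D := coeffSpace (M.restrictScalars k) ((N.map M.subtype).restrictScalars k) with hD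
  have hDsub : IsSubcoalgebra k D :=
    coeffSpace_isSubcoalgebra (fun f a ha => leftHit_mem M f ha) (fun f a ha => leftHit_mem _ f ha)
  have hDiso : ∀ a ∈ D, a ∈ isotypicComponent (HitAlgebra k A) A (M ⧸ N) := by
    intro a ha
    refine Submodule.span_induction (p := fun a _ => a ∈ isotypicComponent (HitAlgebra k A) A
      (M ⧸ N)) ?_ (by simp) (fun x y _ _ hx hy => add_mem hx hy)
      (fun c x _ hx => ((isotypicComponent (HitAlgebra k A) A (M ⧸ N)).restrictScalars k).smul_mem
        c hx) ha
    rintro _ ⟨ξ, hξ, m, hm, rfl⟩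
    -- The right hit kills `N` because f(rightHit ξ n) = ξ(leftHit f n) and `N` is a submodule; so
    -- it descends to M / N.
    let θ := N.liftQ ((hitHom (rightHit ξ) (fun f a => leftHit_rightHit f ξ a)).comp M.subtype) (by
      intro n hn
      refine eq_of_forall_dual (k := k) fun f => ?_
      change f (rightHit ξ n) = f 0
      rw [apply_rightHit, map_zero]
      exact hξ _ (leftHit_mem _ f ⟨n, hn, rfl⟩))
    have h1 := LinearMap.le_comap_isotypicComponent (M ⧸ N) θ
    rw [isotypicComponent_eq_top_iff.2 (IsIsotypicOfType.of_isSimpleModule _ _)] at h1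
    exact h1 (x := N.mkQ ⟨m, hm⟩) trivial
  by_cases hD0 : D = ⊥
  · rw [hD0]; exact bot_le
  refine le_sSup ⟨hDsub, hD0, fun D' hD' hsub => or_iff_not_imp_left.2 fun hne => ?_⟩
  refine le_antisymm hD' ?_
  let P := hitSubmodule D' (fun f a ha => hsub.leftHit_mem f ha)
  have hP : P ≤ isotypicComponent (HitAlgebra k A) A (M ⧸ N) := fun a ha => hDiso a (hD' ha)
  have : IsSemisimpleModule (HitAlgebra k A) P :=
    IsSemisimpleModule.of_injective _ (Submodule.inclusion_injective hP)
  obtain ⟨S, hSP, hS⟩ := (IsSemisimpleModule.eq_bot_or_exists_simple_le P).resolve_left (by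
    intro h
    refine hne ((Submodule.eq_bot_iff _).2 fun a ha => ?_)
    have : a ∈ P := ha
    rw [h] at this
    exact this)
  obtain ⟨e⟩ := isIsotypicOfType_submodule_iff.1
    (IsIsotypicOfType.isotypicComponent (HitAlgebra k A) A (M ⧸ N)) S (hSP.trans hP)
  let θ : (M ⧸ N) →ₗ[HitAlgebra k A] A := S.subtype ∘ₗ e.symm.toLinearMap
  have hθ : Function.Injective θ := S.injective_subtype.comp e.symm.injective
  -- The retraction `p` is only k-linear. It serves to extend functionals from the copy of M / N
  -- inside `D'` to all of `A`.
  obtain ⟨p, hp⟩ := LinearMap.exists_leftInverse_of_injective (θ.restrictScalars k)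
    (LinearMap.ker_eq_bot.2 hθ)
  refine Submodule.span_le.2 ?_
  rintro _ ⟨ξ, hξ, m, hm, rfl⟩
  let ξ₁ : (M ⧸ N) →ₗ[k] k := (N.restrictScalars k).liftQ
      (ξ ∘ₗ (M.restrictScalars k).subtype) (fun n hn => hξ _ ⟨n, hn, rfl⟩) ∘ₗ
    (Submodule.Quotient.restrictScalarsEquiv k N).symm.toLinearMap
  have hξ₁ : ∀ m : M, (ξ₁ ∘ₗ p) (θ (N.mkQ m)) = ξ m := by
    intro m
    have h1 : p (θ (N.mkQ m)) = N.mkQ m := LinearMap.congr_fun hp (N.mkQ m)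
    rw [LinearMap.comp_apply, h1]
    rfl
  -- A coefficient of M / N is also a coefficient of its copy in `D'`, for the extended functional.
  have key : rightHit ξ m = rightHit (ξ₁ ∘ₗ p) ((θ ∘ₗ N.mkQ) ⟨m, hm⟩) := by
    refine eq_of_forall_dual (k := k) fun f => ?_
    rw [apply_rightHit, apply_rightHit, ← map_leftHit (θ ∘ₗ N.mkQ)]
    exact (hξ₁ ⟨leftHit f m, _⟩).symm
  rw [key]
  exact hsub.rightHit_mem _ (hSP (e.symm _).2)

/-- Induction along a composition series: a maximal submodule lies in some step of the filtration,
and the simple quotient costs one more step. -/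
theorem exists_le_coradFil (n : ℕ) : ∀ M : Submodule (HitAlgebra k A) A,
    FiniteDimensional k M → Module.finrank k M = n →
    ∃ m, M.restrictScalars k ≤ coradFil k A m := by
  induction n using Nat.strong_induction_on with
  | _ n ih =>
    intro M hM hn
    have : Module.Finite (HitAlgebra k A) M := Module.Finite.of_restrictScalars_finite k _ _
    obtain h | ⟨N, hN, -⟩ := eq_top_or_exists_le_coatom (⊥ : Submodule (HitAlgebra k A) M)
    · refine ⟨0, fun a ha => ?_⟩
      have : (⟨a, ha⟩ : M) ∈ (⊥ : Submodule (HitAlgebra k A) M) := h ▸ trivial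
      have : a = 0 := congrArg Subtype.val ((Submodule.mem_bot _).1 this)
      rw [this]; exact zero_mem _
    · have := isSimpleModule_iff_isCoatom.2 hN
      let e : N ≃ₗ[k] N.map M.subtype :=
        (N.equivMapOfInjective M.subtype M.injective_subtype).restrictScalars k
      have hfin : FiniteDimensional k N :=
        inferInstanceAs (FiniteDimensional k (N.restrictScalars k))
      obtain ⟨m, hm⟩ := ih (Module.finrank k N) (by
        rw [← hn]
        refine Submodule.finrank_lt (s := N.restrictScalars k) (fun h => hN.1 ?_)
        exact Submodule.restrictScalars_injective k _ _ h) (N.map M.subtype)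
          (Module.Finite.equiv e) e.finrank_eq.symm
      exact ⟨m + 1, fun a ha => mem_coradFil_succ (coeffSpace_le_coradical M N) hm
        (comul_mem_coeffSpace _ _ ha)⟩

variable (k) in
/-- The coradical filtration is exhaustive. -/
theorem exists_mem_coradFil (a : A) : ∃ n, a ∈ coradFil k A n := by
  let g : (A →ₗ[k] k) →ₗ[k] A :=
    { toFun := fun f => leftHit f a
      map_add' := fun f g => by
        simp [leftHit, contractLeft, LinearMap.rTensor_add]
      map_smul' := fun c f => by
        simp [leftHit, contractLeft, LinearMap.rTensor_smul] }
  -- The cyclic submodule generated by `a`. It contains `a` by the counit axiom and is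
  -- finite-dimensional because Δ(a) is a finite sum of pure tensors.
  let M := hitSubmodule (LinearMap.range g) (by
    rintro f _ ⟨f', rfl⟩
    exact ⟨f ∘ₗ leftHit f', (leftHit_leftHit f' f a).symm⟩)
  have hfin : FiniteDimensional k (LinearMap.range g) := by
    have : ∀ t : A ⊗[k] A, ∃ S : Submodule k A, FiniteDimensional k S ∧
        ∀ f : A →ₗ[k] k, contractLeft A f t ∈ S := by
      intro t
      induction t with
      | zero => exact ⟨⊥, inferInstance, by simp⟩
      | add x y hx hy =>
        obtain ⟨S, hS, h⟩ := hx
        obtain ⟨S', hS', h'⟩ := hy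
        refine ⟨S ⊔ S', inferInstance, fun f => ?_⟩
        rw [map_add]
        exact add_mem (Submodule.mem_sup_left (h f)) (Submodule.mem_sup_right (h' f))
      | tmul p q =>
        refine ⟨k ∙ q, inferInstance, fun f => ?_⟩
        rw [contractLeft_tmul]
        exact Submodule.smul_mem _ _ (Submodule.mem_span_singleton_self q)
    obtain ⟨S, hS, h⟩ := this (Coalgebra.comul a)
    refine Submodule.finiteDimensional_of_le (S₂ := S) ?_
    rintro _ ⟨f, rfl⟩
    exact h f
  obtain ⟨n, hn⟩ := exists_le_coradFil _ M hfin rfl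
  exact ⟨n, hn (x := a) ⟨Coalgebra.counit, leftHit_counit a⟩⟩

end Exhaustive
end HopfLift
namespace HopfLift

/-! ### Convolution inverses and the coradical -/

section Takeuchi

theorem coradical_isSubcoalgebra (k A : Type*) [Field k] [AddCommGroup A] [Module k A]
    [Coalgebra k A] : IsSubcoalgebra k (coradical k A) := by
  intro a ha
  rw [coradical, sSup_eq_iSup'] at ha
  refine Submodule.iSup_induction _ (motive := fun a => Coalgebra.comul (R := k) a ∈
    LinearMap.range (TensorProduct.mapIncl (coradical k A) (coradical k A))) ha ?_ (by simp)
    (fun x y hx hy => by rw [map_add]; exact add_mem hx hy)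
  intro C a ha
  exact range_mapIncl_mono (le_sSup C.2) (le_sSup C.2) (C.2.1 a ha)

theorem coradFil_mono (k A : Type*) [Field k] [AddCommGroup A] [Module k A]
    [Coalgebra k A] : Monotone (coradFil k A) := by
  refine monotone_nat_of_le_succ fun n => ?_
  induction n with
  | zero =>
    intro a ha
    exact Submodule.mem_sup_right (range_mapIncl_mono le_rfl le_top
      (coradical_isSubcoalgebra k A a ha))
  | succ n ih =>
    exact Submodule.comap_mono (sup_le_sup (range_mapIncl_mono le_rfl ih) le_rfl)

variable {k C B : Type*} [Field k] [AddCommGroup C] [Module k C] [Coalgebra k C] [Ring B]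
  [Algebra k B]

/-- Write u^(n+2) as u * u^(n+1). On A ⊗ A_[n] the second factor vanishes by induction; on A_[0] ⊗ A
the first factor vanishes. -/
theorem convPow_apply_eq_zero {u : WithConv (C →ₗ[k] B)} (hu : ∀ a ∈ coradical k C, u a = 0)
    (n : ℕ) : ∀ a ∈ coradFil k C n, (u ^ (n + 1)) a = 0 := by
  induction n with
  | zero => rw [zero_add, pow_one]; exact hu
  | succ n ih =>
    intro a ha
    rw [pow_succ', LinearMap.convMul_apply]
    refine LinearMap.mem_ker.1 (SetLike.le_def.1 (sup_le ?_ ?_) ha : _ ∈ LinearMap.ker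
      (LinearMap.mul' k B ∘ₗ TensorProduct.map u.ofConv (u ^ (n + 1)).ofConv))
    · refine range_mapIncl_le fun p _ q hq => ?_
      have : (u ^ (n + 1)).ofConv q = 0 := ih q hq
      simp [this]
    · refine range_mapIncl_le fun p hp q _ => ?_
      have : u.ofConv p = 0 := hu p hp
      simp [this]

theorem exists_convPow_apply_eq_zero {u : WithConv (C →ₗ[k] B)}
    (hu : ∀ a ∈ coradical k C, u a = 0) (a : C) : ∃ N, ∀ m ≥ N, (u ^ m) a = 0 := by
  obtain ⟨n, hn⟩ := exists_mem_coradFil k a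
  refine ⟨n + 1, fun m hm => ?_⟩
  obtain ⟨m, rfl⟩ : ∃ l, m = l + 1 := ⟨m - 1, by omega⟩
  exact convPow_apply_eq_zero hu m a (coradFil_mono k C (by omega) hn)

theorem sum_convPow_apply_eq {u : WithConv (C →ₗ[k] B)} {a : C} {N M : ℕ}
    (hN : ∀ m ≥ N, (u ^ m) a = 0) (hM : N ≤ M) :
    ∑ m ∈ Finset.range M, (u ^ m) a = ∑ m ∈ Finset.range N, (u ^ m) a := by
  symm
  refine Finset.sum_subset (Finset.range_mono hM) fun m _ hm => hN m ?_
  simpa using hm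

/-- The locally finite sum `∑ m, u ^ m` of convolution powers. -/
def convGeom (u : WithConv (C →ₗ[k] B)) (hu : ∀ a ∈ coradical k C, u a = 0) : C →ₗ[k] B where
  toFun a := ∑ m ∈ Finset.range (exists_convPow_apply_eq_zero hu a).choose, (u ^ m) a
  map_add' a b := by
    have ha := (exists_convPow_apply_eq_zero hu a).choose_spec
    have hb := (exists_convPow_apply_eq_zero hu b).choose_spec
    have hab := (exists_convPow_apply_eq_zero hu (a + b)).choose_spec
    set N := (exists_convPow_apply_eq_zero hu a).choose
    set N' := (exists_convPow_apply_eq_zero hu b).choose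
    set N'' := (exists_convPow_apply_eq_zero hu (a + b)).choose
    rw [← sum_convPow_apply_eq ha (le_max_left N (max N' N'')),
      ← sum_convPow_apply_eq hb (le_max_of_le_right (le_max_left N' N'') : N' ≤ max N _),
      ← sum_convPow_apply_eq hab (le_max_of_le_right (le_max_right N' N'') : N'' ≤ max N _),
      ← Finset.sum_add_distrib]
    exact Finset.sum_congr rfl fun m _ => map_add (u ^ m).ofConv a b
  map_smul' c a := by
    have ha := (exists_convPow_apply_eq_zero hu a).choose_spec
    have hca := (exists_convPow_apply_eq_zero hu (c • a)).choose_spec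
    set N := (exists_convPow_apply_eq_zero hu a).choose
    set N' := (exists_convPow_apply_eq_zero hu (c • a)).choose
    rw [← sum_convPow_apply_eq ha (le_max_left N N'),
      ← sum_convPow_apply_eq hca (le_max_right N N'), RingHom.id_apply, Finset.smul_sum]
    exact Finset.sum_congr rfl fun m _ => map_smul (u ^ m).ofConv c a

theorem exists_convGeom_apply_eq (u : WithConv (C →ₗ[k] B)) (hu : ∀ a ∈ coradical k C, u a = 0)
    (a : C) :
    ∃ N, ∀ M ≥ N, convGeom u hu a = (∑ m ∈ Finset.range M, u ^ m).ofConv a := by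
  refine ⟨(exists_convPow_apply_eq_zero hu a).choose, fun M hM => ?_⟩
  refine (sum_convPow_apply_eq (exists_convPow_apply_eq_zero hu a).choose_spec hM).symm.trans ?_
  rw [WithConv.ofConv_sum, LinearMap.sum_apply]

/-- A tensor involves finitely many elements, so one truncation of the geometric series serves for
all of them. -/
theorem exists_map_convGeom_eq (u : WithConv (C →ₗ[k] B)) (hu : ∀ a ∈ coradical k C, u a = 0)
    (f : C →ₗ[k] B) (t : C ⊗[k] C) : ∃ N, ∀ M ≥ N,
      TensorProduct.map f (convGeom u hu) t =
        TensorProduct.map f (∑ m ∈ Finset.range M, u ^ m).ofConv t ∧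
      TensorProduct.map (convGeom u hu) f t =
        TensorProduct.map (∑ m ∈ Finset.range M, u ^ m).ofConv f t := by
  induction t with
  | zero => exact ⟨0, by simp⟩
  | add x y hx hy =>
    obtain ⟨N, hN⟩ := hx
    obtain ⟨N', hN'⟩ := hy
    refine ⟨max N N', fun M hM => ?_⟩
    obtain ⟨h1, h2⟩ := hN M (le_of_max_le_left hM)
    obtain ⟨h3, h4⟩ := hN' M (le_of_max_le_right hM)
    simp only [map_add, h1, h2, h3, h4, and_self]
  | tmul p q =>
    obtain ⟨N, hN⟩ := exists_convGeom_apply_eq u hu p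
    obtain ⟨N', hN'⟩ := exists_convGeom_apply_eq u hu q
    refine ⟨max N N', fun M hM => ?_⟩
    simp only [TensorProduct.map_tmul, hN M (le_of_max_le_left hM), hN' M (le_of_max_le_right hM),
      and_self]

/-- The inverse is the geometric series. At a given element both the series on Δ(a) and the power
u^M can be controlled by one large M, where (1 - u) ∑ u^m = 1 - u^M and u^M vanishes at `a`. -/
theorem isUnit_one_sub_of_coradical (u : WithConv (C →ₗ[k] B))
    (hu : ∀ a ∈ coradical k C, u a = 0) : IsUnit (1 - u) := by
  refine ⟨⟨1 - u, WithConv.toConv (convGeom u hu), ?_, ?_⟩, rfl⟩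
  · apply WithConv.ext
    apply LinearMap.ext
    intro a
    obtain ⟨N, hN⟩ := exists_map_convGeom_eq u hu (1 - u).ofConv (Coalgebra.comul a)
    obtain ⟨N', hN'⟩ := exists_convPow_apply_eq_zero hu a
    have h1 := congrArg (LinearMap.mul' k B) (hN (max N N') (le_max_left _ _)).1
    have h2 : ((1 - u) * ∑ m ∈ Finset.range (max N N'), u ^ m) a =
      (1 - u ^ max N N') a := by rw [mul_neg_geom_sum]
    refine h1.trans (h2.trans ?_)
    change (1 : WithConv (C →ₗ[k] B)) a - (u ^ max N N') a = _
    rw [hN' _ (le_max_right _ _), sub_zero]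
  · apply WithConv.ext
    apply LinearMap.ext
    intro a
    obtain ⟨N, hN⟩ := exists_map_convGeom_eq u hu (1 - u).ofConv (Coalgebra.comul a)
    obtain ⟨N', hN'⟩ := exists_convPow_apply_eq_zero hu a
    have h1 := congrArg (LinearMap.mul' k B) (hN (max N N') (le_max_left _ _)).2
    have h2 : ((∑ m ∈ Finset.range (max N N'), u ^ m) * (1 - u)) a =
      (1 - u ^ max N N') a := by rw [geom_sum_mul_neg]
    refine h1.trans (h2.trans ?_)
    change (1 : WithConv (C →ₗ[k] B)) a - (u ^ max N N') a = _
    rw [hN' _ (le_max_right _ _), sub_zero]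

theorem isHopf_iff_isUnit {B : Type*} [Ring B] [Bialgebra k B] :
    IsHopf k B ↔ IsUnit (WithConv.toConv (LinearMap.id : B →ₗ[k] B)) := by
  constructor
  · rintro ⟨S, h1, h2⟩
    refine ⟨⟨_, WithConv.toConv S, WithConv.ext h2, WithConv.ext h1⟩, rfl⟩
  · rintro ⟨⟨a, b, hab, hba⟩, rfl : a = _⟩
    exact ⟨b.ofConv, congrArg WithConv.ofConv hba, congrArg WithConv.ofConv hab⟩

/-- A bialgebra is a Hopf algebra if its coradical has an antipode. -/
theorem isHopf_of_coradical {B : Type*} [Ring B] [Bialgebra k B] (T : B →ₗ[k] B)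
    (h1 : ∀ a ∈ coradical k B, LinearMap.mul' k B (T.rTensor B (Coalgebra.comul a)) =
      algebraMap k B (Coalgebra.counit a))
    (h2 : ∀ a ∈ coradical k B, LinearMap.mul' k B (T.lTensor B (Coalgebra.comul a)) =
      algebraMap k B (Coalgebra.counit a)) : IsHopf k B := by
  rw [isHopf_iff_isUnit, isUnit_iff_exists_and_exists]
  set i := WithConv.toConv (LinearMap.id : B →ₗ[k] B)
  -- The defects 1 - T * i and 1 - i * T vanish on the coradical, so T * i and i * T are units.
  -- Hence i has an inverse on each side.
  have u1 := isUnit_one_sub_of_coradical (1 - WithConv.toConv T * i) (by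
    intro a ha
    have := h1 a ha
    exact sub_eq_zero.2 this.symm)
  have u2 := isUnit_one_sub_of_coradical (1 - i * WithConv.toConv T) (by
    intro a ha
    have := h2 a ha
    exact sub_eq_zero.2 this.symm)
  rw [sub_sub_cancel] at u1 u2
  obtain ⟨c, hc⟩ := u1.exists_left_inv
  obtain ⟨d, hd⟩ := u2.exists_right_inv
  exact ⟨⟨WithConv.toConv T * d, by rw [← mul_assoc, hd]⟩,
    ⟨c * WithConv.toConv T, by rw [mul_assoc, hc]⟩⟩

end Takeuchi
end HopfLift
namespace HopfLift

/-! ### Functoriality of the coradical filtration -/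

section GrEquiv

variable {k A B : Type*} [Field k] [AddCommGroup A] [Module k A] [Coalgebra k A]
  [AddCommGroup B] [Module k B] [Coalgebra k B]

/-- The linear isomorphism `e` respects the comultiplications. -/
def PreservesComul (e : A ≃ₗ[k] B) : Prop :=
  ∀ a, Coalgebra.comul (R := k) (e a) =
    TensorProduct.map e.toLinearMap e.toLinearMap (Coalgebra.comul a)

namespace PreservesComul

variable {e : A ≃ₗ[k] B} (he : PreservesComul e)

include he in
theorem symm : PreservesComul e.symm := by
  intro b
  obtain ⟨a, rfl⟩ := EquivLike.surjective e b
  rw [he, ← LinearMap.comp_apply, ← TensorProduct.map_comp, LinearEquiv.symm_apply_apply]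
  simp [TensorProduct.map_id]

theorem isSubcoalgebra_map (he : PreservesComul e) {C : Submodule k A} (hC : IsSubcoalgebra k C) :
    IsSubcoalgebra k (C.map e.toLinearMap) := by
  rintro _ ⟨a, ha, rfl⟩
  change Coalgebra.comul (e a) ∈ _
  rw [he]
  exact map_mem_range_mapIncl (fun _ hp => Submodule.mem_map_of_mem hp)
    (fun _ hp => Submodule.mem_map_of_mem hp) (hC a ha)

theorem isSimpleSubcoalgebra_map (he : PreservesComul e) {C : Submodule k A}
    (hC : IsSimpleSubcoalgebra k C) : IsSimpleSubcoalgebra k (C.map e.toLinearMap) := by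
  have h1 : ∀ D : Submodule k B, (D.map e.symm.toLinearMap).map e.toLinearMap = D := by
    intro D
    rw [← Submodule.map_comp]
    simp
  have h2 : ∀ D : Submodule k A, (D.map e.toLinearMap).map e.symm.toLinearMap = D := by
    intro D
    rw [← Submodule.map_comp]
    simp
  refine ⟨he.isSubcoalgebra_map hC.1, fun h => hC.2.1 ?_, fun D hD hDs => ?_⟩
  · rw [← h2 C, h, Submodule.map_bot]
  · have := Submodule.map_mono (f := e.symm.toLinearMap) hD
    rw [h2] at this
    refine (hC.2.2 _ this (he.symm.isSubcoalgebra_map hDs)).imp (fun h => ?_) (fun h => ?_)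
    · rw [← h1 D, h, Submodule.map_bot]
    · rw [← h1 D, h]

theorem coradical_mem (he : PreservesComul e) {a : A} (ha : a ∈ coradical k A) :
    e a ∈ coradical k B := by
  have : coradical k A ≤ (coradical k B).comap e.toLinearMap :=
    sSup_le fun C hC => Submodule.map_le_iff_le_comap.1 (le_sSup (he.isSimpleSubcoalgebra_map hC))
  exact this ha

theorem coradFil_mem (he : PreservesComul e) (n : ℕ) :
    ∀ {a : A}, a ∈ coradFil k A n → e a ∈ coradFil k B n := by
  induction n with
  | zero => exact he.coradical_mem
  | succ n ih =>
    intro a ha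
    rw [coradFil, Submodule.mem_comap, he]
    refine Submodule.mem_comap.1 ((sup_le ?_ ?_ :
      LinearMap.range (TensorProduct.mapIncl (⊤ : Submodule k A) (coradFil k A n)) ⊔
        LinearMap.range (TensorProduct.mapIncl (coradical k A) (⊤ : Submodule k A)) ≤
      (LinearMap.range (TensorProduct.mapIncl (⊤ : Submodule k B) (coradFil k B n)) ⊔
        LinearMap.range (TensorProduct.mapIncl (coradical k B) (⊤ : Submodule k B))).comap
          (TensorProduct.map e.toLinearMap e.toLinearMap)) ha)
    · exact fun t ht => Submodule.mem_sup_left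
        (map_mem_range_mapIncl (fun _ _ => Submodule.mem_top) (fun q hq => ih hq) ht)
    · exact fun t ht => Submodule.mem_sup_right
        (map_mem_range_mapIncl (fun q hq => he.coradical_mem hq) (fun _ _ => Submodule.mem_top) ht)

include he in
theorem map_coradFil (n : ℕ) : (coradFil k A n).map e.toLinearMap = coradFil k B n := by
  refine le_antisymm ?_ fun b hb => ⟨e.symm b, he.symm.coradFil_mem n hb, by simp⟩
  rintro _ ⟨a, ha, rfl⟩
  exact he.coradFil_mem n ha

include he in
theorem map_coradFilPrev (n : ℕ) :
    (coradFilPrev k A n).map e.toLinearMap = coradFilPrev k B n := by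
  cases n with
  | zero => exact Submodule.map_bot _
  | succ n => exact he.map_coradFil n

/-- The isomorphism of the filtration steps. -/
def filEquiv (n : ℕ) : coradFil k A n ≃ₗ[k] coradFil k B n :=
  e.ofSubmodules _ _ (he.map_coradFil n)

/-- The isomorphism `gr A ≃ gr B`. -/
def grEquiv : Gr k A ≃ₗ[k] Gr k B :=
  DFinsupp.mapRange.linearEquiv fun n => Submodule.Quotient.equiv _ _ (he.filEquiv n) (by
    ext ⟨b, hb⟩
    constructor
    · rintro ⟨⟨a, ha⟩, ha', h⟩
      rw [← h]
      change e a ∈ coradFilPrev k B n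
      exact he.map_coradFilPrev n ▸ ⟨a, ha', rfl⟩
    · intro h
      have h' : b ∈ coradFilPrev k B n := h
      rw [← he.map_coradFilPrev n] at h'
      obtain ⟨a, ha, rfl⟩ := h'
      refine ⟨⟨a, ?_⟩, ha, rfl⟩
      rw [← he.map_coradFil n] at hb
      obtain ⟨a', ha', h⟩ := hb
      rwa [← e.injective h])

theorem grEquiv_symb (n : ℕ) (a : coradFil k A n) :
    he.grEquiv (symb k A n a) = symb k B n (he.filEquiv n a) := by
  simp only [symb, LinearMap.comp_apply, grEquiv, DirectSum.lof]
  erw [DFinsupp.mapRange.linearEquiv_apply, DFinsupp.lsingle_apply, DFinsupp.mapRange_single]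
  rfl

theorem coe_filEquiv (n : ℕ) (a : coradFil k A n) : (he.filEquiv n a : B) = e a := rfl

end PreservesComul

end GrEquiv

/-! ### Transport of bialgebra operations and of liftings -/

section Transport

/-- Bialgebra operations transported along a linear isomorphism. -/
def BialgOps.transport {k E E' : Type*} [Field k] [AddCommGroup E] [Module k E]
    [AddCommGroup E'] [Module k E'] (D : BialgOps k E) (ψ : E ≃ₗ[k] E') : BialgOps k E' where
  one := ψ D.one
  mul := ψ.toLinearMap ∘ₗ D.mul ∘ₗ TensorProduct.map ψ.symm.toLinearMap ψ.symm.toLinearMap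
  counit := D.counit ∘ₗ ψ.symm.toLinearMap
  comul := TensorProduct.map ψ.toLinearMap ψ.toLinearMap ∘ₗ D.comul ∘ₗ ψ.symm.toLinearMap

/-- Bialgebra operations with the opposite product. -/
def BialgOps.op {k E : Type*} [Field k] [AddCommGroup E] [Module k E] (D : BialgOps k E) :
    BialgOps k E where
  one := D.one
  mul := D.mul ∘ₗ (TensorProduct.comm k E E).toLinearMap
  counit := D.counit
  comul := D.comul

theorem BialgOps.IsIso.transport {k E E' E'' : Type*} [Field k] [AddCommGroup E] [Module k E]
    [AddCommGroup E'] [Module k E'] [AddCommGroup E''] [Module k E''] {D : BialgOps k E}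
    {D'' : BialgOps k E''} {φ : E ≃ₗ[k] E''} (h : D.IsIso D'' φ) (ψ : E ≃ₗ[k] E') :
    (D.transport ψ).IsIso D'' (ψ.symm.trans φ) where
  map_one := by simpa [BialgOps.transport] using h.map_one
  map_mul := by
    ext a b
    have := LinearMap.congr_fun h.map_mul (ψ.symm a ⊗ₜ ψ.symm b)
    simpa [BialgOps.transport] using this
  map_counit := by
    ext a
    have := LinearMap.congr_fun h.map_counit (ψ.symm a)
    simpa [BialgOps.transport] using this
  map_comul := by
    ext a
    have := LinearMap.congr_fun h.map_comul (ψ.symm a)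
    simp only [LinearMap.comp_apply, LinearEquiv.coe_coe] at this
    simp only [BialgOps.transport, LinearMap.comp_apply, LinearEquiv.coe_coe,
      LinearEquiv.trans_apply, ← this]
    rw [← LinearMap.comp_apply, ← TensorProduct.map_comp]
    congr 2 <;> ext <;> simp

theorem BialgOps.IsIso.op {k E E' : Type*} [Field k] [AddCommGroup E] [Module k E]
    [AddCommGroup E'] [Module k E'] {D : BialgOps k E} {D' : BialgOps k E'} {φ : E ≃ₗ[k] E'}
    (h : D.IsIso D' φ) : D.op.IsIso D'.op φ where
  map_one := h.map_one
  map_mul := by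
    ext a b
    exact LinearMap.congr_fun h.map_mul (b ⊗ₜ a)
  map_counit := h.map_counit
  map_comul := h.map_comul

theorem BialgOps.IsIso.trans {k E E' E'' : Type*} [Field k] [AddCommGroup E] [Module k E]
    [AddCommGroup E'] [Module k E'] [AddCommGroup E''] [Module k E''] {D : BialgOps k E}
    {D' : BialgOps k E'} {D'' : BialgOps k E''} {φ : E ≃ₗ[k] E'} {ψ : E' ≃ₗ[k] E''}
    (h : D.IsIso D' φ) (h' : D'.IsIso D'' ψ) : D.IsIso D'' (φ.trans ψ) where
  map_one := by simp [h.map_one, h'.map_one]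
  map_mul := by
    ext a b
    have h1 := LinearMap.congr_fun h.map_mul (a ⊗ₜ b)
    have h2 := LinearMap.congr_fun h'.map_mul (φ a ⊗ₜ φ b)
    simp only [LinearMap.comp_apply, LinearEquiv.coe_coe, TensorProduct.map_tmul] at h1 h2
    simp [h1, h2]
  map_counit := by
    rw [← h.map_counit, ← h'.map_counit]
    rfl
  map_comul := by
    have : TensorProduct.map (φ.trans ψ).toLinearMap (φ.trans ψ).toLinearMap =
        TensorProduct.map ψ.toLinearMap ψ.toLinearMap ∘ₗ
          TensorProduct.map φ.toLinearMap φ.toLinearMap := by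
      rw [← TensorProduct.map_comp]; rfl
    rw [this, LinearMap.comp_assoc, h.map_comul, ← LinearMap.comp_assoc, h'.map_comul]
    rfl

variable {k A B : Type*} [Field k] [Ring A] [Bialgebra k A] [Ring B] [Bialgebra k B]

/-- Compatibility of `e` with products is not assumed, and the product rule is a separate hypothesis
written with `e a * e b`. This allows `e` to be either an isomorphism or the identity map A → A^op,
which reverses products. -/
theorem IsInducedOnGr.of_equiv {e : A ≃ₗ[k] B} (he : PreservesComul e) (h1 : e 1 = 1)
    (hε : ∀ a, Coalgebra.counit (R := k) (e a) = Coalgebra.counit (R := k) a)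
    {D : BialgOps k (Gr k A)} (hD : IsInducedOnGr k A D) {D' : BialgOps k (Gr k B)}
    (hone : D'.one = he.grEquiv D.one) (hcounit : ∀ a, D'.counit (he.grEquiv a) = D.counit a)
    (hcomul : ∀ a, D'.comul (he.grEquiv a) =
      TensorProduct.map he.grEquiv.toLinearMap he.grEquiv.toLinearMap (D.comul a))
    (hmul : ∀ (m n : ℕ) (a : coradFil k A m) (b : coradFil k A n),
      ∃ h : (e a * e b : B) ∈ coradFil k B (m + n),
        D'.mul (he.grEquiv (symb k A m a) ⊗ₜ he.grEquiv (symb k A n b)) =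
          symb k B (m + n) ⟨e a * e b, h⟩) : IsInducedOnGr k B D' where
  one := by
    obtain ⟨h, h'⟩ := hD.one
    refine ⟨h1 ▸ he.coradFil_mem 0 h, ?_⟩
    rw [hone, h', he.grEquiv_symb]
    congr 1
    exact Subtype.ext h1
  mul m n a b := by
    obtain ⟨a, rfl⟩ := (he.filEquiv m).surjective a
    obtain ⟨b, rfl⟩ := (he.filEquiv n).surjective b
    rw [← he.grEquiv_symb, ← he.grEquiv_symb]
    exact hmul m n a b
  counit n a := by
    obtain ⟨a, rfl⟩ := (he.filEquiv n).surjective a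
    rw [← he.grEquiv_symb, hcounit, hD.counit, he.coe_filEquiv, hε]
  comul n a := by
    obtain ⟨a, rfl⟩ := (he.filEquiv n).surjective a
    obtain ⟨t, h, h'⟩ := hD.comul n a
    refine ⟨fun p => TensorProduct.map (he.filEquiv p.1).toLinearMap
      (he.filEquiv p.2).toLinearMap (t p), ?_, ?_⟩
    · rw [he.coe_filEquiv, he, h, map_sum]
      refine Finset.sum_congr rfl fun p _ => ?_
      simp only [TensorProduct.mapIncl, ← LinearMap.comp_apply, ← TensorProduct.map_comp]
      rfl
    · rw [← he.grEquiv_symb, hcomul, h', map_sum]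
      refine Finset.sum_congr rfl fun p _ => ?_
      simp only [← LinearMap.comp_apply, ← TensorProduct.map_comp]
      congr 2 <;> exact LinearMap.ext fun a => he.grEquiv_symb _ a

theorem IsHopf.of_equiv (e : A ≃ₐc[k] B) (h : IsHopf k A) : IsHopf k B := by
  obtain ⟨S, h1, h2⟩ := h
  let e₀ : A ≃ₗ[k] B := (e : A ≃ₐ[k] B).toLinearEquiv
  have hc : ∀ a, Coalgebra.comul (R := k) (e a) =
      TensorProduct.map e₀.toLinearMap e₀.toLinearMap (Coalgebra.comul a) :=
    fun a => (CoalgHomClass.map_comp_comul_apply e a).symm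
  have hε : ∀ a, Coalgebra.counit (R := k) (e a) = Coalgebra.counit (R := k) a :=
    fun a => CoalgHomClass.counit_comp_apply e a
  let T : B →ₗ[k] B := e₀.toLinearMap ∘ₗ S ∘ₗ e₀.symm.toLinearMap
  have key : ∀ t : A ⊗[k] A, LinearMap.mul' k B (T.rTensor B (TensorProduct.map e₀.toLinearMap
      e₀.toLinearMap t)) = e (LinearMap.mul' k A (S.rTensor A t)) ∧
      LinearMap.mul' k B (T.lTensor B (TensorProduct.map e₀.toLinearMap
      e₀.toLinearMap t)) = e (LinearMap.mul' k A (S.lTensor A t)) := by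
    intro t
    induction t with
    | zero => simp
    | add x y hx hy => simp only [map_add, hx, hy, and_self]
    | tmul a b =>
      have h : ∀ x, e₀ x = e x := fun _ => rfl
      have h' : ∀ x, e₀.symm (e x) = x := e₀.symm_apply_apply
      simp [T, h, h']
  refine ⟨T, ?_, ?_⟩ <;> ext b <;> obtain ⟨a, rfl⟩ := EquivLike.surjective e b
  · have := LinearMap.congr_fun h1 a
    simp only [LinearMap.comp_apply] at this ⊢
    rw [hc, (key _).1, this, hε]
    exact AlgHomClass.commutes e _
  · have := LinearMap.congr_fun h2 a
    simp only [LinearMap.comp_apply] at this ⊢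
    rw [hc, (key _).2, this, hε]
    exact AlgHomClass.commutes e _

/-- Being a lifting is invariant under isomorphisms. -/
theorem IsLifting.of_equiv {H M : Type*} [Ring H] [HopfAlgebra k H] [AddCommGroup M] [Module k M]
    {V : YDModule k H M} (e : A ≃ₐc[k] B) (h : IsLifting V A) : IsLifting V B := by
  obtain ⟨hH, D, hD, φ, hφ⟩ := h
  let e₀ : A ≃ₗ[k] B := (e : A ≃ₐ[k] B).toLinearEquiv
  have he : PreservesComul e₀ := fun a => (CoalgHomClass.map_comp_comul_apply e a).symm
  have hψ := hφ.transport (E' := Gr k B) he.grEquiv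
  refine ⟨hH.of_equiv e, D.transport he.grEquiv, ?_, _, hψ⟩
  refine hD.of_equiv he (map_one e) (fun a => CoalgHomClass.counit_comp_apply e a) rfl
    (fun a => by simp [BialgOps.transport]) (fun a => by simp [BialgOps.transport]) ?_
  intro m n a b
  obtain ⟨h, h'⟩ := hD.mul m n a b
  have hm : e₀ (a * b) = e₀ a * e₀ b := map_mul e _ _
  refine ⟨hm ▸ he.coradFil_mem _ h, ?_⟩
  simp only [BialgOps.transport, LinearMap.comp_apply, TensorProduct.map_tmul, LinearEquiv.coe_coe,
    LinearEquiv.symm_apply_apply, h']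
  rw [he.grEquiv_symb]
  congr 1
  exact Subtype.ext hm

/-- The opposite of a lifting `A` is a lifting as soon as it is a Hopf algebra and its bosonization
is the opposite of that of `A`. -/
theorem IsLifting.op {H M M' : Type*} [Ring H] [HopfAlgebra k H] [AddCommGroup M] [Module k M]
    [AddCommGroup M'] [Module k M'] {V : YDModule k H M} {V' : YDModule k H M'}
    {θ : V.Nichols ⊗[k] H ≃ₗ[k] V'.Nichols ⊗[k] H} (hθ : V.bosonization.op.IsIso V'.bosonization θ)
    (h : IsLifting V A) (hop : IsHopf k (Op A)) : IsLifting V' (Op A) := by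
  obtain ⟨hH, D, hD, φ, hφ⟩ := h
  have he : PreservesComul (Op.linearEquiv k A) := fun a => rfl
  have hψ := (hφ.op.trans hθ).transport (E' := Gr k (Op A)) he.grEquiv
  refine ⟨hop, D.op.transport he.grEquiv, ?_, _, hψ⟩
  refine hD.of_equiv he rfl (fun a => rfl) rfl
    (fun a => by simp [BialgOps.transport, BialgOps.op])
    (fun a => by simp [BialgOps.transport, BialgOps.op]) ?_
  intro m n a b
  obtain ⟨h, h'⟩ := hD.mul n m b a
  -- In A^op the product of classes of degrees m and n is the class of b a, of degree n + m.
  rw [add_comm m n]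
  refine ⟨he.coradFil_mem _ h, ?_⟩
  simp only [BialgOps.transport, BialgOps.op, LinearMap.comp_apply, TensorProduct.map_tmul,
    LinearEquiv.coe_coe, LinearEquiv.symm_apply_apply, TensorProduct.comm_tmul, h']
  rw [he.grEquiv_symb]
  rfl

end Transport
end HopfLift
namespace HopfLift

/-! ### The antipode as an isomorphism `A^cop ≃ A^op` -/

section Antipode

open HopfAlgebra in
/-- The antipode reverses the comultiplication. -/
theorem comul_antipode {k A : Type*} [Field k] [Ring A] [HopfAlgebra k A] (a : A) :
    Coalgebra.comul (R := k) (antipode k a) =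
      TensorProduct.map (antipode k) (antipode k)
        (TensorProduct.comm k A A (Coalgebra.comul a)) := by
  -- In the convolution algebra Hom(A, A ⊗ A), `G` is a left inverse of Δ, while Δ ∘ S is a right
  -- inverse; so they coincide.
  let G : A →ₗ[k] A ⊗[k] A := TensorProduct.map (antipode k) (antipode k) ∘ₗ
    (TensorProduct.comm k A A).toLinearMap ∘ₗ Coalgebra.comul
  have h1 : WithConv.toConv G * WithConv.toConv (Coalgebra.comul (R := k) (A := A)) = 1 := by
    apply WithConv.ext
    apply LinearMap.ext
    intro a
    let μ := LinearMap.mul' k A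
    let S : A →ₗ[k] A := antipode k
    -- The convolution G * Δ evaluates to S(a₂) a₃ ⊗ S(a₁) a₄. The inner pair collapses first, then
    -- the outer one.
    obtain ⟨Q, hQ⟩ : ∃ Q : A ⊗[k] (A ⊗[k] (A ⊗[k] A)) →ₗ[k] A ⊗[k] A, ∀ p q r s,
        Q (p ⊗ₜ (q ⊗ₜ (r ⊗ₜ s))) = (S q * r) ⊗ₜ (S p * s) :=
      ⟨TensorProduct.map (μ ∘ₗ S.rTensor A) (μ ∘ₗ S.rTensor A) ∘ₗ
        (TensorProduct.leftComm k A (A ⊗[k] A) A).toLinearMap ∘ₗ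
        ((TensorProduct.assoc k A A A).symm.toLinearMap).lTensor A, fun p q r s => by simp [μ]⟩
    have h2 : ∀ t : A ⊗[k] A, LinearMap.mul' k (A ⊗[k] A)
        (TensorProduct.map G (Coalgebra.comul (R := k)) t) =
        Q (((Coalgebra.comul (R := k)).lTensor A).lTensor A
          (TensorProduct.assoc k A A A ((Coalgebra.comul (R := k)).rTensor A t))) := by
      intro t
      induction t with
      | zero => simp
      | add x y hx hy => simp only [map_add, hx, hy]
      | tmul a b =>
        simp only [TensorProduct.map_tmul, LinearMap.rTensor_tmul, G, LinearMap.comp_apply,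
          LinearEquiv.coe_coe]
        generalize Coalgebra.comul (R := k) a = s
        induction s with
        | zero => simp
        | add x y hx hy => simp only [map_add, add_tmul, hx, hy]
        | tmul p q =>
          simp only [TensorProduct.assoc_tmul, LinearMap.lTensor_tmul]
          generalize Coalgebra.comul (R := k) b = r
          induction r with
          | zero => simp
          | add x y hx hy => simp only [map_add, tmul_add, hx, hy]
          | tmul r s => simp [hQ, S]
    have h3 : ∀ t : A ⊗[k] A, Q (((Coalgebra.comul (R := k)).lTensor A ∘ₗ
        Coalgebra.comul).lTensor A t) = 1 ⊗ₜ μ (S.rTensor A t) := by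
      intro t
      induction t with
      | zero => simp
      | add x y hx hy => simp only [map_add, tmul_add, hx, hy]
      | tmul a b =>
        rw [LinearMap.lTensor_tmul, LinearMap.comp_apply, ← Coalgebra.coassoc_apply]
        have h4 : ∀ t : A ⊗[k] A, Q (a ⊗ₜ TensorProduct.assoc k A A A
            ((Coalgebra.comul (R := k)).rTensor A t)) =
            1 ⊗ₜ μ (S a ⊗ₜ TensorProduct.lid k A ((Coalgebra.counit (R := k)).rTensor A t)) := by
          intro t
          induction t with
          | zero => simp
          | add x y hx hy => simp only [map_add, tmul_add, hx, hy]
          | tmul p q =>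
            have h5 : ∀ s : A ⊗[k] A, Q (a ⊗ₜ TensorProduct.assoc k A A A (s ⊗ₜ q)) =
                μ (S.rTensor A s) ⊗ₜ (S a * q) := by
              intro s
              induction s with
              | zero => simp
              | add x y hx hy => simp only [map_add, tmul_add, add_tmul, hx, hy]
              | tmul p q => simp [hQ, μ]
            rw [LinearMap.rTensor_tmul, h5, mul_antipode_rTensor_comul_apply,
              Algebra.algebraMap_eq_smul_one]
            simp [μ, smul_tmul]
        rw [h4, Coalgebra.rTensor_counit_comul]
        simp
    refine (h2 _).trans ?_
    rw [Coalgebra.coassoc_apply, ← LinearMap.lTensor_comp_apply, h3,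
      mul_antipode_rTensor_comul_apply, Algebra.algebraMap_eq_smul_one]
    change _ = algebraMap k (A ⊗[k] A) (Coalgebra.counit a)
    rw [Algebra.algebraMap_eq_smul_one, Algebra.TensorProduct.one_def, tmul_smul]
  have h2 := left_inv_eq_right_inv h1 LinearMap.comul_right_inv
  exact (LinearMap.congr_fun (congrArg WithConv.ofConv h2) a).symm

-- Applying S to T(a₂) a₁ = ε(a) gives S(a₁) S(T(a₂)) = ε(a). So S ∘ T is a right convolution
-- inverse of S, whose left inverse is the identity.
open HopfAlgebra in
theorem antipode_apply_of_skew {k A : Type*} [Field k] [Ring A] [HopfAlgebra k A] (T : A →ₗ[k] A)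
    (hT : ∀ a : A, LinearMap.mul' k A (T.rTensor A (TensorProduct.comm k A A
      (Coalgebra.comul (R := k) a))) = algebraMap k A (Coalgebra.counit a)) (a : A) :
    antipode k (T a) = a := by
  have h1 : WithConv.toConv (antipode k (A := A)) * WithConv.toConv (antipode k ∘ₗ T) = 1 := by
    apply WithConv.ext
    apply LinearMap.ext
    intro a
    have : ∀ t : A ⊗[k] A, LinearMap.mul' k A (TensorProduct.map (antipode k) (antipode k ∘ₗ T) t) =
        antipode k (LinearMap.mul' k A (T.rTensor A (TensorProduct.comm k A A t))) := by
      intro t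
      induction t with
      | zero => simp
      | add x y hx hy => simp only [map_add, hx, hy]
      | tmul p q => simp [antipode_mul_antidistrib]
    refine (this _).trans ?_
    rw [hT, Algebra.algebraMap_eq_smul_one, map_smul, antipode_one]
    exact (Algebra.algebraMap_eq_smul_one _).symm
  have h2 : WithConv.toConv (LinearMap.id (R := k) (M := A)) *
    WithConv.toConv (antipode k (A := A)) = 1 := LinearMap.id_mul_antipode
  exact (LinearMap.congr_fun (congrArg WithConv.ofConv (left_inv_eq_right_inv h2 h1)) a).symm

/-- The Hopf algebra structure given by an antipode. -/
@[reducible]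
def IsHopf.hopfAlgebra {k A : Type*} [Field k] [Ring A] [i : Bialgebra k A] (h : IsHopf k A) :
    HopfAlgebra k A where
  __ := i
  antipode := h.choose
  mul_antipode_rTensor_comul := h.choose_spec.1
  mul_antipode_lTensor_comul := h.choose_spec.2

variable {k A : Type*} [Field k] [Ring A] [Bialgebra k A]

/-- If `A` and `A^op` are Hopf algebras, then `A^cop` and `A^op` are isomorphic. -/
theorem nonempty_cop_equiv_op (h : IsHopf k A) (h' : IsHopf k (Op A)) :
    Nonempty (Cop A ≃ₐc[k] Op A) := by
  let i₁ : HopfAlgebra k A := h.hopfAlgebra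
  let i₂ : HopfAlgebra k (Op A) := h'.hopfAlgebra
  let o := Op.linearEquiv k A
  let S : A →ₗ[k] A := HopfAlgebra.antipode k
  -- Read on `A`, the antipode of A^op satisfies T(a₂) a₁ = ε(a): it is a skew antipode of `A`.
  let T : A →ₗ[k] A := o.symm.toLinearMap ∘ₗ HopfAlgebra.antipode k ∘ₗ o.toLinearMap
  have hST : ∀ a, S (T a) = a := by
    refine antipode_apply_of_skew T fun a => ?_
    have h1 := HopfAlgebra.mul_antipode_lTensor_comul_apply (R := k) (o a)
    have h2 : ∀ t : A ⊗[k] A, LinearMap.mul' k (Op A) ((HopfAlgebra.antipode k).lTensor (Op A)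
        (TensorProduct.map o.toLinearMap o.toLinearMap t)) =
        o (LinearMap.mul' k A (T.rTensor A (TensorProduct.comm k A A t))) := by
      intro t
      induction t with
      | zero => simp
      | add x y hx hy => simp only [map_add, hx, hy]
      | tmul p q => simp [T, o, Op.linearEquiv_mul]
    exact o.injective ((h2 _).symm.trans h1)
  -- Same argument with the roles exchanged: `S` is a skew antipode of A^op.
  have hTS : ∀ a, T (S a) = a := by
    intro a
    have h1 : ∀ b : Op A, HopfAlgebra.antipode k ((o.toLinearMap ∘ₗ S ∘ₗ o.symm.toLinearMap) b) =
        b := by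
      refine antipode_apply_of_skew _ fun b => ?_
      obtain ⟨a, rfl⟩ := o.surjective b
      have h1 := HopfAlgebra.mul_antipode_lTensor_comul_apply (R := k) a
      have h2 : ∀ t : A ⊗[k] A, LinearMap.mul' k (Op A)
          ((o.toLinearMap ∘ₗ S ∘ₗ o.symm.toLinearMap).rTensor (Op A)
            (TensorProduct.comm k (Op A) (Op A)
              (TensorProduct.map o.toLinearMap o.toLinearMap t))) =
          o (LinearMap.mul' k A (S.lTensor A t)) := by
        intro t
        induction t with
        | zero => simp
        | add x y hx hy => simp only [map_add, hx, hy]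
        | tmul p q => simp [o, Op.linearEquiv_mul]
      exact (h2 _).trans (congrArg o h1)
    exact o.injective (h1 (o a))
  let c := Cop.equiv k A
  let s : A ≃ₗ[k] A := { S with invFun := T, left_inv := hTS, right_inv := hST }
  -- The antipode reverses products and coproducts, so between A^cop and A^op it preserves both.
  let L : Cop A ≃ₗ[k] Op A := c.symm.toLinearEquiv.trans (s.trans o)
  refine ⟨BialgEquiv.ofAlgEquiv (AlgEquiv.ofLinearEquiv L ?_ ?_) ?_ ?_⟩
  · exact congrArg o HopfAlgebra.antipode_one
  · intro a b
    exact congrArg o (HopfAlgebra.antipode_mul_antidistrib (R := k) (A := A) a b)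
  · ext x
    obtain ⟨a, rfl⟩ := c.surjective x
    exact HopfAlgebra.counit_antipode a
  · apply AlgHom.toLinearMap_injective
    apply LinearMap.ext
    intro x
    obtain ⟨a, rfl⟩ := c.surjective x
    change TensorProduct.map L.toLinearMap L.toLinearMap
      (TensorProduct.map c.toLinearMap c.toLinearMap
        (TensorProduct.comm k A A (Coalgebra.comul a))) =
      TensorProduct.map o.toLinearMap o.toLinearMap (Coalgebra.comul (S a))
    rw [comul_antipode]
    simp only [← LinearMap.comp_apply, ← TensorProduct.map_comp]
    rfl

end Antipode
end HopfLift
namespace HopfLift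

/-! ### The smash product `T(V) # H` -/

section SmashMul

variable {k H B : Type*} [Field k] [Ring H] [Bialgebra k H] [Ring B] [Algebra k B]

/-- Stated for an arbitrary bilinear `act` because it is needed both for T(V) and for B(V). -/
theorem smashMul_tmul (act : H →ₗ[k] B →ₗ[k] B) (x y : B) (h f : H) :
    TensorProduct.map (LinearMap.mul' k B) (LinearMap.mul' k H)
      (applyMiddle (actFlip act) ((x ⊗ₜ h) ⊗ₜ (y ⊗ₜ f))) =
    TensorProduct.map (LinearMap.mulLeft k x ∘ₗ act.flip y) (LinearMap.mulRight k f)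
      (Coalgebra.comul (R := k) h) := by
  simp only [applyMiddle, LinearMap.comp_apply, LinearEquiv.coe_coe, TensorProduct.assoc_tmul,
    LinearMap.lTensor_tmul, TensorProduct.assoc_symm_tmul, LinearMap.rTensor_tmul, actFlip_tmul]
  generalize Coalgebra.comul (R := k) h = t
  induction t with
  | zero => simp
  | add a b ha hb => simp only [map_add, add_tmul, tmul_add, ha, hb]
  | tmul a b => simp

end SmashMul

namespace YDModule

variable {k H M : Type*} [Field k] [Ring H] [HopfAlgebra k H] [AddCommGroup M] [Module k M]
  (V : YDModule k H M)

theorem tensorAct_one_right (h : H) :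
    V.tensorAct h 1 = Coalgebra.counit (R := k) h • (1 : TensorAlgebra k M) := by
  rw [← Algebra.algebraMap_eq_smul_one]
  change (V.tensorActHom 1).ofConv h = _
  rw [map_one]
  rfl

theorem tensorAct_ι (h : H) (m : M) :
    V.tensorAct h (TensorAlgebra.ι k m) = TensorAlgebra.ι k (V.act h m) := by
  change (V.tensorActHom (TensorAlgebra.ι k m)).ofConv h = _
  rw [tensorActHom, TensorAlgebra.lift_ι_apply]
  rfl

theorem tensorAct_mul_right (h : H) (x y : TensorAlgebra k M) :
    V.tensorAct h (x * y) = LinearMap.mul' k (TensorAlgebra k M)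
      (TensorProduct.map (V.tensorAct.flip x) (V.tensorAct.flip y)
        (Coalgebra.comul (R := k) h)) := by
  change (V.tensorActHom (x * y)).ofConv h = _
  rw [map_mul]
  rfl

theorem tensorAct_algebraMap (h : H) (c : k) : V.tensorAct h (algebraMap k _ c) =
    Coalgebra.counit (R := k) h • algebraMap k (TensorAlgebra k M) c := by
  rw [Algebra.algebraMap_eq_smul_one, map_smul, tensorAct_one_right, smul_comm]

theorem tensorAct_one (x : TensorAlgebra k M) : V.tensorAct 1 x = x := by
  induction x using TensorAlgebra.induction with
  | algebraMap c => rw [tensorAct_algebraMap, Bialgebra.counit_one, one_smul]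
  | ι m => rw [tensorAct_ι, map_one]; rfl
  | mul x y hx hy =>
    rw [tensorAct_mul_right, Bialgebra.comul_one, Algebra.TensorProduct.one_def]
    simp [hx, hy]
  | add x y hx hy => rw [map_add, hx, hy]

theorem tensorAct_mul (h g : H) (x : TensorAlgebra k M) :
    V.tensorAct (h * g) x = V.tensorAct h (V.tensorAct g x) := by
  induction x using TensorAlgebra.induction generalizing h g with
  | algebraMap c =>
    simp only [tensorAct_algebraMap, map_smul, Bialgebra.counit_mul, smul_smul, mul_comm]
  | ι m => simp only [tensorAct_ι, map_mul, Module.End.mul_apply]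
  | mul x y hx hy =>
    rw [tensorAct_mul_right, tensorAct_mul_right, Bialgebra.comul_mul]
    generalize Coalgebra.comul (R := k) g = t
    induction t with
    | zero => simp
    | add a b ha hb => simp only [map_add, mul_add, ha, hb]
    | tmul c d =>
      simp only [TensorProduct.map_tmul, LinearMap.mul'_apply, LinearMap.flip_apply,
        tensorAct_mul_right]
      generalize Coalgebra.comul (R := k) h = s
      induction s with
      | zero => simp
      | add a b ha hb => simp only [map_add, add_mul, ha, hb]
      | tmul a b => simp [hx, hy]
  | add x y hx hy => simp only [map_add, hx, hy]

/-- The smash product `T(V) # H`. -/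
def Smash (_ : YDModule k H M) : Type _ := TensorAlgebra k M ⊗[k] H

namespace Smash

instance : AddCommGroup V.Smash := inferInstanceAs (AddCommGroup (TensorAlgebra k M ⊗[k] H))

instance : Module k V.Smash := inferInstanceAs (Module k (TensorAlgebra k M ⊗[k] H))

/-- The element `x # h`. -/
def mk (x : TensorAlgebra k M) (h : H) : V.Smash := (x ⊗ₜ[k] h : TensorAlgebra k M ⊗[k] H)

/-- The linear identification with the tensor product. -/
def toTensor : V.Smash ≃ₗ[k] TensorAlgebra k M ⊗[k] H := LinearEquiv.refl k _

@[simp]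
theorem toTensor_mk (x : TensorAlgebra k M) (h : H) : toTensor V (mk V x h) = x ⊗ₜ h := rfl

@[simp]
theorem toTensor_symm_tmul (x : TensorAlgebra k M) (h : H) :
    (toTensor V).symm (x ⊗ₜ h) = mk V x h := rfl

/-- The product of `T(V) # H`. -/
def mulLin : V.Smash →ₗ[k] V.Smash →ₗ[k] V.Smash :=
  TensorProduct.curry (TensorProduct.map (LinearMap.mul' k (TensorAlgebra k M))
    (LinearMap.mul' k H) ∘ₗ applyMiddle (actFlip V.tensorAct))

variable {V} in
theorem mk_induction {p : V.Smash → Prop} (zero : p 0) (mk : ∀ x h, p (mk V x h))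
    (add : ∀ a b, p a → p b → p (a + b)) (a : V.Smash) : p a := by
  refine TensorProduct.induction_on (R := k) (motive := p) a zero mk add

theorem mulLin_mk (x y : TensorAlgebra k M) (h f : H) : mulLin V (mk V x h) (mk V y f) =
    (toTensor V).symm (TensorProduct.map (LinearMap.mulLeft k x ∘ₗ V.tensorAct.flip y)
      (LinearMap.mulRight k f) (Coalgebra.comul (R := k) h)) :=
  smashMul_tmul V.tensorAct x y h f

theorem mulLin_assoc (a b c : V.Smash) :
    mulLin V (mulLin V a b) c = mulLin V a (mulLin V b c) := by
  induction a using mk_induction with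
  | zero => simp
  | add a a' ha ha' => simp only [map_add, LinearMap.add_apply, ha, ha']
  | mk x h =>
  induction b using mk_induction with
  | zero => simp
  | add a a' ha ha' => simp only [map_add, LinearMap.add_apply, ha, ha']
  | mk y f =>
  induction c using mk_induction with
  | zero => simp
  | add a a' ha ha' => simp only [map_add, ha, ha']
  | mk z g =>
  -- Both bracketings are x (h₁ · y) (h₂f₁ · z) # h₃f₂g. The map `Q` multiplies out once the
  -- coproducts are taken, and coassociativity matches the two ways of splitting h.
  obtain ⟨Q, hQ⟩ : ∃ Q : H ⊗[k] (H ⊗[k] H) →ₗ[k] TensorAlgebra k M ⊗[k] H, ∀ a b c,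
      Q (a ⊗ₜ (b ⊗ₜ c)) = (x * V.tensorAct a y * V.tensorAct b z) ⊗ₜ (c * g) :=
    ⟨TensorProduct.map (LinearMap.mul' k _ ∘ₗ
        TensorProduct.map (LinearMap.mulLeft k x ∘ₗ V.tensorAct.flip y) (V.tensorAct.flip z))
        (LinearMap.mulRight k g) ∘ₗ (TensorProduct.assoc k H H H).symm.toLinearMap,
      fun a b c => by simp⟩
  have h1 : ∀ t : H ⊗[k] H, mulLin V ((toTensor V).symm (TensorProduct.map (LinearMap.mulLeft k x ∘ₗ
      V.tensorAct.flip y) (LinearMap.mulRight k f) t)) (mk V z g) =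
      (toTensor V).symm (Q ((Coalgebra.comul (R := k)).lTensor H t *
        (1 ⊗ₜ Coalgebra.comul (R := k) f))) := by
    intro t
    induction t with
    | zero => simp
    | add a b ha hb => simp only [map_add, LinearMap.add_apply, add_mul, ha, hb]
    | tmul a b =>
      simp only [TensorProduct.map_tmul, toTensor_symm_tmul, mulLin_mk, LinearMap.mulRight_apply,
        Bialgebra.comul_mul, LinearMap.lTensor_tmul, Algebra.TensorProduct.tmul_mul_tmul, mul_one]
      generalize Coalgebra.comul (R := k) b * Coalgebra.comul (R := k) f = s
      induction s with
      | zero => simp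
      | add a b ha hb => simp only [map_add, tmul_add, ha, hb]
      | tmul a b => simp [hQ, mul_assoc]
  have h2 : ∀ s : H ⊗[k] H, mulLin V (mk V x h) ((toTensor V).symm (TensorProduct.map
      (LinearMap.mulLeft k y ∘ₗ V.tensorAct.flip z) (LinearMap.mulRight k g) s)) =
      (toTensor V).symm (Q (TensorProduct.assoc k H H H ((Coalgebra.comul (R := k)).rTensor H
        (Coalgebra.comul (R := k) h)) * (1 ⊗ₜ s))) := by
    intro s
    induction s with
    | zero => simp
    | add a b ha hb => simp only [map_add, mul_add, tmul_add, ha, hb]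
    | tmul a b =>
      simp only [TensorProduct.map_tmul, toTensor_symm_tmul, mulLin_mk]
      generalize Coalgebra.comul (R := k) h = t
      induction t with
      | zero => simp
      | add a b ha hb => simp only [map_add, add_mul, ha, hb]
      | tmul c d =>
        simp only [TensorProduct.map_tmul, LinearMap.comp_apply, LinearMap.flip_apply,
          LinearMap.mulLeft_apply, LinearMap.mulRight_apply, tensorAct_mul_right,
          LinearMap.rTensor_tmul]
        generalize Coalgebra.comul (R := k) c = u
        induction u with
        | zero => simp
        | add a b ha hb => simp only [map_add, add_mul, mul_add, add_tmul, ha, hb]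
        | tmul c d => simp [hQ, mul_assoc, tensorAct_mul]
  rw [mulLin_mk, mulLin_mk, h1, h2, Coalgebra.coassoc_apply]

/-- The copy `Smash` is used because T(V) ⊗ H already carries the componentwise product. -/
instance : Ring V.Smash where
  __ := (inferInstance : AddCommGroup V.Smash)
  one := mk V 1 1
  mul a b := mulLin V a b
  left_distrib a b c := map_add (mulLin V a) b c
  right_distrib a b c := LinearMap.map_add₂ (mulLin V) a b c
  zero_mul a := LinearMap.map_zero₂ (mulLin V) a
  mul_zero a := map_zero (mulLin V a)
  mul_assoc := mulLin_assoc V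
  one_mul a := by
    change mulLin V (mk V 1 1) a = a
    induction a using mk_induction with
    | zero => simp
    | add a b ha hb => rw [map_add, ha, hb]
    | mk x h =>
      rw [mulLin_mk, Bialgebra.comul_one, Algebra.TensorProduct.one_def]
      simp [tensorAct_one]
  mul_one a := by
    change mulLin V a (mk V 1 1) = a
    induction a using mk_induction with
    | zero => simp
    | add a b ha hb => rw [map_add, LinearMap.add_apply, ha, hb]
    | mk x h =>
      rw [mulLin_mk]
      have : ∀ t : H ⊗[k] H, TensorProduct.map (LinearMap.mulLeft k x ∘ₗ V.tensorAct.flip 1)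
          (LinearMap.mulRight k 1) t = x ⊗ₜ TensorProduct.lid k H
            ((Coalgebra.counit (R := k)).rTensor H t) := by
        intro t
        induction t with
        | zero => simp
        | add a b ha hb => simp only [map_add, tmul_add, ha, hb]
        | tmul a b => simp [tensorAct_one_right, smul_tmul]
      rw [this, Coalgebra.rTensor_counit_comul]
      simp

instance : Algebra k V.Smash :=
  Algebra.ofModule (fun r a b => LinearMap.map_smul₂ (mulLin V) r a b)
    (fun r a b => map_smul (mulLin V a) r b)

theorem one_def : (1 : V.Smash) = mk V 1 1 := rfl

theorem mk_mul_mk (x y : TensorAlgebra k M) (h f : H) : mk V x h * mk V y f =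
    (toTensor V).symm (TensorProduct.map (LinearMap.mulLeft k x ∘ₗ V.tensorAct.flip y)
      (LinearMap.mulRight k f) (Coalgebra.comul (R := k) h)) := mulLin_mk V x y h f

/-- The embedding `x ↦ x # 1` of `T(V)`. -/
def inl : TensorAlgebra k M →ₐ[k] V.Smash :=
  AlgHom.ofLinearMap ((toTensor V).symm.toLinearMap ∘ₗ (TensorProduct.mk k _ H).flip 1) rfl
    (by
      intro x y
      change mk V (x * y) 1 = mk V x 1 * mk V y 1
      rw [mk_mul_mk, Bialgebra.comul_one, Algebra.TensorProduct.one_def]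
      simp [tensorAct_one])

/-- The embedding `h ↦ 1 # h` of `H`. -/
def inr : H →ₐ[k] V.Smash :=
  AlgHom.ofLinearMap ((toTensor V).symm.toLinearMap ∘ₗ TensorProduct.mk k _ H 1) rfl
    (by
      intro h f
      change mk V 1 (h * f) = mk V 1 h * mk V 1 f
      rw [mk_mul_mk]
      have : ∀ t : H ⊗[k] H, TensorProduct.map (LinearMap.mulLeft k 1 ∘ₗ V.tensorAct.flip 1)
          (LinearMap.mulRight k f) t = 1 ⊗ₜ (TensorProduct.lid k H
            ((Coalgebra.counit (R := k)).rTensor H t) * f) := by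
        intro t
        induction t with
        | zero => simp
        | add a b ha hb => simp only [map_add, tmul_add, add_mul, ha, hb]
        | tmul a b => simp [tensorAct_one_right, smul_tmul]
      rw [this, Coalgebra.rTensor_counit_comul]
      simp)

theorem inl_apply (x : TensorAlgebra k M) : inl V x = mk V x 1 := rfl

theorem inr_apply (h : H) : inr V h = mk V 1 h := rfl

theorem inl_mul_mk (x y : TensorAlgebra k M) (h : H) : inl V x * mk V y h = mk V (x * y) h := by
  rw [inl_apply, mk_mul_mk, Bialgebra.comul_one, Algebra.TensorProduct.one_def]
  simp [tensorAct_one]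

theorem inl_mul_inr (x : TensorAlgebra k M) (h : H) : inl V x * inr V h = mk V x h := by
  rw [inr_apply, inl_mul_mk, mul_one]

theorem inr_mul_mk (x : TensorAlgebra k M) (h f : H) : inr V h * mk V x f =
    (toTensor V).symm (TensorProduct.map (V.tensorAct.flip x)
      (LinearMap.mulRight k f) (Coalgebra.comul (R := k) h)) := by
  rw [inr_apply, mk_mul_mk, LinearMap.mulLeft_one, LinearMap.id_comp]

theorem mk_mul_inr (x : TensorAlgebra k M) (h f : H) : mk V x h * inr V f = mk V x (h * f) := by
  rw [← inl_mul_inr, mul_assoc, ← map_mul, inl_mul_inr]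

variable {V} in
/-- `T(V) # H` is generated by `V` and `H`. -/
theorem induction {p : V.Smash → Prop} (ι : ∀ m, p (inl V (TensorAlgebra.ι k m)))
    (inr : ∀ h, p (inr V h)) (add : ∀ a b, p a → p b → p (a + b))
    (mul : ∀ a b, p a → p b → p (a * b)) (a : V.Smash) : p a := by
  induction a using mk_induction with
  | zero => simpa using inr 0
  | add a b ha hb => exact add a b ha hb
  | mk x h =>
    rw [← inl_mul_inr]
    refine mul _ _ ?_ (inr h)
    induction x using TensorAlgebra.induction with
    | algebraMap c =>
      rw [AlgHom.commutes, ← AlgHom.commutes (Smash.inr V)]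
      exact inr _
    | ι m => exact ι m
    | mul x y hx hy => rw [map_mul]; exact mul _ _ hx hy
    | add x y hx hy => rw [map_add]; exact add _ _ hx hy

/-! ### Universal property of the smash product -/

section Lift

variable {C : Type*} [Ring C] [Algebra k C] (f : TensorAlgebra k M →ₐ[k] C) (g : H →ₐ[k] C)

/-- The commutation rule passes to products: moving h past x and then past y splits h twice, and
coassociativity regroups the first two pieces into the action on x y. So it need only be checked on
V. -/
theorem lift_relation (hfg : ∀ h m, g h * f (TensorAlgebra.ι k m) = LinearMap.mul' k C
      (TensorProduct.map (f.toLinearMap ∘ₗ V.tensorAct.flip (TensorAlgebra.ι k m)) g.toLinearMap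
        (Coalgebra.comul (R := k) h))) (h : H) (x : TensorAlgebra k M) :
    g h * f x = LinearMap.mul' k C
      (TensorProduct.map (f.toLinearMap ∘ₗ V.tensorAct.flip x) g.toLinearMap
        (Coalgebra.comul (R := k) h)) := by
  induction x using TensorAlgebra.induction generalizing h with
  | algebraMap c =>
    have : ∀ t : H ⊗[k] H, LinearMap.mul' k C (TensorProduct.map (f.toLinearMap ∘ₗ
        V.tensorAct.flip (algebraMap k _ c)) g.toLinearMap t) =
        algebraMap k C c * g (TensorProduct.lid k H ((Coalgebra.counit (R := k)).rTensor H t)) := by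
      intro t
      induction t with
      | zero => simp
      | add a b ha hb => simp only [map_add, mul_add, ha, hb]
      | tmul a b => simp [tensorAct_algebraMap]
    rw [this, Coalgebra.rTensor_counit_comul, AlgHom.commutes, ← Algebra.commutes]
    simp
  | ι m => exact hfg h m
  | add x y hx hy =>
    rw [map_add, mul_add, hx, hy, map_add V.tensorAct.flip, LinearMap.comp_add,
      TensorProduct.map_add_left, LinearMap.add_apply, map_add]
  | mul x y hx hy =>
    obtain ⟨Q, hQ⟩ : ∃ Q : H ⊗[k] (H ⊗[k] H) →ₗ[k] C, ∀ a b c,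
        Q (a ⊗ₜ (b ⊗ₜ c)) = f (V.tensorAct a x) * (f (V.tensorAct b y) * g c) :=
      ⟨LinearMap.mul' k C ∘ₗ TensorProduct.map (f.toLinearMap ∘ₗ V.tensorAct.flip x)
        (LinearMap.mul' k C ∘ₗ TensorProduct.map (f.toLinearMap ∘ₗ V.tensorAct.flip y)
          g.toLinearMap), fun a b c => by simp⟩
    have h1 : ∀ t : H ⊗[k] H, LinearMap.mul' k C (TensorProduct.map (f.toLinearMap ∘ₗ
        V.tensorAct.flip x) g.toLinearMap t) * f y =
        Q ((Coalgebra.comul (R := k)).lTensor H t) := by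
      intro t
      induction t with
      | zero => simp
      | add a b ha hb => simp only [map_add, add_mul, ha, hb]
      | tmul a b =>
        simp only [TensorProduct.map_tmul, LinearMap.mul'_apply, AlgHom.toLinearMap_apply,
          mul_assoc, hy, LinearMap.lTensor_tmul]
        generalize Coalgebra.comul (R := k) b = s
        induction s with
        | zero => simp
        | add a b ha hb => simp only [map_add, mul_add, tmul_add, ha, hb]
        | tmul a b => simp [hQ]
    have h2 : ∀ t : H ⊗[k] H, LinearMap.mul' k C (TensorProduct.map (f.toLinearMap ∘ₗ
        V.tensorAct.flip (x * y)) g.toLinearMap t) =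
        Q (TensorProduct.assoc k H H H ((Coalgebra.comul (R := k)).rTensor H t)) := by
      intro t
      induction t with
      | zero => simp
      | add a b ha hb => simp only [map_add, ha, hb]
      | tmul a b =>
        simp only [TensorProduct.map_tmul, LinearMap.mul'_apply, AlgHom.toLinearMap_apply,
          LinearMap.comp_apply, LinearMap.flip_apply, tensorAct_mul_right, LinearMap.rTensor_tmul]
        generalize Coalgebra.comul (R := k) a = s
        induction s with
        | zero => simp
        | add a b ha hb => simp only [map_add, add_mul, add_tmul, ha, hb]
        | tmul a b => simp [hQ, mul_assoc]
    rw [map_mul, ← mul_assoc, hx, h1, h2, Coalgebra.coassoc_apply]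

/-- The universal property of `T(V) # H`. -/
def lift (hfg : ∀ h m, g h * f (TensorAlgebra.ι k m) = LinearMap.mul' k C
      (TensorProduct.map (f.toLinearMap ∘ₗ V.tensorAct.flip (TensorAlgebra.ι k m)) g.toLinearMap
        (Coalgebra.comul (R := k) h))) : V.Smash →ₐ[k] C :=
  AlgHom.ofLinearMap (LinearMap.mul' k C ∘ₗ TensorProduct.map f.toLinearMap g.toLinearMap ∘ₗ
      (toTensor V).toLinearMap)
    (by
      change f 1 * g 1 = 1
      simp)
    (by
      intro a b
      induction a using mk_induction with
      | zero => simp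
      | add a a' ha ha' => simp only [map_add, add_mul, ha, ha']
      | mk x h =>
      induction b using mk_induction with
      | zero => simp
      | add a a' ha ha' => simp only [map_add, mul_add, ha, ha']
      | mk y l =>
      rw [mk_mul_mk]
      change _ = (f x * g h) * (f y * g l)
      rw [mul_assoc, ← mul_assoc (g h), lift_relation V f g hfg]
      generalize Coalgebra.comul (R := k) h = t
      induction t with
      | zero => simp
      | add a b ha hb => simp only [map_add, add_mul, mul_add, ha, hb]
      | tmul a b => simp [mul_assoc])

variable (hfg : ∀ h m, g h * f (TensorAlgebra.ι k m) = LinearMap.mul' k C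
      (TensorProduct.map (f.toLinearMap ∘ₗ V.tensorAct.flip (TensorAlgebra.ι k m)) g.toLinearMap
        (Coalgebra.comul (R := k) h)))

theorem lift_mk (x : TensorAlgebra k M) (h : H) : lift V f g hfg (mk V x h) = f x * g h := rfl

theorem lift_inl (x : TensorAlgebra k M) : lift V f g hfg (inl V x) = f x := by
  rw [inl_apply, lift_mk, map_one, mul_one]

theorem lift_inr (h : H) : lift V f g hfg (inr V h) = g h := by
  rw [inr_apply, lift_mk, map_one, one_mul]

end Lift

end Smash

end YDModule
end HopfLift
namespace HopfLift

/-! ### The comultiplication of `T(V) # H` -/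

namespace YDModule

variable {k H M : Type*} [Field k] [Ring H] [HopfAlgebra k H] [AddCommGroup M] [Module k M]
  (V : YDModule k H M)

/-- Words are built by multiplying by a generator on the left, in step with the recursion
`tensorComul_ι_mul`. -/
theorem tensorAlgebra_induction_ι_mul {R N : Type*} [CommRing R] [AddCommGroup N] [Module R N]
    {p : TensorAlgebra R N → Prop} (one : p 1) (add : ∀ x y, p x → p y → p (x + y))
    (smul : ∀ (c : R) x, p x → p (c • x)) (ι_mul : ∀ m x, p x → p (TensorAlgebra.ι R m * x))
    (x : TensorAlgebra R N) : p x := by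
  have h : ∀ x y : TensorAlgebra R N, p y → p (x * y) := by
    intro x
    induction x using TensorAlgebra.induction with
    | algebraMap c => intro y hy; rw [← Algebra.smul_def]; exact smul c y hy
    | ι m => exact fun y hy => ι_mul m y hy
    | mul a b ha hb => intro y hy; rw [mul_assoc]; exact ha _ (hb _ hy)
    | add a b ha hb => intro y hy; rw [add_mul]; exact add _ _ (ha _ hy) (hb _ hy)
  simpa using h x 1 one

theorem tensorComul_one : V.tensorComul 1 = 1 ⊗ₜ 1 := by
  simp [tensorComul]

theorem tensorComul_ι_mul (m : M) (x : TensorAlgebra k M) :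
    V.tensorComul (TensorAlgebra.ι k m * x) = V.braidedMulPrimitive m (V.tensorComul x) := by
  simp [tensorComul]

theorem braidedMulPrimitive_tmul (m : M) (a b : TensorAlgebra k M) :
    V.braidedMulPrimitive m (a ⊗ₜ b) = (TensorAlgebra.ι k m * a) ⊗ₜ b +
      TensorProduct.map (V.tensorAct.flip a) (LinearMap.mulRight k b ∘ₗ TensorAlgebra.ι k)
        (V.coact m) := by
  have : ∀ t : H ⊗[k] M, TensorProduct.homTensorHomMap (RingHom.id k) (TensorAlgebra k M)
      (TensorAlgebra k M) (TensorAlgebra k M) (TensorAlgebra k M) (TensorProduct.map V.tensorAct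
        (LinearMap.mul k (TensorAlgebra k M) ∘ₗ TensorAlgebra.ι k) t) (a ⊗ₜ b) =
      TensorProduct.map (V.tensorAct.flip a) (LinearMap.mulRight k b ∘ₗ TensorAlgebra.ι k) t := by
    intro t
    induction t with
    | zero => simp
    | add x y hx hy => simp only [map_add, LinearMap.add_apply, hx, hy]
    | tmul h n => simp
  rw [← this]
  simp [braidedMulPrimitive]

theorem tensorCoact_ι (m : M) :
    V.tensorCoact (TensorAlgebra.ι k m) = (TensorAlgebra.ι k).lTensor H (V.coact m) := by
  simp [tensorCoact]

namespace Smash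

/-- The restriction to `H` of the comultiplication of `T(V) # H`. -/
def comulInr : H →ₐ[k] V.Smash ⊗[k] V.Smash :=
  (Algebra.TensorProduct.map (inr V) (inr V)).comp (Bialgebra.comulAlgHom k H)

theorem comulInr_apply (h : H) : comulInr V h =
    Algebra.TensorProduct.map (inr V) (inr V) (Coalgebra.comul (R := k) h) := rfl

/-- The map `x ↦ x₋₁ ⊗ x₀` from `T(V)` to `(T(V) # H) ⊗ (T(V) # H)`. -/
def coactHom : TensorAlgebra k M →ₐ[k] V.Smash ⊗[k] V.Smash :=
  (Algebra.TensorProduct.map (inr V) (inl V)).comp V.tensorCoact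

theorem coactHom_ι (m : M) : coactHom V (TensorAlgebra.ι k m) =
    TensorProduct.map (inr V).toLinearMap ((inl V).toLinearMap ∘ₗ TensorAlgebra.ι k)
      (V.coact m) := by
  rw [coactHom, AlgHom.comp_apply, tensorCoact_ι]
  generalize V.coact m = t
  induction t with
  | zero => simp
  | add x y hx hy => simp only [map_add, hx, hy]
  | tmul h n => simp

/-- The restriction to `T(V)` of the comultiplication of `T(V) # H`. -/
def comulInl : TensorAlgebra k M →ₐ[k] V.Smash ⊗[k] V.Smash :=
  TensorAlgebra.lift k ((TensorProduct.mk k _ _).flip 1 ∘ₗ (inl V).toLinearMap ∘ₗ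
    TensorAlgebra.ι k + (coactHom V).toLinearMap ∘ₗ TensorAlgebra.ι k)

theorem comulInl_ι (m : M) : comulInl V (TensorAlgebra.ι k m) =
    inl V (TensorAlgebra.ι k m) ⊗ₜ 1 + coactHom V (TensorAlgebra.ι k m) := by
  simp [comulInl]

theorem inr_mul_inl (h : H) (x : TensorAlgebra k M) : inr V h * inl V x =
    (toTensor V).symm ((V.tensorAct.flip x).rTensor H (Coalgebra.comul (R := k) h)) := by
  rw [inl_apply, inr_mul_mk, LinearMap.mulRight_one]
  rfl

/-- Both sides are (h₁ · m) h₂ ⊗ h₃. This is the half of the relation for `comulHom` that concerns m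
⊗ 1; `comulInr_mul_coactHom` is the half that concerns m₋₁ ⊗ m₀. -/
theorem inl_mul_comulInr (h : H) (m : M) :
    comulInr V h * (inl V (TensorAlgebra.ι k m) ⊗ₜ 1) = LinearMap.mul' k _
      (TensorProduct.map ((TensorProduct.mk k _ _).flip 1 ∘ₗ (inl V).toLinearMap ∘ₗ
        TensorAlgebra.ι k ∘ₗ V.act.toLinearMap.flip m) (comulInr V).toLinearMap
          (Coalgebra.comul (R := k) h)) := by
  obtain ⟨Q, hQ⟩ : ∃ Q : H ⊗[k] (H ⊗[k] H) →ₗ[k] V.Smash ⊗[k] V.Smash, ∀ a b c,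
      Q (a ⊗ₜ (b ⊗ₜ c)) = mk V (TensorAlgebra.ι k (V.act a m)) b ⊗ₜ inr V c :=
    ⟨TensorProduct.map ((toTensor V).symm.toLinearMap ∘ₗ
      (TensorAlgebra.ι k ∘ₗ V.act.toLinearMap.flip m).rTensor H) (inr V).toLinearMap ∘ₗ
        (TensorProduct.assoc k H H H).symm.toLinearMap, fun a b c => by simp⟩
  have h1 : ∀ t : H ⊗[k] H, Algebra.TensorProduct.map (inr V) (inr V) t *
      (inl V (TensorAlgebra.ι k m) ⊗ₜ 1) =
      Q (TensorProduct.assoc k H H H ((Coalgebra.comul (R := k)).rTensor H t)) := by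
    intro t
    induction t with
    | zero => simp
    | add x y hx hy => simp only [map_add, add_mul, hx, hy]
    | tmul a b =>
      simp only [Algebra.TensorProduct.map_tmul, Algebra.TensorProduct.tmul_mul_tmul, inr_mul_inl,
        mul_one, LinearMap.rTensor_tmul]
      generalize Coalgebra.comul (R := k) a = s
      induction s with
      | zero => simp
      | add x y hx hy => simp only [map_add, add_tmul, hx, hy]
      | tmul x y => simp [hQ, tensorAct_ι]
  have h2 : ∀ t : H ⊗[k] H, LinearMap.mul' k _
      (TensorProduct.map ((TensorProduct.mk k _ _).flip 1 ∘ₗ (inl V).toLinearMap ∘ₗ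
        TensorAlgebra.ι k ∘ₗ V.act.toLinearMap.flip m) (comulInr V).toLinearMap t) =
      Q ((Coalgebra.comul (R := k)).lTensor H t) := by
    intro t
    induction t with
    | zero => simp
    | add x y hx hy => simp only [map_add, hx, hy]
    | tmul a b =>
      simp only [TensorProduct.map_tmul, LinearMap.mul'_apply, AlgHom.toLinearMap_apply,
        comulInr_apply, LinearMap.lTensor_tmul]
      generalize Coalgebra.comul (R := k) b = s
      induction s with
      | zero => simp
      | add x y hx hy => simp only [map_add, mul_add, tmul_add, hx, hy]
      | tmul x y => simp [hQ, inl_mul_inr]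
  rw [h2, ← Coalgebra.coassoc_apply, ← h1]
  rfl

/-- Here the Yetter-Drinfeld condition enters: the two sides are h₁m₋₁ ⊗ (h₂ · m₀) h₃ and (h₁ · m)₋₁
h₂ ⊗ (h₁ · m)₀ h₃. -/
theorem comulInr_mul_coactHom (h : H) (m : M) :
    comulInr V h * coactHom V (TensorAlgebra.ι k m) = LinearMap.mul' k _
      (TensorProduct.map ((coactHom V).toLinearMap ∘ₗ
        TensorAlgebra.ι k ∘ₗ V.act.toLinearMap.flip m) (comulInr V).toLinearMap
          (Coalgebra.comul (R := k) h)) := by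
  obtain ⟨K, hK⟩ : ∃ K : H ⊗[k] M →ₗ[k] H ⊗[k] H →ₗ[k] H ⊗[k] M, ∀ u a b,
      K u (a ⊗ₜ b) = TensorProduct.map (LinearMap.mulLeft k a) (V.act b) u := by
    refine ⟨(TensorProduct.curry (TensorProduct.map (LinearMap.mul' k H)
      (TensorProduct.lift V.act.toLinearMap) ∘ₗ
      (TensorProduct.tensorTensorTensorComm k H H H M).toLinearMap)).flip, fun u a b => ?_⟩
    induction u with
    | zero => simp
    | add x y hx hy => simp only [map_add, LinearMap.add_apply, hx, hy]
    | tmul x y => simp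
  obtain ⟨K', hK'⟩ : ∃ K' : H ⊗[k] H →ₗ[k] H ⊗[k] M, ∀ a b,
      K' (a ⊗ₜ b) = (LinearMap.mulRight k b).rTensor M (V.coact (V.act a m)) :=
    ⟨coactFlip V.coact ∘ₗ (V.act.toLinearMap.flip m).rTensor H,
      fun a b => by simp [coactFlip_tmul]⟩
  -- The two composites are the two sides of `V.compat` at m, as functions of h.
  have hKK' : K (V.coact m) ∘ₗ Coalgebra.comul (R := k) = K' ∘ₗ Coalgebra.comul (R := k) := by
    apply LinearMap.ext
    intro h
    have h1 := LinearMap.congr_fun V.compat (h ⊗ₜ m)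
    simp only [LinearMap.comp_apply, TensorProduct.map_tmul, actFlip_tmul] at h1 ⊢
    refine Eq.trans ?_ (h1.trans ?_)
    · generalize Coalgebra.comul (R := k) h = t
      induction t with
      | zero => simp
      | add x y hx hy => simp only [map_add, add_tmul, hx, hy]
      | tmul a b =>
        rw [hK]
        generalize V.coact m = t
        induction t with
        | zero => simp
        | add x y hx hy => simp only [map_add, tmul_add, hx, hy]
        | tmul x y => simp
    · generalize Coalgebra.comul (R := k) h = t
      induction t with
      | zero => simp
      | add x y hx hy => simp only [map_add, hx, hy]
      | tmul a b => simp [hK', coactFlip_tmul]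
  obtain ⟨Q, hQ⟩ : ∃ Q : (H ⊗[k] M) ⊗[k] H →ₗ[k] V.Smash ⊗[k] V.Smash, ∀ a n c,
      Q ((a ⊗ₜ n) ⊗ₜ c) = inr V a ⊗ₜ mk V (TensorAlgebra.ι k n) c :=
    ⟨TensorProduct.map (inr V).toLinearMap ((toTensor V).symm.toLinearMap ∘ₗ
      (TensorAlgebra.ι k).rTensor H) ∘ₗ (TensorProduct.assoc k H M H).toLinearMap,
      fun a b c => by simp⟩
  have h1 : ∀ t : H ⊗[k] H, Algebra.TensorProduct.map (inr V) (inr V) t *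
      coactHom V (TensorAlgebra.ι k m) = Q ((K (V.coact m)).rTensor H ((TensorProduct.assoc k H H H).symm
        ((Coalgebra.comul (R := k)).lTensor H t))) := by
    intro t
    induction t with
    | zero => simp
    | add x y hx hy => simp only [map_add, add_mul, hx, hy]
    | tmul a b =>
      rw [coactHom_ι, LinearMap.lTensor_tmul, Algebra.TensorProduct.map_tmul]
      generalize V.coact m = u
      induction u with
      | zero => simp
      | add x y hx hy => simp only [map_add, mul_add, LinearMap.rTensor_add, LinearMap.add_apply,
          hx, hy]
      | tmul p n =>
        rw [TensorProduct.map_tmul, Algebra.TensorProduct.tmul_mul_tmul, LinearMap.comp_apply,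
          AlgHom.toLinearMap_apply, AlgHom.toLinearMap_apply, inr_mul_inl]
        generalize Coalgebra.comul (R := k) b = s
        induction s with
        | zero => simp
        | add x y hx hy => simp only [map_add, tmul_add, hx, hy]
        | tmul x y => simp [hQ, hK, tensorAct_ι]
  have h2 : ∀ t : H ⊗[k] H, LinearMap.mul' k _
      (TensorProduct.map ((coactHom V).toLinearMap ∘ₗ
        TensorAlgebra.ι k ∘ₗ V.act.toLinearMap.flip m) (comulInr V).toLinearMap t) =
      Q (K'.rTensor H ((TensorProduct.assoc k H H H).symm
        ((Coalgebra.comul (R := k)).lTensor H t))) := by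
    intro t
    induction t with
    | zero => simp
    | add x y hx hy => simp only [map_add, hx, hy]
    | tmul a b =>
      simp only [TensorProduct.map_tmul, LinearMap.mul'_apply, AlgHom.toLinearMap_apply,
        comulInr_apply, LinearMap.lTensor_tmul, LinearMap.comp_apply, coactHom_ι,
        LinearMap.flip_apply]
      generalize Coalgebra.comul (R := k) b = s
      induction s with
      | zero => simp
      | add x y hx hy => simp only [map_add, mul_add, tmul_add, hx, hy]
      | tmul x y =>
        simp only [TensorProduct.assoc_symm_tmul, LinearMap.rTensor_tmul, hK']
        generalize V.coact (V.act a m) = u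
        induction u with
        | zero => simp
        | add x y hx hy => simp only [map_add, add_mul, add_tmul, hx, hy]
        | tmul p n => simp [hQ, inl_mul_inr]
  rw [h2, comulInr_apply, h1, ← Coalgebra.coassoc_apply, LinearEquiv.symm_apply_apply,
    ← LinearMap.rTensor_comp_apply, hKK', LinearMap.rTensor_comp_apply,
    ← LinearEquiv.symm_apply_apply (TensorProduct.assoc k H H H)
      ((Coalgebra.comul (R := k)).rTensor H _), Coalgebra.coassoc_apply]

/-- The comultiplication of `T(V) # H`. -/
def comulHom : V.Smash →ₐ[k] V.Smash ⊗[k] V.Smash :=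
  lift V (comulInl V) (comulInr V) (by
    intro h m
    rw [comulInl_ι, mul_add, inl_mul_comulInr, comulInr_mul_coactHom]
    rw [← map_add, ← LinearMap.add_apply, ← TensorProduct.map_add_left]
    generalize Coalgebra.comul (R := k) h = t
    induction t with
    | zero => simp
    | add x y hx hy => simp only [map_add, hx, hy]
    | tmul a b => simp [tensorAct_ι, comulInl_ι])

/-- Moving m₋₁ past a splits it, and coassociativity of the coaction turns the result into (m₋₁ ·
a)(m₀)₋₁ ⊗ (m₀)₀. The factor m₋₁ · a is the braiding of m with a. -/
theorem coactHom_ι_mul (m : M) (a : TensorAlgebra k M) :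
    coactHom V (TensorAlgebra.ι k m) * (inl V a ⊗ₜ 1) = LinearMap.mul' k _
      (TensorProduct.map ((TensorProduct.mk k _ _).flip 1 ∘ₗ (inl V).toLinearMap ∘ₗ
        V.tensorAct.flip a) ((coactHom V).toLinearMap ∘ₗ TensorAlgebra.ι k) (V.coact m)) := by
  obtain ⟨Q, hQ⟩ : ∃ Q : H ⊗[k] (H ⊗[k] M) →ₗ[k] V.Smash ⊗[k] V.Smash, ∀ g h n,
      Q (g ⊗ₜ (h ⊗ₜ n)) = mk V (V.tensorAct g a) h ⊗ₜ inl V (TensorAlgebra.ι k n) :=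
    ⟨TensorProduct.map ((toTensor V).symm.toLinearMap ∘ₗ (V.tensorAct.flip a).rTensor H)
      ((inl V).toLinearMap ∘ₗ TensorAlgebra.ι k) ∘ₗ
        (TensorProduct.assoc k H H M).symm.toLinearMap, fun a b c => by simp⟩
  have h1 : ∀ t : H ⊗[k] M, TensorProduct.map (inr V).toLinearMap ((inl V).toLinearMap ∘ₗ
      TensorAlgebra.ι k) t * (inl V a ⊗ₜ 1) =
      Q (TensorProduct.assoc k H H M ((Coalgebra.comul (R := k)).rTensor M t)) := by
    intro t
    induction t with
    | zero => simp
    | add x y hx hy => simp only [map_add, add_mul, hx, hy]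
    | tmul h n =>
      simp only [TensorProduct.map_tmul, Algebra.TensorProduct.tmul_mul_tmul, inr_mul_inl,
        mul_one, LinearMap.rTensor_tmul, AlgHom.toLinearMap_apply, LinearMap.comp_apply]
      generalize Coalgebra.comul (R := k) h = s
      induction s with
      | zero => simp
      | add x y hx hy => simp only [map_add, add_tmul, hx, hy]
      | tmul x y => simp [hQ]
  have h2 : ∀ t : H ⊗[k] M, LinearMap.mul' k _
      (TensorProduct.map ((TensorProduct.mk k _ _).flip 1 ∘ₗ (inl V).toLinearMap ∘ₗ
        V.tensorAct.flip a) ((coactHom V).toLinearMap ∘ₗ TensorAlgebra.ι k) t) =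
      Q (V.coact.lTensor H t) := by
    intro t
    induction t with
    | zero => simp
    | add x y hx hy => simp only [map_add, hx, hy]
    | tmul h n =>
      simp only [TensorProduct.map_tmul, LinearMap.mul'_apply, LinearMap.comp_apply,
        AlgHom.toLinearMap_apply, coactHom_ι, LinearMap.lTensor_tmul]
      generalize V.coact n = s
      induction s with
      | zero => simp
      | add x y hx hy => simp only [map_add, mul_add, tmul_add, hx, hy]
      | tmul x y => simp [hQ, inl_mul_inr]
  rw [coactHom_ι, h1, h2]
  exact congrArg Q (LinearMap.congr_fun V.coassoc m)

/-- The restriction to `T(V)` of the comultiplication of `T(V) # H`, in terms of the braided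
comultiplication of `T(V)`. -/
theorem comulInl_apply (x : TensorAlgebra k M) : comulInl V x = LinearMap.mul' k _
    (TensorProduct.map ((TensorProduct.mk k _ _).flip 1 ∘ₗ (inl V).toLinearMap)
      (coactHom V).toLinearMap (V.tensorComul x)) := by
  -- For x = m y, multiplication by m ⊗ 1 and by m₋₁ ⊗ m₀ accounts for the two summands of
  -- `braidedMulPrimitive_tmul`.
  induction x using tensorAlgebra_induction_ι_mul with
  | one => simp [tensorComul_one, Algebra.TensorProduct.one_def]
  | add x y hx hy => simp only [map_add, hx, hy]
  | smul c x hx => simp only [map_smul, hx]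
  | ι_mul m x hx =>
    rw [map_mul, hx, tensorComul_ι_mul]
    generalize V.tensorComul x = t
    induction t with
    | zero => simp
    | add x y hx hy => simp only [map_add, mul_add, hx, hy]
    | tmul a b =>
      simp only [TensorProduct.map_tmul, LinearMap.mul'_apply, LinearMap.comp_apply,
        AlgHom.toLinearMap_apply, LinearMap.flip_apply, TensorProduct.mk_apply,
        braidedMulPrimitive_tmul, map_add, comulInl_ι, add_mul, map_mul, ← mul_assoc,
        coactHom_ι_mul, Algebra.TensorProduct.tmul_mul_tmul, one_mul]
      congr 1
      generalize V.coact m = s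
      induction s with
      | zero => simp
      | add x y hx hy => simp only [map_add, add_mul, hx, hy]
      | tmul x y => simp [mul_assoc]

theorem comulHom_inl (x : TensorAlgebra k M) : comulHom V (inl V x) = comulInl V x :=
  lift_inl ..

theorem comulHom_inr (h : H) : comulHom V (inr V h) = comulInr V h :=
  lift_inr ..

/-- The algebra map `comulHom` is given by the biproduct formula. Comultiplications of bosonizations
can therefore be compared on generators. -/
theorem comulHom_mk (x : TensorAlgebra k M) (h : H) : comulHom V (mk V x h) =
    TensorProduct.map (toTensor V).symm.toLinearMap (toTensor V).symm.toLinearMap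
      (applyMiddle (coactFlip V.tensorCoact.toLinearMap)
        (V.tensorComul x ⊗ₜ Coalgebra.comul (R := k) h)) := by
  rw [← inl_mul_inr, map_mul, comulHom_inl, comulHom_inr, comulInl_apply, comulInr_apply]
  generalize V.tensorComul x = s
  generalize Coalgebra.comul (R := k) h = t
  induction s with
  | zero => simp
  | add x y hx hy => simp only [map_add, add_mul, add_tmul, hx, hy]
  | tmul a b =>
  induction t with
  | zero => simp
  | add x y hx hy => simp only [map_add, mul_add, tmul_add, hx, hy]
  | tmul c d =>
    simp only [applyMiddle, LinearMap.comp_apply, LinearEquiv.coe_coe, TensorProduct.assoc_tmul,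
      LinearMap.lTensor_tmul, TensorProduct.assoc_symm_tmul, LinearMap.rTensor_tmul,
      coactFlip_tmul, TensorProduct.map_tmul, LinearMap.mul'_apply, AlgHom.toLinearMap_apply,
      coactHom, AlgHom.comp_apply]
    generalize V.tensorCoact b = u
    induction u with
    | zero => simp
    | add x y hx hy => simp only [map_add, add_mul, mul_add, add_tmul, tmul_add, hx, hy]
    | tmul x y => simp [inl_mul_inr, mk_mul_inr]

end Smash
end YDModule
end HopfLift
namespace HopfLift

/-! ### The isomorphism between the opposite of a bosonization and the dual bosonization -/

section Rev

variable {k M M' : Type*} [Field k] [AddCommGroup M] [Module k M] [AddCommGroup M'] [Module k M']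

/-- The algebra map from `T(M')` to the opposite algebra of `T(M)` given by `e`. -/
def revHom (e : M' →ₗ[k] M) : TensorAlgebra k M' →ₐ[k] (TensorAlgebra k M)ᵐᵒᵖ :=
  TensorAlgebra.lift k ((MulOpposite.opLinearEquiv k).toLinearMap ∘ₗ TensorAlgebra.ι k ∘ₗ e)

/-- The antimultiplicative map from `T(M')` to `T(M)` given by `e`. -/
def rev (e : M' →ₗ[k] M) : TensorAlgebra k M' →ₗ[k] TensorAlgebra k M :=
  (MulOpposite.opLinearEquiv k).symm.toLinearMap ∘ₗ (revHom e).toLinearMap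

theorem rev_ι (e : M' →ₗ[k] M) (m : M') :
    rev e (TensorAlgebra.ι k m) = TensorAlgebra.ι k (e m) := by
  simp [rev, revHom]

theorem rev_mul (e : M' →ₗ[k] M) (x y : TensorAlgebra k M') :
    rev e (x * y) = rev e y * rev e x := by
  simp [rev]

theorem rev_one (e : M' →ₗ[k] M) : rev e 1 = 1 := by
  simp [rev]

theorem rev_algebraMap (e : M' →ₗ[k] M) (c : k) :
    rev e (algebraMap k _ c) = algebraMap k _ c := by
  simp [Algebra.algebraMap_eq_smul_one, rev_one]

theorem rev_symm_rev (e : M' ≃ₗ[k] M) (x : TensorAlgebra k M') :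
    rev e.symm.toLinearMap (rev e.toLinearMap x) = x := by
  induction x using TensorAlgebra.induction with
  | algebraMap c => simp only [rev_algebraMap]
  | ι m => simp [rev_ι]
  | mul x y hx hy => rw [rev_mul, rev_mul, hx, hy]
  | add x y hx hy => rw [map_add, map_add, hx, hy]

theorem rev_rev_symm (e : M' ≃ₗ[k] M) (x : TensorAlgebra k M) :
    rev e.toLinearMap (rev e.symm.toLinearMap x) = x :=
  rev_symm_rev e.symm x

theorem rev_mem_pow (e : M' →ₗ[k] M) (n : ℕ) {x : TensorAlgebra k M'}
    (hx : x ∈ LinearMap.range (TensorAlgebra.ι k (M := M')) ^ n) :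
    rev e x ∈ LinearMap.range (TensorAlgebra.ι k (M := M)) ^ n := by
  induction n generalizing x with
  | zero =>
    rw [pow_zero] at hx ⊢
    obtain ⟨c, rfl⟩ := Submodule.mem_one.1 hx
    rw [rev_algebraMap]
    exact Submodule.mem_one.2 ⟨c, rfl⟩
  | succ n ih =>
    rw [pow_succ] at hx
    rw [pow_succ']
    refine Submodule.mul_induction_on hx ?_ ?_
    · rintro x hx _ ⟨m, rfl⟩
      rw [rev_mul, rev_ι]
      exact Submodule.mul_mem_mul ⟨_, rfl⟩ (ih hx)
    · intro x y hx hy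
      rw [map_add]
      exact Submodule.add_mem _ hx hy

end Rev

namespace YDModule

variable {k H M M' : Type*} [Field k] [Ring H] [HopfAlgebra k H] [AddCommGroup M] [Module k M]
  [AddCommGroup M'] [Module k M']

/-- Data relating a Yetter-Drinfeld module `V` to a module `V'` whose bosonization is the opposite
of that of `V`. -/
structure OpTwist (V : YDModule k H M) (V' : YDModule k H M') (e : M' ≃ₗ[k] M)
    (σ τ : H →ₗ[k] H) : Prop where
  σ_σ : ∀ h, σ (σ h) = h
  τ_τ : ∀ h, τ (τ h) = h
  σ_one : σ 1 = 1
  σ_mul : ∀ g h, σ (g * h) = σ h * σ g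
  counit_σ : ∀ h, Coalgebra.counit (R := k) (σ h) = Coalgebra.counit (R := k) h
  comul_σ : ∀ h, Coalgebra.comul (R := k) (σ h) = TensorProduct.map σ σ (Coalgebra.comul h)
  counit_τ : ∀ h, Coalgebra.counit (R := k) (τ h) = Coalgebra.counit (R := k) h
  comul_τ : ∀ h, Coalgebra.comul (R := k) (τ h) =
    TensorProduct.map τ τ (TensorProduct.comm k H H (Coalgebra.comul h))
  σ_τ : ∀ h, LinearMap.mul' k H (TensorProduct.map σ τ (TensorProduct.comm k H H
    (Coalgebra.comul h))) = algebraMap k H (Coalgebra.counit h)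
  τ_σ : ∀ h, LinearMap.mul' k H (TensorProduct.map τ σ (TensorProduct.comm k H H
    (Coalgebra.comul h))) = algebraMap k H (Coalgebra.counit h)
  coact : ∀ m, V.coact (e m) = TensorProduct.map σ e.toLinearMap (V'.coact m)
  act : ∀ h m, V.act (τ h) (e m) = e (V'.act h m)

namespace OpTwist

variable {V : YDModule k H M} {V' : YDModule k H M'} {e : M' ≃ₗ[k] M} {σ τ : H →ₗ[k] H}

theorem symm (D : OpTwist V V' e σ τ) : OpTwist V' V e.symm σ τ where
  __ := D
  coact m := by
    have h := D.coact (e.symm m)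
    rw [LinearEquiv.apply_symm_apply] at h
    rw [h]
    generalize V'.coact (e.symm m) = t
    induction t with
    | zero => simp
    | add x y hx hy => simp only [map_add, ← hx, ← hy]
    | tmul x y => simp [D.σ_σ]
  act h m := by
    have h1 := D.act (τ h) (e.symm m)
    rw [LinearEquiv.apply_symm_apply, D.τ_τ] at h1
    rw [h1, LinearEquiv.symm_apply_apply]

/-- Reversing a word exchanges the two halves of Δ(h), and τ reverses Δ, so the two reversals
cancel. -/
theorem tensorAct_rev (D : OpTwist V V' e σ τ) (h : H) (x : TensorAlgebra k M') :
    V.tensorAct (τ h) (rev e.toLinearMap x) = rev e.toLinearMap (V'.tensorAct h x) := by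
  induction x using TensorAlgebra.induction generalizing h with
  | algebraMap c =>
    rw [rev_algebraMap, tensorAct_algebraMap, tensorAct_algebraMap, map_smul, rev_algebraMap,
      D.counit_τ]
  | ι m =>
    rw [rev_ι, tensorAct_ι, tensorAct_ι, rev_ι]
    exact congrArg _ (D.act h m)
  | add x y hx hy => simp only [map_add, hx, hy]
  | mul x y hx hy =>
    rw [rev_mul, tensorAct_mul_right, tensorAct_mul_right, D.comul_τ]
    generalize Coalgebra.comul (R := k) h = t
    induction t with
    | zero => simp
    | add x y hx hy => simp only [map_add, hx, hy]
    | tmul a b => simp [hx, hy, rev_mul]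

/-- The coaction on T(V) is an algebra map and both σ and `rev` are antimultiplicative, so
generators decide. -/
theorem tensorCoact_rev (D : OpTwist V V' e σ τ) (x : TensorAlgebra k M') :
    V.tensorCoact (rev e.toLinearMap x) =
      TensorProduct.map σ (rev e.toLinearMap) (V'.tensorCoact x) := by
  induction x using TensorAlgebra.induction with
  | algebraMap c =>
    rw [rev_algebraMap, AlgHom.commutes, AlgHom.commutes, Algebra.TensorProduct.algebraMap_apply,
      Algebra.TensorProduct.algebraMap_apply, Algebra.algebraMap_eq_smul_one]
    simp [D.σ_one, rev_one]
  | ι m =>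
    rw [rev_ι, tensorCoact_ι, tensorCoact_ι, LinearEquiv.coe_coe, D.coact]
    generalize V'.coact m = t
    induction t with
    | zero => simp
    | add x y hx hy => simp only [map_add, hx, hy]
    | tmul a b => simp [rev_ι]
  | add x y hx hy => simp only [map_add, hx, hy]
  | mul x y hx hy =>
    rw [rev_mul, map_mul, map_mul, hx, hy]
    generalize V'.tensorCoact x = s
    generalize V'.tensorCoact y = t
    induction s with
    | zero => simp
    | add x y hx hy => simp only [map_add, mul_add, add_mul, hx, hy]
    | tmul a b =>
    induction t with
    | zero => simp
    | add x y hx hy => simp only [map_add, mul_add, add_mul, hx, hy]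
    | tmul c d => simp [D.σ_mul, rev_mul]

open Smash

/-- Moving σ(h₂) past e(h₁ · m) = τ(h₁) · e(m) makes σ(h₂) τ(h₁) act on e(m), and `σ_τ` leaves e(m)
σ(h). This is the relation h m = (h₁ · m) h₂ of T(V') # H, read in the opposite of T(V) # H. -/
theorem inl_mul_inr_σ (D : OpTwist V V' e σ τ) (h : H) (m : M') :
    inl V (TensorAlgebra.ι k (e m)) * inr V (σ h) =
      LinearMap.mul' k _ (TensorProduct.map ((inr V).toLinearMap ∘ₗ σ)
        ((inl V).toLinearMap ∘ₗ TensorAlgebra.ι k ∘ₗ e.toLinearMap ∘ₗ V'.act.toLinearMap.flip m)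
        (TensorProduct.comm k H H (Coalgebra.comul (R := k) h))) := by
  obtain ⟨Q, hQ⟩ : ∃ Q : H ⊗[k] (H ⊗[k] H) →ₗ[k] V.Smash, ∀ a b c,
      Q (a ⊗ₜ (b ⊗ₜ c)) = Smash.mk V (TensorAlgebra.ι k (V.act (σ b * τ a) (e m))) (σ c) :=
    ⟨(toTensor V).symm.toLinearMap ∘ₗ TensorProduct.map (TensorAlgebra.ι k ∘ₗ
      V.act.toLinearMap.flip (e m) ∘ₗ LinearMap.mul' k H ∘ₗ TensorProduct.map σ τ ∘ₗ
      (TensorProduct.comm k H H).toLinearMap) σ ∘ₗ (TensorProduct.assoc k H H H).symm.toLinearMap,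
      fun a b c => by simp⟩
  have h1 : ∀ t : H ⊗[k] H, LinearMap.mul' k _ (TensorProduct.map ((inr V).toLinearMap ∘ₗ σ)
        ((inl V).toLinearMap ∘ₗ TensorAlgebra.ι k ∘ₗ e.toLinearMap ∘ₗ V'.act.toLinearMap.flip m)
        (TensorProduct.comm k H H t)) = Q ((Coalgebra.comul (R := k)).lTensor H t) := by
    intro t
    induction t with
    | zero => simp
    | add x y hx hy => simp only [map_add, hx, hy]
    | tmul a b =>
      simp only [TensorProduct.comm_tmul, TensorProduct.map_tmul, LinearMap.mul'_apply,
        LinearMap.comp_apply, AlgHom.toLinearMap_apply, inr_mul_inl, D.comul_σ, LinearEquiv.coe_coe,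
        LinearMap.flip_apply, ← D.act, LinearMap.lTensor_tmul]
      generalize Coalgebra.comul (R := k) b = s
      induction s with
      | zero => simp
      | add x y hx hy => simp only [map_add, tmul_add, hx, hy]
      | tmul x y => simp [hQ, tensorAct_ι]
  have h2 : ∀ t : H ⊗[k] H, Q (TensorProduct.assoc k H H H ((Coalgebra.comul (R := k)).rTensor H
      t)) = Smash.mk V (TensorAlgebra.ι k (e m)) (σ (TensorProduct.lid k H
        ((Coalgebra.counit (R := k)).rTensor H t))) := by
    intro t
    induction t with
    | zero => simp [← inl_mul_inr]
    | add x y hx hy => simp only [map_add, hx, hy, ← inl_mul_inr, mul_add]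
    | tmul a b =>
      have h3 : ∀ s : H ⊗[k] H, Q (TensorProduct.assoc k H H H (s ⊗ₜ b)) =
          Smash.mk V (TensorAlgebra.ι k (V.act (LinearMap.mul' k H (TensorProduct.map σ τ
            (TensorProduct.comm k H H s))) (e m))) (σ b) := by
        intro s
        induction s with
        | zero => simp [← inl_mul_inr]
        | add x y hx hy => simp only [map_add, add_tmul, hx, hy, ← inl_mul_inr, LinearMap.add_apply,
            add_mul]
        | tmul x y => simp [hQ]
      rw [LinearMap.rTensor_tmul, h3, D.σ_τ]
      simp [← inl_mul_inr, Algebra.algebraMap_eq_smul_one]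
  rw [h1, ← Coalgebra.coassoc_apply, h2, Coalgebra.rTensor_counit_comul, inl_mul_inr]
  simp

/-- The restriction to `H` of `flipHom`. -/
def flipInr (D : OpTwist V V' e σ τ) : H →ₐ[k] V.Smashᵐᵒᵖ :=
  AlgHom.ofLinearMap ((MulOpposite.opLinearEquiv k).toLinearMap ∘ₗ (inr V).toLinearMap ∘ₗ σ)
    (by simp [D.σ_one]) (by intro g h; simp [D.σ_mul])

theorem flipInr_apply (D : OpTwist V V' e σ τ) (h : H) :
    D.flipInr h = MulOpposite.op (inr V (σ h)) := rfl

/-- The algebra map from `T(V') # H` to the opposite algebra of `T(V) # H`. -/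
def flipHom (D : OpTwist V V' e σ τ) : V'.Smash →ₐ[k] V.Smashᵐᵒᵖ :=
  lift V' (TensorAlgebra.lift k ((MulOpposite.opLinearEquiv k).toLinearMap ∘ₗ (inl V).toLinearMap ∘ₗ
      TensorAlgebra.ι k ∘ₗ e.toLinearMap)) D.flipInr (by
    intro h m
    apply MulOpposite.unop_injective
    have h1 := D.inl_mul_inr_σ h m
    simp only [TensorAlgebra.lift_ι_apply, LinearMap.comp_apply, LinearEquiv.coe_coe,
      AlgHom.toLinearMap_apply, flipInr_apply, MulOpposite.unop_mul,
      MulOpposite.coe_opLinearEquiv, MulOpposite.unop_op, h1]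
    generalize Coalgebra.comul (R := k) h = t
    induction t with
    | zero => simp
    | add x y hx hy => simp only [map_add, hx, hy, MulOpposite.unop_add]
    | tmul a b => simp [tensorAct_ι, flipInr_apply])

/-- The antimultiplicative map from `T(V') # H` to `T(V) # H`. -/
def flip (D : OpTwist V V' e σ τ) : V'.Smash →ₗ[k] V.Smash :=
  (MulOpposite.opLinearEquiv k).symm.toLinearMap ∘ₗ D.flipHom.toLinearMap

variable (D : OpTwist V V' e σ τ)

theorem flip_mul (a b : V'.Smash) : D.flip (a * b) = D.flip b * D.flip a := by
  simp [flip]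

theorem flip_inl_ι (m : M') : D.flip (inl V' (TensorAlgebra.ι k m)) =
    inl V (TensorAlgebra.ι k (e m)) := by
  simp [flip, flipHom, lift_inl]

theorem flip_inr (h : H) : D.flip (inr V' h) = inr V (σ h) := by
  simp [flip, flipHom, lift_inr, flipInr_apply]

theorem flip_inl (x : TensorAlgebra k M') : D.flip (inl V' x) = inl V (rev e.toLinearMap x) := by
  induction x using TensorAlgebra.induction with
  | algebraMap c =>
    rw [AlgHom.commutes, ← AlgHom.commutes (inr V'), flip_inr, rev_algebraMap, AlgHom.commutes,
      ← AlgHom.commutes (inr V)]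
    simp [Algebra.algebraMap_eq_smul_one, D.σ_one]
  | ι m => rw [flip_inl_ι, rev_ι]; rfl
  | mul x y hx hy => rw [map_mul, flip_mul, hx, hy, rev_mul, map_mul]
  | add x y hx hy => simp only [map_add, hx, hy]

theorem flip_mk (x : TensorAlgebra k M') (h : H) : D.flip (Smash.mk V' x h) =
    (toTensor V).symm (actFlip V.tensorAct (σ h ⊗ₜ rev e.toLinearMap x)) := by
  rw [← inl_mul_inr, flip_mul, flip_inr, flip_inl, inr_mul_inl, actFlip_tmul]

theorem flip_symm_flip (a : V'.Smash) : D.symm.flip (D.flip a) = a := by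
  induction a using Smash.induction with
  | ι m => rw [flip_inl_ι, flip_inl_ι, LinearEquiv.symm_apply_apply]
  | inr h => rw [flip_inr, flip_inr, D.σ_σ]
  | add a b ha hb => rw [map_add, map_add, ha, hb]
  | mul a b ha hb => rw [flip_mul, flip_mul, ha, hb]

/-- Both sides are antimultiplicative in `a`, so V and H suffice: `coact` gives the first, `comul_σ`
the second. -/
theorem comulHom_flip (a : V'.Smash) : comulHom V (D.flip a) =
    TensorProduct.map D.flip D.flip (comulHom V' a) := by
  induction a using Smash.induction with
  | ι m =>
    rw [flip_inl_ι, comulHom_inl, comulHom_inl, comulInl_ι, comulInl_ι, coactHom_ι, coactHom_ι,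
      D.coact, map_add, TensorProduct.map_tmul, flip_inl_ι, ← map_one (inr V'), flip_inr, D.σ_one,
      map_one]
    congr 1
    generalize V'.coact m = t
    induction t with
    | zero => simp
    | add x y hx hy => simp only [map_add, hx, hy]
    | tmul x y => simp [flip_inr, flip_inl_ι]
  | inr h =>
    rw [flip_inr, comulHom_inr, comulHom_inr, comulInr_apply, comulInr_apply, D.comul_σ]
    generalize Coalgebra.comul (R := k) h = t
    induction t with
    | zero => simp
    | add x y hx hy => simp only [map_add, hx, hy]
    | tmul x y => simp [flip_inr]
  | add a b ha hb => simp only [map_add, ha, hb]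
  | mul a b ha hb =>
    rw [flip_mul, map_mul, map_mul, ha, hb]
    generalize comulHom V' a = s
    generalize comulHom V' b = t
    induction s with
    | zero => simp
    | add x y hx hy => simp only [map_add, add_mul, mul_add, hx, hy]
    | tmul x y =>
    induction t with
    | zero => simp
    | add x y hx hy => simp only [map_add, add_mul, mul_add, hx, hy]
    | tmul x y => simp [flip_mul]

end OpTwist
end YDModule
end HopfLift
namespace HopfLift

namespace YDModule

variable {k H M M' : Type*} [Field k] [Ring H] [HopfAlgebra k H] [AddCommGroup M] [Module k M]
  [AddCommGroup M'] [Module k M']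

/-! ### The projection of `T(V) # H` to the bosonization -/

section Projection

variable (V : YDModule k H M)

open Smash

theorem nicholsAct_proj (h : H) (x : TensorAlgebra k M) :
    V.nicholsAct h (V.proj x) = V.proj (V.tensorAct h x) := rfl

theorem nicholsCoact_proj (x : TensorAlgebra k M) :
    V.nicholsCoact (V.proj x) = V.proj.toLinearMap.lTensor H (V.tensorCoact x) := rfl

theorem nicholsCounit_proj (x : TensorAlgebra k M) :
    V.nicholsCounit (V.proj x) = TensorAlgebra.algebraMapInv x := rfl

theorem nicholsComul_proj (x : TensorAlgebra k M) : V.nicholsComul (V.proj x) =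
    TensorProduct.map V.proj.toLinearMap V.proj.toLinearMap (V.tensorComul x) := rfl

/-- The projection of `T(V) # H` to the bosonization. -/
def smashProj : V.Smash →ₗ[k] V.Nichols ⊗[k] H :=
  V.proj.toLinearMap.rTensor H ∘ₗ (toTensor V).toLinearMap

theorem smashProj_mk (x : TensorAlgebra k M) (h : H) :
    V.smashProj (Smash.mk V x h) = V.proj x ⊗ₜ h := rfl

theorem smashProj_surjective : Function.Surjective V.smashProj :=
  (LinearMap.rTensor_surjective H V.proj_surjective).comp (toTensor V).surjective

theorem smashProj_one : V.smashProj 1 = V.bosonization.one := by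
  rw [Smash.one_def, smashProj_mk, map_one]
  rfl

/-- Both products are computed by `smashMul_tmul`. As the bosonization is only a list of operations,
later identities in it are pulled back along the surjection from the ring T(V) # H. -/
theorem smashProj_mul (a b : V.Smash) :
    V.smashProj (a * b) = V.bosonization.mul (V.smashProj a ⊗ₜ V.smashProj b) := by
  induction a using mk_induction with
  | zero => simp
  | add x y hx hy => simp only [map_add, add_mul, add_tmul, hx, hy]
  | mk x h =>
  induction b using mk_induction with
  | zero => simp
  | add x y hx hy => simp only [map_add, mul_add, tmul_add, hx, hy]
  | mk y g =>
  rw [smashProj_mk, smashProj_mk, bosonization, LinearMap.comp_apply, smashMul_tmul, mk_mul_mk]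
  generalize Coalgebra.comul (R := k) h = t
  induction t with
  | zero => simp
  | add x y hx hy => simp only [map_add, hx, hy]
  | tmul a b => simp [smashProj_mk, nicholsAct_proj]

theorem map_smashProj_comulHom (a : V.Smash) :
    TensorProduct.map V.smashProj V.smashProj (comulHom V a) =
      V.bosonization.comul (V.smashProj a) := by
  induction a using mk_induction with
  | zero => simp
  | add x y hx hy => simp only [map_add, hx, hy]
  | mk x h =>
  rw [smashProj_mk, comulHom_mk, bosonization, LinearMap.comp_apply, TensorProduct.map_tmul,
    nicholsComul_proj]
  generalize V.tensorComul x = s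
  generalize Coalgebra.comul (R := k) h = t
  induction s with
  | zero => simp
  | add x y hx hy => simp only [map_add, add_tmul, hx, hy]
  | tmul a b =>
  induction t with
  | zero => simp
  | add x y hx hy => simp only [map_add, tmul_add, hx, hy]
  | tmul c d =>
    simp only [applyMiddle, LinearMap.comp_apply, LinearEquiv.coe_coe, TensorProduct.assoc_tmul,
      LinearMap.lTensor_tmul, TensorProduct.assoc_symm_tmul, LinearMap.rTensor_tmul,
      coactFlip_tmul, TensorProduct.map_tmul, AlgHom.toLinearMap_apply, nicholsCoact_proj]
    generalize V.tensorCoact b = u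
    induction u with
    | zero => simp
    | add x y hx hy => simp only [map_add, add_tmul, tmul_add, hx, hy]
    | tmul x y => simp [smashProj_mk]

theorem bosonization_counit_smashProj_mk (x : TensorAlgebra k M) (h : H) :
    V.bosonization.counit (V.smashProj (Smash.mk V x h)) =
      TensorAlgebra.algebraMapInv x * Coalgebra.counit (R := k) h := by
  simp [bosonization, smashProj_mk, nicholsCounit_proj]

/-- The composite is the algebra map obtained by `lift` from the counits of T(V) and H; the relation
it requires holds because both sides vanish on V. -/
theorem bosonization_counit_smashProj_mul (a b : V.Smash) :
    V.bosonization.counit (V.smashProj (a * b)) =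
      V.bosonization.counit (V.smashProj a) * V.bosonization.counit (V.smashProj b) := by
  have h : ∀ a, V.bosonization.counit (V.smashProj a) = lift V TensorAlgebra.algebraMapInv
      (Bialgebra.counitAlgHom k H) (by
        intro h m
        have : ∀ t : H ⊗[k] H, LinearMap.mul' k k (TensorProduct.map
          ((TensorAlgebra.algebraMapInv (R := k) (M := M)).toLinearMap ∘ₗ
            V.tensorAct.flip (TensorAlgebra.ι k m)) (Bialgebra.counitAlgHom k H).toLinearMap t) =
            0 := by
          intro t
          induction t with
          | zero => simp
          | add x y hx hy => simp only [map_add, hx, hy, add_zero]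
          | tmul x y => simp [tensorAct_ι, TensorAlgebra.algebraMapInv]
        rw [this]
        simp [TensorAlgebra.algebraMapInv]) a := by
    intro a
    induction a using mk_induction with
    | zero => simp
    | add x y hx hy => simp only [map_add, hx, hy]
    | mk x h => rw [bosonization_counit_smashProj_mk, Smash.lift_mk]; rfl
  simp only [h, map_mul]

/-- The map `x # h ↦ ε(h) x`. -/
def Smash.fst : V.Smash →ₗ[k] TensorAlgebra k M :=
  (TensorProduct.rid k _).toLinearMap ∘ₗ (Coalgebra.counit (R := k)).lTensor _ ∘ₗ
    (toTensor V).toLinearMap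

theorem Smash.fst_mk (x : TensorAlgebra k M) (h : H) :
    Smash.fst V (Smash.mk V x h) = Coalgebra.counit (R := k) h • x := by
  simp [Smash.fst]

theorem counit_tensorCoact (x : TensorAlgebra k M) : TensorProduct.lid k _
    ((Coalgebra.counit (R := k) (A := H)).rTensor _ (V.tensorCoact x)) = x := by
  have : ((Algebra.TensorProduct.lid k (TensorAlgebra k M)).toAlgHom.comp
      (Algebra.TensorProduct.map (Bialgebra.counitAlgHom k H) (AlgHom.id k _))).comp V.tensorCoact =
      AlgHom.id k _ := by
    ext m
    have h := LinearMap.congr_fun V.counit_coact m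
    simp only [LinearMap.comp_apply, LinearEquiv.coe_coe, LinearMap.id_apply] at h
    simp only [LinearMap.comp_apply, AlgHom.toLinearMap_apply, AlgHom.comp_apply, tensorCoact_ι,
      AlgHom.id_apply]
    conv_rhs => rw [← h]
    generalize V.coact m = t
    induction t with
    | zero => simp
    | add x y hx hy => simp only [map_add, hx, hy]
    | tmul x y => simp
  exact DFunLike.congr_fun this x

/-- Applying ε to the factors in H removes the coaction from x⁽¹⁾ (x⁽²⁾)₋₁ ⊗ (x⁽²⁾)₀. The braided
comultiplication is thus recovered from the multiplicative one. -/
theorem map_fst_comulHom_inl (x : TensorAlgebra k M) :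
    TensorProduct.map (Smash.fst V) (Smash.fst V) (comulHom V (inl V x)) = V.tensorComul x := by
  rw [inl_apply, comulHom_mk, Bialgebra.comul_one, Algebra.TensorProduct.one_def]
  generalize V.tensorComul x = t
  induction t with
  | zero => simp
  | add x y hx hy => simp only [map_add, add_tmul, hx, hy]
  | tmul a b =>
    conv_rhs => rw [← V.counit_tensorCoact b]
    simp only [applyMiddle, LinearMap.comp_apply, LinearEquiv.coe_coe, TensorProduct.assoc_tmul,
      LinearMap.lTensor_tmul, LinearMap.rTensor_tmul,
      coactFlip_tmul, AlgHom.toLinearMap_apply, TensorProduct.assoc_symm_tmul]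
    generalize V.tensorCoact b = u
    induction u with
    | zero => simp
    | add x y hx hy => simp only [map_add, add_tmul, tmul_add, hx, hy]
    | tmul x y => simp [Smash.fst_mk, smul_tmul]

end Projection

/-! ### Matching the defining ideals and descending `flip` to the bosonizations -/

namespace OpTwist

variable {V : YDModule k H M} {V' : YDModule k H M'} {e : M' ≃ₗ[k] M} {σ τ : H →ₗ[k] H}

open Smash

/-- The image in `T(V)` of the defining ideal of `B(V')`. -/
def revIdeal (V' : YDModule k H M') (e : M' ≃ₗ[k] M) : Ideal (TensorAlgebra k M) where
  carrier := {x | rev e.symm.toLinearMap x ∈ V'.nicholsIdeal}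
  add_mem' hx hy := by
    simp only [Set.mem_ofPred_eq, map_add] at *
    exact Ideal.add_mem _ hx hy
  zero_mem' := by simp
  smul_mem' c x hx := by
    simp only [Set.mem_ofPred_eq, smul_eq_mul, rev_mul] at *
    exact Ideal.mul_mem_right _ _ hx

theorem mem_revIdeal {x : TensorAlgebra k M} :
    x ∈ revIdeal V' e ↔ rev e.symm.toLinearMap x ∈ V'.nicholsIdeal := Iff.rfl

theorem rev_mem_revIdeal {x : TensorAlgebra k M'} :
    rev e.toLinearMap x ∈ revIdeal V' e ↔ x ∈ V'.nicholsIdeal := by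
  rw [mem_revIdeal, rev_symm_rev]

variable (D : OpTwist V V' e σ τ)

theorem tensorAct_mem_revIdeal (D : OpTwist V V' e σ τ) (h : H) {x : TensorAlgebra k M}
    (hx : x ∈ revIdeal V' e) :
    V.tensorAct h x ∈ revIdeal V' e := by
  rw [mem_revIdeal, ← D.symm.tensorAct_rev]
  exact V'.nicholsIdeal_isHopfIdeal.act_mem _ _ hx

/-- The map to `T(V)/J` induced on the bosonization of `V'`. -/
theorem exists_mkQ_fst_flip (D : OpTwist V V' e σ τ) :
    ∃ q : V'.Nichols ⊗[k] H →ₗ[k]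
      (TensorAlgebra k M ⧸ (revIdeal V' e).restrictScalars k), ∀ a,
      q (V'.smashProj a) = ((revIdeal V' e).restrictScalars k).mkQ (Smash.fst V (D.flip a)) := by
  refine ⟨TensorProduct.lift (V'.descend (((V.tensorAct ∘ₗ σ).flip ∘ₗ rev e.toLinearMap).compr₂
    ((revIdeal V' e).restrictScalars k).mkQ) ?_), fun a => ?_⟩
  · intro x hx
    ext h
    simp only [LinearMap.compr₂_apply, LinearMap.comp_apply, LinearMap.flip_apply,
      LinearMap.zero_apply, Submodule.mkQ_apply, Submodule.Quotient.mk_eq_zero]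
    exact D.tensorAct_mem_revIdeal _ (rev_mem_revIdeal.2 hx)
  · induction a using mk_induction with
    | zero => simp
    | add x y hx hy => simp only [map_add, hx, hy]
    | mk x h =>
      rw [smashProj_mk, TensorProduct.lift.tmul, descend_proj, flip_mk, actFlip_tmul]
      simp only [LinearMap.compr₂_apply, LinearMap.comp_apply, LinearMap.flip_apply]
      congr 1
      -- Since flip(x # h) = σ(h)₁ · rev(x) # σ(h)₂, applying the counit to H leaves σ(h) · rev(x).
      have h1 : ∀ t : H ⊗[k] H, Smash.fst V ((toTensor V).symm
          ((V.tensorAct.flip (rev e.toLinearMap x)).rTensor H t)) = V.tensorAct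
            (TensorProduct.rid k H ((Coalgebra.counit (R := k)).lTensor H t))
            (rev e.toLinearMap x) := by
        intro t
        induction t with
        | zero => simp
        | add x y hx hy => simp only [map_add, LinearMap.add_apply, hx, hy]
        | tmul a b => simp [Smash.fst_mk]
      rw [h1, Coalgebra.lTensor_counit_comul]
      simp

/-- `rev` transports generators, action and coaction. The coideal condition is checked in the smash
products, where `flip` is comultiplicative, and is brought back to T(V) by `map_fst_comulHom_inl`.
-/
theorem isHopfIdeal_revIdeal (D : OpTwist V V' e σ τ) : V.IsHopfIdeal (revIdeal V' e) where
  generated := by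
    obtain ⟨S, hS, hI⟩ := V'.nicholsIdeal_isHopfIdeal.generated
    refine ⟨rev e.toLinearMap '' S, ?_, le_antisymm ?_ ?_⟩
    · rintro _ ⟨s, hs, rfl⟩
      obtain ⟨n, hn, h⟩ := hS s hs
      exact ⟨n, hn, rev_mem_pow _ n h⟩
    · intro x hx
      -- The extra factor `c` makes the induction work: `rev` turns left multiplication into right
      -- multiplication, which `c` absorbs.
      have key : ∀ y ∈ V'.nicholsIdeal, ∀ c, rev e.toLinearMap y * c ∈ Ideal.span
          {x | ∃ a b, ∃ s ∈ rev e.toLinearMap '' S, x = a * s * b} := by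
        intro y hy
        rw [hI] at hy
        refine Submodule.span_induction (p := fun y _ => ∀ c, rev e.toLinearMap y * c ∈ Ideal.span
          {x | ∃ a b, ∃ s ∈ rev e.toLinearMap '' S, x = a * s * b}) ?_ (by simp) ?_ ?_ hy
        · rintro _ ⟨a, b, s, hs, rfl⟩ c
          exact Ideal.subset_span ⟨rev e.toLinearMap b, rev e.toLinearMap a * c, _, ⟨s, hs, rfl⟩,
            by simp [rev_mul, mul_assoc]⟩
        · intro x y _ _ hx hy c
          rw [map_add, add_mul]
          exact Ideal.add_mem _ (hx c) (hy c)
        · intro a y _ hy c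
          rw [smul_eq_mul, rev_mul, mul_assoc]
          exact hy _
      have := key _ hx 1
      rwa [mul_one, rev_rev_symm] at this
    · rw [Ideal.span_le]
      rintro _ ⟨a, b, _, ⟨s, hs, rfl⟩, rfl⟩
      change rev e.symm.toLinearMap _ ∈ V'.nicholsIdeal
      rw [rev_mul, rev_mul, rev_symm_rev]
      refine Ideal.mul_mem_left _ _ (Ideal.mul_mem_right _ _ ?_)
      rw [hI]
      exact Ideal.subset_span ⟨1, 1, s, hs, by simp⟩
  act_mem h x hx := D.tensorAct_mem_revIdeal h hx
  coact_mem x hx := by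
    obtain ⟨t, ht⟩ := V'.nicholsIdeal_isHopfIdeal.coact_mem _ hx
    rw [← rev_rev_symm e x, D.tensorCoact_rev, ← ht]
    clear ht
    induction t with
    | zero => simp
    | add x y hx hy => simp only [map_add]; exact Submodule.add_mem _ hx hy
    | tmul a b =>
      exact ⟨σ a ⊗ₜ ⟨rev e.toLinearMap b, rev_mem_revIdeal.2 b.2⟩, by simp⟩
  comul_mem x hx := by
    obtain ⟨q, hq⟩ := D.exists_mkQ_fst_flip
    let Q := ((revIdeal V' e).restrictScalars k).mkQ
    -- The image of the coproduct factors through the bosonization of V', where the class of z is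
    -- zero.
    have h : TensorProduct.map Q Q (V.tensorComul x) = 0 := by
      obtain ⟨z, rfl⟩ : ∃ z, rev e.toLinearMap z = x := ⟨_, rev_rev_symm e x⟩
      have hz : V'.smashProj (inl V' z) = 0 := by
        rw [inl_apply, smashProj_mk, V'.proj_eq_zero (rev_mem_revIdeal.1 hx), zero_tmul]
      have hq' : (Q ∘ₗ Smash.fst V) ∘ₗ D.flip = q ∘ₗ V'.smashProj :=
        LinearMap.ext fun a => (hq a).symm
      rw [← map_fst_comulHom_inl, ← D.flip_inl, comulHom_flip, ← LinearMap.comp_apply,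
        ← LinearMap.comp_apply, ← TensorProduct.map_comp, ← TensorProduct.map_comp, hq',
        TensorProduct.map_comp, LinearMap.comp_apply, map_smashProj_comulHom, hz, map_zero, map_zero]
    have hx : Function.Exact ((revIdeal V' e).restrictScalars k).subtype Q :=
      LinearMap.exact_subtype_mkQ _
    have hQ : Function.Surjective Q := Submodule.mkQ_surjective _
    have hk := TensorProduct.map_ker hx hQ hx hQ
    rw [sup_comm, ← hk]
    exact h

-- Maximality of the defining ideal of B(V) replaces any explicit description of its elements.
include D in
theorem rev_mem_nicholsIdeal {x : TensorAlgebra k M'} (hx : x ∈ V'.nicholsIdeal) :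
    rev e.toLinearMap x ∈ V.nicholsIdeal :=
  V.le_nicholsIdeal D.isHopfIdeal_revIdeal (rev_mem_revIdeal.2 hx)

theorem smashProj_flip_eq_zero {x : TensorAlgebra k M'} (hx : x ∈ V'.nicholsIdeal) (h : H) :
    V.smashProj (D.flip (Smash.mk V' x h)) = 0 := by
  rw [← inl_mul_inr, flip_mul, flip_inl, smashProj_mul, inl_apply, smashProj_mk,
    V.proj_eq_zero (D.rev_mem_nicholsIdeal hx), zero_tmul, tmul_zero, map_zero]

/-- The map induced by `flip` on the bosonizations. -/
def flipLin : V'.Nichols ⊗[k] H →ₗ[k] V.Nichols ⊗[k] H :=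
  TensorProduct.lift (V'.descend
    (TensorProduct.curry (V.smashProj ∘ₗ D.flip ∘ₗ (toTensor V').symm.toLinearMap))
    (fun _ hx => LinearMap.ext fun h => D.smashProj_flip_eq_zero hx h))

theorem flipLin_smashProj (a : V'.Smash) :
    D.flipLin (V'.smashProj a) = V.smashProj (D.flip a) := by
  induction a using mk_induction with
  | zero => simp
  | add x y hx hy => simp only [map_add, hx, hy]
  | mk x h => rfl

theorem flipLin_symm_flipLin (a : V'.Nichols ⊗[k] H) : D.symm.flipLin (D.flipLin a) = a := by
  obtain ⟨a, rfl⟩ := V'.smashProj_surjective a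
  rw [flipLin_smashProj, flipLin_smashProj, flip_symm_flip]

/-- The isomorphism induced by `flip` on the bosonizations. -/
def flipEquiv : V'.Nichols ⊗[k] H ≃ₗ[k] V.Nichols ⊗[k] H where
  __ := D.flipLin
  invFun := D.symm.flipLin
  left_inv := D.flipLin_symm_flipLin
  right_inv := D.symm.flipLin_symm_flipLin

theorem flipEquiv_smashProj (a : V'.Smash) :
    D.flipEquiv (V'.smashProj a) = V.smashProj (D.flip a) := D.flipLin_smashProj a

theorem bosonization_counit_flip (a : V'.Smash) :
    V.bosonization.counit (V.smashProj (D.flip a)) = V'.bosonization.counit (V'.smashProj a) := by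
  induction a using Smash.induction with
  | ι m =>
    rw [flip_inl_ι]
    simp [inl_apply, bosonization_counit_smashProj_mk, TensorAlgebra.algebraMapInv]
  | inr h =>
    rw [flip_inr]
    simp [inr_apply, bosonization_counit_smashProj_mk, D.counit_σ]
  | add x y hx hy => simp only [map_add, hx, hy]
  | mul x y hx hy => rw [flip_mul, bosonization_counit_smashProj_mul, hx, hy,
      bosonization_counit_smashProj_mul, mul_comm]

/-- The projections from the smash products are surjective and respect all operations, so each
clause reduces to the same property of `flip`. -/
theorem isIso_flipEquiv : V'.bosonization.op.IsIso V.bosonization D.flipEquiv where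
  map_one := by
    change D.flipEquiv V'.bosonization.one = _
    rw [← smashProj_one, flipEquiv_smashProj, ← smashProj_one, ← map_one (inr V'), flip_inr,
      D.σ_one, map_one]
  map_mul := by
    refine TensorProduct.ext' fun a b => ?_
    obtain ⟨a, rfl⟩ := V'.smashProj_surjective a
    obtain ⟨b, rfl⟩ := V'.smashProj_surjective b
    change D.flipEquiv (V'.bosonization.mul (V'.smashProj b ⊗ₜ V'.smashProj a)) =
      V.bosonization.mul (D.flipEquiv (V'.smashProj a) ⊗ₜ D.flipEquiv (V'.smashProj b))
    rw [← smashProj_mul, flipEquiv_smashProj, flipEquiv_smashProj, flipEquiv_smashProj,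
      ← smashProj_mul, flip_mul]
  map_counit := by
    apply LinearMap.ext
    intro a
    obtain ⟨a, rfl⟩ := V'.smashProj_surjective a
    change V.bosonization.counit (D.flipEquiv (V'.smashProj a)) = _
    rw [flipEquiv_smashProj]
    exact D.bosonization_counit_flip a
  map_comul := by
    apply LinearMap.ext
    intro a
    obtain ⟨a, rfl⟩ := V'.smashProj_surjective a
    change TensorProduct.map D.flipEquiv.toLinearMap D.flipEquiv.toLinearMap
      (V'.bosonization.comul (V'.smashProj a)) =
      V.bosonization.comul (D.flipEquiv (V'.smashProj a))
    have h : D.flipEquiv.toLinearMap ∘ₗ V'.smashProj = V.smashProj ∘ₗ D.flip :=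
      LinearMap.ext D.flipEquiv_smashProj
    rw [flipEquiv_smashProj, ← map_smashProj_comulHom, ← map_smashProj_comulHom, comulHom_flip,
      ← LinearMap.comp_apply, ← LinearMap.comp_apply, ← TensorProduct.map_comp,
      ← TensorProduct.map_comp, h]

end OpTwist
end YDModule
end HopfLift
namespace HopfLift

/-! ### Filtrations and simple subcoalgebras -/

section Filtered

variable {k A E : Type*} [Field k] [AddCommGroup A] [Module k A] [Coalgebra k A]
  [AddCommGroup E] [Module k E]

/-- An injective map that is comultiplicative on the simple subcoalgebra `C` sends `C` to the
lowest step of any exhaustive coalgebra filtration. -/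
theorem map_mem_of_isSimpleSubcoalgebra {C : Submodule k A} (hC : IsSimpleSubcoalgebra k C)
    (ΔE : E →ₗ[k] E ⊗[k] E) (F : ℕ → Submodule k E) (hexh : ∀ x, ∃ n, x ∈ F n)
    (h1 : ∀ n, ∀ x ∈ F n, ΔE x ∈ LinearMap.range (TensorProduct.mapIncl (F n) (F n)))
    (h2 : ∀ n, ∀ x ∈ F (n + 1), ΔE x ∈
      LinearMap.range (TensorProduct.mapIncl (F n) (F (n + 1))) ⊔
        LinearMap.range (TensorProduct.mapIncl (F (n + 1)) (F n)))
    (f : A →ₗ[k] E) (hf : ∀ c ∈ C, ΔE (f c) = TensorProduct.map f f (Coalgebra.comul c))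
    (hinj : ∀ c ∈ C, f c = 0 → c = 0) {c : A} (hc : c ∈ C) : f c ∈ F 0 := by
  let v : C →ₗ[k] E := f ∘ₗ C.subtype
  have hv : Function.Injective v := (injective_iff_map_eq_zero v).2 fun c hc =>
    Subtype.ext (hinj c c.2 hc)
  have hs : ∀ x ∈ C, ∃ s : C ⊗[k] C, TensorProduct.mapIncl C C s = Coalgebra.comul x ∧
      TensorProduct.map v v s = ΔE (f x) := by
    intro x hx
    obtain ⟨s, hs⟩ := hC.1 x hx
    refine ⟨s, hs, ?_⟩
    rw [hf x hx, ← hs, TensorProduct.mapIncl, ← LinearMap.comp_apply, ← TensorProduct.map_comp]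
  -- Membership of Δ_E(f x) in F n ⊗ F n is tested by reducing each factor modulo F n. As `v` is
  -- injective and tensoring is exact, the test can be made on C ⊗ C. By simplicity these
  -- subcoalgebras are 0 or C.
  have hsub : ∀ n, IsSubcoalgebra k (C ⊓ (F n).comap f) := by
    intro n x hx
    obtain ⟨s, hs, hs'⟩ := hs x hx.1
    have hx' := h1 n (f x) hx.2
    rw [← hs'] at hx'
    have hr := (mem_range_rTensor_iff _ _).1 (range_mapIncl_le_rTensor _ _ hx')
    have hl := (mem_range_lTensor_iff _ _).1 (range_mapIncl_le_lTensor _ _ hx')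
    let u : C →ₗ[k] E ⧸ F n := (F n).mkQ ∘ₗ v
    have hr' : u.rTensor C s = 0 := by
      apply Module.Flat.lTensor_preserves_injective_linearMap (M := E ⧸ F n) v hv
      rw [map_zero, ← hr, ← LinearMap.comp_apply, ← LinearMap.comp_apply,
        LinearMap.lTensor_comp_rTensor, LinearMap.rTensor_comp_map]
    have hl' : u.lTensor C s = 0 := by
      apply Module.Flat.rTensor_preserves_injective_linearMap (M := E ⧸ F n) v hv
      rw [map_zero, ← hl, ← LinearMap.comp_apply, ← LinearMap.comp_apply,
        LinearMap.rTensor_comp_lTensor, LinearMap.lTensor_comp_map]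
    have := map_mem_range_mapIncl (u := C.subtype) (v := C.subtype)
      (N₁ := C ⊓ (F n).comap f) (N₁' := C ⊓ (F n).comap f)
      (fun p hp => ⟨p.2, (Submodule.Quotient.mk_eq_zero (F n)).1 hp⟩)
      (fun p hp => ⟨p.2, (Submodule.Quotient.mk_eq_zero (F n)).1 hp⟩)
      (mem_range_mapIncl_of_ker hr' hl')
    rw [← hs]
    exact this
  have hdich : ∀ n, C ⊓ (F n).comap f = ⊥ ∨ C ⊓ (F n).comap f = C :=
    fun n => hC.2.2 _ inf_le_left (hsub n)
  by_contra hcon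
  have h0 : ¬ C ≤ (F 0).comap f := fun h => hcon (h hc)
  classical
  have hex : ∃ n, C ≤ (F n).comap f := by
    obtain ⟨y, hy, hy0⟩ := Submodule.exists_mem_ne_zero_of_ne_bot hC.2.1
    obtain ⟨n, hn⟩ := hexh (f y)
    refine ⟨n, (hdich n).elim (fun h => ?_) inf_eq_left.1⟩
    exact absurd ((Submodule.mem_bot k).1 (h ▸ (⟨hy, hn⟩ : y ∈ C ⊓ (F n).comap f))) hy0
  -- Let n + 1 be the first step containing f(C). Then f(C) meets F n trivially, so C embeds in E /
  -- F n, whereas h2 makes the coproduct vanish in E / F n ⊗ E / F n.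
  obtain ⟨n, hn⟩ : ∃ n, Nat.find hex = n + 1 := by
    refine Nat.exists_eq_succ_of_ne_zero fun h => h0 ?_
    have := Nat.find_spec hex
    rwa [h] at this
  have hn1 : C ≤ (F (n + 1)).comap f := hn ▸ Nat.find_spec hex
  have hn0 : C ⊓ (F n).comap f = ⊥ :=
    (hdich n).resolve_right fun h => Nat.find_min hex (by omega) (inf_eq_left.1 h)
  apply hC.2.1
  refine (Submodule.eq_bot_iff C).2 fun x hx => ?_
  obtain ⟨s, hs, hs'⟩ := hs x hx
  let g : C →ₗ[k] E ⧸ F n := (F n).mkQ ∘ₗ v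
  have hg : Function.Injective g := (injective_iff_map_eq_zero g).2 fun c hc =>
    Subtype.ext ((Submodule.mem_bot k).1
      (hn0 ▸ (⟨c.2, (Submodule.Quotient.mk_eq_zero (F n)).1 hc⟩ : (c : A) ∈ C ⊓ (F n).comap f)))
  have hz : TensorProduct.map (F n).mkQ (F n).mkQ (ΔE (f x)) = 0 := by
    have hle : LinearMap.range (TensorProduct.mapIncl (F n) (F (n + 1))) ⊔
        LinearMap.range (TensorProduct.mapIncl (F (n + 1)) (F n)) ≤
        LinearMap.ker (TensorProduct.map (F n).mkQ (F n).mkQ) := by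
      refine sup_le (range_mapIncl_le ?_) (range_mapIncl_le ?_)
      · intro p hp q _
        have : (F n).mkQ p = 0 := (Submodule.Quotient.mk_eq_zero _).2 hp
        rw [LinearMap.mem_ker, TensorProduct.map_tmul, this, zero_tmul]
      · intro p _ q hq
        have : (F n).mkQ q = 0 := (Submodule.Quotient.mk_eq_zero _).2 hq
        rw [LinearMap.mem_ker, TensorProduct.map_tmul, this, tmul_zero]
    exact hle (h2 n _ (hn1 hx))
  have hs0 : s = 0 := by
    have hi : Function.Injective (TensorProduct.map g g) := by
      rw [← LinearMap.lTensor_comp_rTensor]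
      exact (Module.Flat.lTensor_preserves_injective_linearMap g hg).comp
        (Module.Flat.rTensor_preserves_injective_linearMap g hg)
    apply hi
    rw [map_zero, ← hz, ← hs', ← LinearMap.comp_apply, ← TensorProduct.map_comp]
  rw [hs0, map_zero] at hs
  -- Now Δ(x) = 0, and the counit axiom forces x = 0 for every x in C.
  have := Coalgebra.rTensor_counit_comul (R := k) x
  rw [← hs, map_zero] at this
  have h3 := congrArg (TensorProduct.lid k A) this
  simpa using h3.symm

end Filtered

/-! ### The filtration of the bosonization by degree -/

namespace YDModule

variable {k H M : Type*} [Field k] [Ring H] [HopfAlgebra k H] [AddCommGroup M] [Module k M]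
  (V : YDModule k H M)

namespace Smash

/-- The span of the elements `x # h` with `x` of degree at most `n`. -/
def fil : ℕ → Submodule k V.Smash
  | 0 => LinearMap.range (inr V).toLinearMap
  | n + 1 => fil n ⊔ Submodule.span k {z | ∃ m, ∃ y ∈ fil n, z = inl V (TensorAlgebra.ι k m) * y}

theorem fil_mono : Monotone (fil V) := monotone_nat_of_le_succ fun _ => le_sup_left

theorem ι_mul_mem_fil (m : M) {n : ℕ} {y : V.Smash} (hy : y ∈ fil V n) :
    inl V (TensorAlgebra.ι k m) * y ∈ fil V (n + 1) :=
  (le_sup_right : _ ≤ fil V (n + 1)) (Submodule.subset_span ⟨m, y, hy, rfl⟩)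

variable {V} in
theorem fil_succ_induction {n : ℕ} {p : V.Smash → Prop} (mem : ∀ y ∈ fil V n, p y)
    (ι_mul : ∀ m, ∀ y ∈ fil V n, p (inl V (TensorAlgebra.ι k m) * y))
    (add : ∀ a b, p a → p b → p (a + b)) (smul : ∀ (c : k) a, p a → p (c • a))
    {y : V.Smash} (hy : y ∈ fil V (n + 1)) : p y := by
  obtain ⟨a, ha, b, hb, rfl⟩ := Submodule.mem_sup.1 hy
  refine add _ _ (mem a ha) ?_
  refine Submodule.span_induction (p := fun y _ => p y) ?_ (mem 0 (Submodule.zero_mem _))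
    (fun a b _ _ => add a b) (fun c a _ => smul c a) hb
  rintro _ ⟨m, y, hy, rfl⟩
  exact ι_mul m y hy

/-- Since h v = (h₁ · v) h₂ and the action preserves V, moving h inward does not raise the degree.
-/
theorem inr_mul_mem_fil (h : H) {n : ℕ} {y : V.Smash} (hy : y ∈ fil V n) :
    inr V h * y ∈ fil V n := by
  induction n generalizing h y with
  | zero =>
    obtain ⟨g, rfl⟩ := hy
    exact ⟨h * g, map_mul (inr V) h g⟩
  | succ n ih =>
    refine fil_succ_induction (p := fun y => ∀ h, inr V h * y ∈ fil V (n + 1)) ?_ ?_ ?_ ?_ hy h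
    · exact fun y hy h => fil_mono V n.le_succ (ih h hy)
    · intro m y hy h
      rw [← mul_assoc, inr_mul_inl]
      generalize Coalgebra.comul (R := k) h = t
      induction t with
      | zero => simp
      | add a b ha hb => simp only [map_add, add_mul]; exact Submodule.add_mem _ ha hb
      | tmul a b =>
        rw [LinearMap.rTensor_tmul, toTensor_symm_tmul, LinearMap.flip_apply, tensorAct_ι,
          ← inl_mul_inr, mul_assoc]
        exact ι_mul_mem_fil V _ (ih b hy)
    · intro a b ha hb h
      rw [mul_add]
      exact Submodule.add_mem _ (ha h) (hb h)
    · intro c a ha h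
      rw [mul_smul_comm]
      exact Submodule.smul_mem _ c (ha h)

theorem exists_mem_fil (a : V.Smash) : ∃ n, a ∈ fil V n := by
  induction a using mk_induction with
  | zero => exact ⟨0, Submodule.zero_mem _⟩
  | add a b ha hb =>
    obtain ⟨m, hm⟩ := ha
    obtain ⟨n, hn⟩ := hb
    exact ⟨max m n, Submodule.add_mem _ (fil_mono V (le_max_left _ _) hm)
      (fil_mono V (le_max_right _ _) hn)⟩
  | mk x h =>
    induction x using tensorAlgebra_induction_ι_mul with
    | one => exact ⟨0, h, rfl⟩
    | add x y hx hy =>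
      obtain ⟨m, hm⟩ := hx
      obtain ⟨n, hn⟩ := hy
      refine ⟨max m n, ?_⟩
      rw [← inl_mul_inr, map_add, add_mul, inl_mul_inr, inl_mul_inr]
      exact Submodule.add_mem _ (fil_mono V (le_max_left _ _) hm)
        (fil_mono V (le_max_right _ _) hn)
    | smul c x hx =>
      obtain ⟨n, hn⟩ := hx
      refine ⟨n, ?_⟩
      rw [← inl_mul_inr, map_smul, smul_mul_assoc, inl_mul_inr]
      exact Submodule.smul_mem _ c hn
    | ι_mul m x hx =>
      obtain ⟨n, hn⟩ := hx
      exact ⟨n + 1, by rw [← inl_mul_mk]; exact ι_mul_mem_fil V m hn⟩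

/-- Multiplication with `Δ(v)` raises the degree of one of the tensor factors. -/
theorem comulInl_ι_mul_mem {i j : ℕ} (m : M) {t : V.Smash ⊗[k] V.Smash}
    (ht : t ∈ LinearMap.range (TensorProduct.mapIncl (fil V i) (fil V j))) :
    comulInl V (TensorAlgebra.ι k m) * t ∈
      LinearMap.range (TensorProduct.mapIncl (fil V (i + 1)) (fil V j)) ⊔
        LinearMap.range (TensorProduct.mapIncl (fil V i) (fil V (j + 1))) := by
  refine range_mapIncl_le (S := (LinearMap.range (TensorProduct.mapIncl (fil V (i + 1)) (fil V j)) ⊔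
        LinearMap.range (TensorProduct.mapIncl (fil V i) (fil V (j + 1)))).comap
        (LinearMap.mulLeft k (comulInl V (TensorAlgebra.ι k m)))) (fun p hp q hq => ?_) ht
  rw [Submodule.mem_comap, LinearMap.mulLeft_apply, comulInl_ι, add_mul, coactHom_ι,
    Algebra.TensorProduct.tmul_mul_tmul, one_mul]
  refine Submodule.add_mem_sup (tmul_mem_range_mapIncl (ι_mul_mem_fil V m hp) hq) ?_
  generalize V.coact m = u
  induction u with
  | zero => simp
  | add x y hx hy => rw [map_add, add_mul]; exact Submodule.add_mem _ hx hy
  | tmul h n =>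
    rw [TensorProduct.map_tmul, Algebra.TensorProduct.tmul_mul_tmul]
    exact tmul_mem_range_mapIncl (inr_mul_mem_fil V h hp) (ι_mul_mem_fil V n hq)

theorem comulHom_mem_of_fil_zero {y : V.Smash} (hy : y ∈ fil V 0) :
    comulHom V y ∈ LinearMap.range (TensorProduct.mapIncl (fil V 0) (fil V 0)) := by
  obtain ⟨h, rfl⟩ := hy
  change comulHom V (inr V h) ∈ _
  rw [comulHom_inr, comulInr_apply]
  generalize Coalgebra.comul (R := k) h = t
  induction t with
  | zero => simp
  | add a b ha hb => rw [map_add]; exact Submodule.add_mem _ ha hb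
  | tmul a b => exact tmul_mem_range_mapIncl ⟨a, rfl⟩ ⟨b, rfl⟩

/-- Multiplication by Δ(v) raises one tensor factor by one degree, so this containment propagates by
induction. It is weaker than Δ(F_n) ⊆ ∑ F_i ⊗ F_{n-i}, but it is all that
`map_mem_of_isSimpleSubcoalgebra` needs. -/
theorem comulHom_mem_of_fil_succ (n : ℕ) {y : V.Smash} (hy : y ∈ fil V (n + 1)) :
    comulHom V y ∈ LinearMap.range (TensorProduct.mapIncl (fil V n) (fil V (n + 1))) ⊔
      LinearMap.range (TensorProduct.mapIncl (fil V (n + 1)) (fil V n)) := by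
  induction n generalizing y with
  | zero =>
    refine fil_succ_induction (p := fun y => comulHom V y ∈
      LinearMap.range (TensorProduct.mapIncl (fil V 0) (fil V 1)) ⊔
      LinearMap.range (TensorProduct.mapIncl (fil V 1) (fil V 0))) ?_ ?_ ?_ ?_ hy
    · exact fun y hy => Submodule.mem_sup_left
        (range_mapIncl_mono le_rfl (fil_mono V zero_le_one) (comulHom_mem_of_fil_zero V hy))
    · intro m y hy
      rw [map_mul, comulHom_inl, sup_comm]
      exact comulInl_ι_mul_mem V m (comulHom_mem_of_fil_zero V hy)
    · intro a b ha hb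
      rw [map_add]
      exact Submodule.add_mem _ ha hb
    · intro c a ha
      rw [map_smul]
      exact Submodule.smul_mem _ c ha
  | succ n ih =>
    have h1 := fil_mono V n.le_succ
    have h2 := fil_mono V (n + 1).le_succ
    refine fil_succ_induction (p := fun y => comulHom V y ∈
      LinearMap.range (TensorProduct.mapIncl (fil V (n + 1)) (fil V (n + 1 + 1))) ⊔
      LinearMap.range (TensorProduct.mapIncl (fil V (n + 1 + 1)) (fil V (n + 1)))) ?_ ?_ ?_ ?_ hy
    · intro y hy
      exact sup_le_sup (range_mapIncl_mono h1 h2) (range_mapIncl_mono h2 h1) (ih hy)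
    · intro m y hy
      rw [map_mul, comulHom_inl]
      obtain ⟨s, hs, t, ht, hst⟩ := Submodule.mem_sup.1 (ih hy)
      rw [← hst, mul_add]
      refine Submodule.add_mem _ ?_ ?_
      · refine SetLike.le_def.1 (sup_le ?_ ?_) (comulInl_ι_mul_mem V m hs)
        · exact le_sup_of_le_left (range_mapIncl_mono le_rfl h2)
        · exact le_sup_of_le_left (range_mapIncl_mono h1 le_rfl)
      · refine SetLike.le_def.1 (sup_le ?_ ?_) (comulInl_ι_mul_mem V m ht)
        · exact le_sup_of_le_right (range_mapIncl_mono le_rfl h1)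
        · exact le_sup_of_le_right (range_mapIncl_mono h2 le_rfl)
    · intro a b ha hb
      rw [map_add]
      exact Submodule.add_mem _ ha hb
    · intro c a ha
      rw [map_smul]
      exact Submodule.smul_mem _ c ha

theorem comulHom_mem_of_fil (n : ℕ) {y : V.Smash} (hy : y ∈ fil V n) :
    comulHom V y ∈ LinearMap.range (TensorProduct.mapIncl (fil V n) (fil V n)) := by
  cases n with
  | zero => exact comulHom_mem_of_fil_zero V hy
  | succ n =>
    have h1 := fil_mono V n.le_succ
    exact SetLike.le_def.1 (sup_le (range_mapIncl_mono h1 le_rfl) (range_mapIncl_mono le_rfl h1))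
      (comulHom_mem_of_fil_succ V n hy)

end Smash

open Smash

/-- The image of `fil` in the bosonization. -/
def bosFil (n : ℕ) : Submodule k (V.Nichols ⊗[k] H) := (fil V n).map V.smashProj

-- The degree filtration of T(V) # H projects to an exhaustive coalgebra filtration of the
-- bosonization, with lowest step 1 ⊗ H.
variable {V} in
theorem map_mem_bosFil_of_isSimpleSubcoalgebra {A : Type*} [AddCommGroup A] [Module k A]
    [Coalgebra k A] {C : Submodule k A} (hC : IsSimpleSubcoalgebra k C)
    (f : A →ₗ[k] V.Nichols ⊗[k] H)
    (hf : ∀ c ∈ C, V.bosonization.comul (f c) = TensorProduct.map f f (Coalgebra.comul c))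
    (hinj : ∀ c ∈ C, f c = 0 → c = 0) {c : A} (hc : c ∈ C) : ∃ h : H, f c = 1 ⊗ₜ h := by
  have : f c ∈ V.bosFil 0 := by
    refine map_mem_of_isSimpleSubcoalgebra hC V.bosonization.comul V.bosFil ?_ ?_ ?_ f hf hinj hc
    · intro x
      obtain ⟨a, rfl⟩ := V.smashProj_surjective x
      obtain ⟨n, hn⟩ := exists_mem_fil V a
      exact ⟨n, a, hn, rfl⟩
    · rintro n _ ⟨a, ha, rfl⟩
      rw [← map_smashProj_comulHom]
      exact map_mem_range_mapIncl (fun _ hp => Submodule.mem_map_of_mem hp) (fun _ hp => Submodule.mem_map_of_mem hp)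
        (comulHom_mem_of_fil V n ha)
    · rintro n _ ⟨a, ha, rfl⟩
      rw [← map_smashProj_comulHom]
      obtain ⟨s, hs, t, ht, hst⟩ := Submodule.mem_sup.1 (comulHom_mem_of_fil_succ V n ha)
      rw [← hst, map_add]
      exact Submodule.add_mem_sup
        (map_mem_range_mapIncl (fun _ hp => Submodule.mem_map_of_mem hp) (fun _ hp => Submodule.mem_map_of_mem hp) hs)
        (map_mem_range_mapIncl (fun _ hp => Submodule.mem_map_of_mem hp) (fun _ hp => Submodule.mem_map_of_mem hp) ht)
  obtain ⟨_, ⟨h, rfl⟩, h'⟩ := this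
  exact ⟨h, h'.symm⟩

end YDModule
end HopfLift
namespace HopfLift

/-! ### The opposite of a lifting is a Hopf algebra -/

section GrZero

variable (k A : Type*) [Field k] [AddCommGroup A] [Module k A] [Coalgebra k A]

/-- The projection of `gr A` to its component of degree zero, the coradical of `A`. -/
def grZero : Gr k A →ₗ[k] A :=
  ((coradFilPrev k A 0).submoduleOf (coradFil k A 0)).liftQ (coradFil k A 0).subtype
      (fun _ hx => hx) ∘ₗ
    DirectSum.component k ℕ
      (fun n => coradFil k A n ⧸ (coradFilPrev k A n).submoduleOf (coradFil k A n)) 0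

theorem grZero_symb (n : ℕ) (a : coradFil k A n) :
    grZero k A (symb k A n a) = if n = 0 then (a : A) else 0 := by
  split_ifs with h
  · subst h
    simp only [grZero, symb, LinearMap.comp_apply, DirectSum.component.lof_self]
    rfl
  · simp only [grZero, symb, LinearMap.comp_apply]
    rw [DirectSum.component.of, dif_neg h, map_zero]

theorem symb_induction {p : Gr k A → Prop} (zero : p 0) (symb : ∀ n a, p (symb k A n a))
    (add : ∀ x y, p x → p y → p (x + y)) (x : Gr k A) : p x := by
  induction x using DirectSum.induction_on with
  | zero => exact zero
  | of n a =>
    obtain ⟨a, rfl⟩ := Submodule.mkQ_surjective _ a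
    exact symb n a
  | add x y hx hy => exact add x y hx hy

theorem symb_zero_injective : Function.Injective (symb k A 0) := by
  intro a b h
  have := congrArg (grZero k A) h
  rw [grZero_symb, grZero_symb, if_pos rfl, if_pos rfl] at this
  exact Subtype.ext this

end GrZero

/-- Degrees add, and m + n = 0 only if m = n = 0; so components of positive degree never contribute
to degree zero. -/
theorem grZero_mul {k A : Type*} [Field k] [Ring A] [Bialgebra k A] {D : BialgOps k (Gr k A)}
    (hD : IsInducedOnGr k A D) (x y : Gr k A) :
    grZero k A (D.mul (x ⊗ₜ y)) = grZero k A x * grZero k A y := by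
  induction x using symb_induction with
  | zero => simp
  | add x y hx hy => simp only [map_add, add_tmul, add_mul, hx, hy]
  | symb m a =>
  induction y using symb_induction with
  | zero => simp
  | add x y hx hy => simp only [map_add, tmul_add, mul_add, hx, hy]
  | symb n b =>
    obtain ⟨h, h'⟩ := hD.mul m n a b
    rw [h', grZero_symb, grZero_symb, grZero_symb]
    by_cases hm : m = 0 <;> by_cases hn : n = 0 <;> simp [hm, hn]

variable {k H M M' : Type*} [Field k] [Ring H] [HopfAlgebra k H] [AddCommGroup M] [Module k M]
  [AddCommGroup M'] [Module k M'] {V : YDModule k H M} {V' : YDModule k H M'}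

theorem YDModule.bosonization_mul_one_tmul (V : YDModule k H M) (g h : H) :
    V.bosonization.mul ((1 ⊗ₜ g) ⊗ₜ (1 ⊗ₜ h)) = 1 ⊗ₜ (g * h) := by
  have h1 : ∀ h, (1 : V.Nichols) ⊗ₜ h = V.smashProj (Smash.inr V h) := fun h => by
    rw [Smash.inr_apply, smashProj_mk, map_one]
  rw [h1, h1, h1, ← smashProj_mul, ← map_mul]

theorem YDModule.bosonization_comul_one_tmul (V : YDModule k H M) (h : H) :
    V.bosonization.comul (1 ⊗ₜ h) = TensorProduct.map (TensorProduct.mk k V.Nichols H 1)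
      (TensorProduct.mk k V.Nichols H 1) (Coalgebra.comul (R := k) h) := by
  have h1 : ∀ h, (1 : V.Nichols) ⊗ₜ h = V.smashProj (Smash.inr V h) := fun h => by
    rw [Smash.inr_apply, smashProj_mk, map_one]
  rw [h1, ← map_smashProj_comulHom, Smash.comulHom_inr, Smash.comulInr_apply]
  generalize Coalgebra.comul (R := k) h = t
  induction t with
  | zero => simp
  | add a b ha hb => simp only [map_add, ha, hb]
  | tmul a b => simp [h1]

theorem YDModule.bosonization_counit_one_tmul (V : YDModule k H M) (h : H) :
    V.bosonization.counit (1 ⊗ₜ h) = Coalgebra.counit (R := k) h := by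
  have h1 : (1 : V.Nichols) ⊗ₜ h = V.smashProj (Smash.mk V 1 h) := by
    rw [smashProj_mk, map_one]
  rw [h1, bosonization_counit_smashProj_mk, map_one, one_mul]

/-- The coradical of a lifting embeds into `H`: there are a coalgebra map `p` from the coradical to
`H` and an algebra map `ρ` from `H` to `A` with `ρ (p a) = a`. -/
theorem IsLifting.exists_retraction {A : Type*} [Ring A] [Bialgebra k A] (h : IsLifting V A) :
    ∃ (p : A →ₗ[k] H) (ρ : H →ₗ[k] A), ρ 1 = 1 ∧ (∀ g h, ρ (g * h) = ρ g * ρ h) ∧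
      ∀ a ∈ coradical k A, ρ (p a) = a ∧
        Coalgebra.counit (R := k) (p a) = Coalgebra.counit (R := k) a ∧
        Coalgebra.comul (R := k) (p a) = TensorProduct.map p p (Coalgebra.comul a) := by
  obtain ⟨-, D, hD, φ, hφ⟩ := h
  -- An arbitrary linear extension to `A`, so that `TensorProduct.map f f` applies to Δ(a); only the
  -- values on the coradical matter.
  obtain ⟨f, hf⟩ := LinearMap.exists_extend (φ.toLinearMap ∘ₗ symb k A 0)
  have hf' : ∀ a : coradFil k A 0, f a = φ (symb k A 0 a) := fun a => LinearMap.congr_fun hf a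
  let ε' : V.Nichols ⊗[k] H →ₗ[k] H :=
    (TensorProduct.lid k H).toLinearMap ∘ₗ V.nicholsCounit.rTensor H
  have hε' : ∀ h : H, ε' (1 ⊗ₜ h) = h := by
    intro h
    have : V.nicholsCounit 1 = 1 := by
      rw [← map_one V.proj, YDModule.nicholsCounit_proj, map_one]
    simp [ε', this]
  let ρ : H →ₗ[k] A := grZero k A ∘ₗ φ.symm.toLinearMap ∘ₗ TensorProduct.mk k _ H 1
  have hφmul : ∀ x y, φ (D.mul (x ⊗ₜ y)) = V.bosonization.mul (φ x ⊗ₜ φ y) :=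
    fun x y => LinearMap.congr_fun hφ.map_mul (x ⊗ₜ y)
  have hcomul : ∀ a ∈ coradical k A,
      V.bosonization.comul (f a) = TensorProduct.map f f (Coalgebra.comul a) := by
    intro a ha
    obtain ⟨t, ht, ht'⟩ := hD.comul 0 ⟨a, ha⟩
    rw [Finset.Nat.antidiagonal_zero, Finset.sum_singleton] at ht ht'
    have h1 := LinearMap.congr_fun hφ.map_comul (symb k A 0 ⟨a, ha⟩)
    simp only [LinearMap.comp_apply, LinearEquiv.coe_coe] at h1
    rw [show f a = _ from hf' ⟨a, ha⟩, ← h1, ht', ht, TensorProduct.mapIncl,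
      ← LinearMap.comp_apply, ← LinearMap.comp_apply, ← TensorProduct.map_comp,
      ← TensorProduct.map_comp, hf]
  -- The isomorphism φ is not assumed to be graded. Instead f is injective and comultiplicative on
  -- each simple subcoalgebra, hence sends it into 1 ⊗ H, and so sends their sum there.
  have hfp : ∀ a ∈ coradical k A, f a = 1 ⊗ₜ ε' (f a) := by
    have key : ∀ a ∈ coradical k A, ∃ h : H, f a = 1 ⊗ₜ h := by
      intro a ha
      have hle : coradical k A ≤ (LinearMap.range (TensorProduct.mk k V.Nichols H 1)).comap f := by
        refine sSup_le fun C hC c hc => ?_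
        have hC' : C ≤ coradical k A := le_sSup hC
        have hinj : ∀ c ∈ C, f c = 0 → c = 0 := by
          intro c hc h0
          rw [show f c = _ from hf' ⟨c, hC' hc⟩] at h0
          exact congrArg Subtype.val (symb_zero_injective k A
            ((φ.map_eq_zero_iff.1 h0).trans (map_zero _).symm))
        obtain ⟨h, hh⟩ := YDModule.map_mem_bosFil_of_isSimpleSubcoalgebra hC f
          (fun c hc => hcomul c (hC' hc)) hinj hc
        exact ⟨h, hh.symm⟩
      obtain ⟨h, hh⟩ := hle ha
      exact ⟨h, hh.symm⟩
    intro a ha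
    obtain ⟨h, hh⟩ := key a ha
    rw [hh, hε']
  refine ⟨ε' ∘ₗ f, ρ, ?_, ?_, fun a ha => ⟨?_, ?_, ?_⟩⟩
  · obtain ⟨h1, h2⟩ := hD.one
    have : φ.symm (1 ⊗ₜ 1) = D.one := by
      rw [LinearEquiv.symm_apply_eq, hφ.map_one]
      rfl
    simp only [ρ, LinearMap.comp_apply, LinearEquiv.coe_coe, TensorProduct.mk_apply, this, h2,
      grZero_symb, if_true]
  · intro g h
    simp only [ρ, LinearMap.comp_apply, LinearEquiv.coe_coe, TensorProduct.mk_apply]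
    rw [← grZero_mul hD]
    congr 1
    rw [LinearEquiv.symm_apply_eq, hφmul, LinearEquiv.apply_symm_apply,
      LinearEquiv.apply_symm_apply, V.bosonization_mul_one_tmul]
  · simp only [ρ, LinearMap.comp_apply, LinearEquiv.coe_coe, TensorProduct.mk_apply]
    rw [← hfp a ha, show f a = _ from hf' ⟨a, ha⟩, LinearEquiv.symm_apply_apply, grZero_symb,
      if_pos rfl]
  · have h1 := LinearMap.congr_fun hφ.map_counit (symb k A 0 ⟨a, ha⟩)
    simp only [LinearMap.comp_apply, LinearEquiv.coe_coe] at h1 ⊢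
    rw [← V.bosonization_counit_one_tmul, ← hfp a ha, show f a = _ from hf' ⟨a, ha⟩, h1,
      hD.counit, if_pos rfl]
  · rw [TensorProduct.map_comp]
    change Coalgebra.comul (R := k) (ε' (f a)) =
      TensorProduct.map ε' ε' (TensorProduct.map f f (Coalgebra.comul a))
    have h1 : ε' ∘ₗ TensorProduct.mk k V.Nichols H 1 = LinearMap.id := LinearMap.ext hε'
    conv_rhs => rw [← hcomul a ha, hfp a ha, V.bosonization_comul_one_tmul, ← LinearMap.comp_apply,
      ← TensorProduct.map_comp, h1, TensorProduct.map_id, LinearMap.id_apply]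

/-- If `H` has a skew antipode `T`, then the opposite of a lifting over `H` is a Hopf algebra. -/
theorem IsLifting.isHopf_op {A : Type*} [Ring A] [Bialgebra k A] (h : IsLifting V A)
    (T : H →ₗ[k] H)
    (h1 : ∀ h : H, LinearMap.mul' k H (T.rTensor H (TensorProduct.comm k H H
      (Coalgebra.comul (R := k) h))) = algebraMap k H (Coalgebra.counit h))
    (h2 : ∀ h : H, LinearMap.mul' k H (T.lTensor H (TensorProduct.comm k H H
      (Coalgebra.comul (R := k) h))) = algebraMap k H (Coalgebra.counit h)) : IsHopf k (Op A) := by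
  obtain ⟨p, ρ, hρ1, hρmul, hp⟩ := h.exists_retraction
  let o := Op.linearEquiv k A
  have ho : PreservesComul o := fun a => rfl
  have hρalg : ∀ c : k, o (ρ (algebraMap k H c)) = algebraMap k (Op A) c := by
    intro c
    rw [Algebra.algebraMap_eq_smul_one, map_smul, hρ1, map_smul, Algebra.algebraMap_eq_smul_one]
    rfl
  -- The candidate antipode on the coradical of A^op is ρ T p. Since ρ p is the identity there, its
  -- products become ρ(p(a₂) T(p(a₁))) and ρ(T(p(a₂)) p(a₁)), to which the skew antipode identities
  -- of H apply.
  have key : ∀ a ∈ coradical k A,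
      LinearMap.mul' k (Op A) ((o.toLinearMap ∘ₗ (ρ ∘ₗ T ∘ₗ p) ∘ₗ o.symm.toLinearMap).rTensor (Op A)
        (TensorProduct.map o.toLinearMap o.toLinearMap (Coalgebra.comul a))) =
        o (ρ (LinearMap.mul' k H (T.lTensor H (TensorProduct.comm k H H
          (TensorProduct.map p p (Coalgebra.comul (R := k) a)))))) ∧
      LinearMap.mul' k (Op A) ((o.toLinearMap ∘ₗ (ρ ∘ₗ T ∘ₗ p) ∘ₗ o.symm.toLinearMap).lTensor (Op A)
        (TensorProduct.map o.toLinearMap o.toLinearMap (Coalgebra.comul a))) =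
        o (ρ (LinearMap.mul' k H (T.rTensor H (TensorProduct.comm k H H
          (TensorProduct.map p p (Coalgebra.comul (R := k) a)))))) := by
    intro a ha
    obtain ⟨t, ht⟩ := coradical_isSubcoalgebra k A a ha
    rw [← ht]
    clear ht
    induction t with
    | zero => simp
    | add x y hx hy => simp only [map_add, hx, hy, and_self]
    | tmul x y =>
      simp [TensorProduct.mapIncl, hρmul, (hp _ x.2).1, (hp _ y.2).1, ← Op.linearEquiv_mul, o]
  refine isHopf_of_coradical (o.toLinearMap ∘ₗ (ρ ∘ₗ T ∘ₗ p) ∘ₗ o.symm.toLinearMap) ?_ ?_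
  · intro b hb
    obtain ⟨a, rfl⟩ := o.surjective b
    have ha : a ∈ coradical k A := by simpa using ho.symm.coradical_mem hb
    rw [ho a, (key a ha).1, ← (hp a ha).2.2, h2, hρalg, (hp a ha).2.1]
    rfl
  · intro b hb
    obtain ⟨a, rfl⟩ := o.surjective b
    have ha : a ∈ coradical k A := by simpa using ho.symm.coradical_mem hb
    rw [ho a, (key a ha).2, ← (hp a ha).2.2, h1, hρalg, (hp a ha).2.1]
    rfl

/-! ### Opposites and co-opposites of liftings along a twist -/

namespace YDModule.OpTwist

variable {e : M' ≃ₗ[k] M} {σ τ : H →ₗ[k] H} (D : OpTwist V V' e σ τ)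
  {A : Type*} [Ring A] [Bialgebra k A]

include D

/-- Evaluating `τ_σ` and `σ_τ` at σ(h), with σ an involution, shows that τσ is a skew antipode of H.
-/
theorem isHopf_op (h : IsLifting V A) : IsHopf k (Op A) := by
  refine h.isHopf_op (τ ∘ₗ σ) (fun h => ?_) (fun h => ?_)
  · have h1 := D.τ_σ (σ h)
    rw [D.comul_σ, D.counit_σ] at h1
    rw [← h1]
    generalize Coalgebra.comul (R := k) h = t
    induction t with
    | zero => simp
    | add x y hx hy => simp only [map_add, hx, hy]
    | tmul x y => simp [D.σ_σ]
  · have h1 := D.σ_τ (σ h)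
    rw [D.comul_σ, D.counit_σ] at h1
    rw [← h1]
    generalize Coalgebra.comul (R := k) h = t
    induction t with
    | zero => simp
    | add x y hx hy => simp only [map_add, hx, hy]
    | tmul x y => simp [D.σ_σ]

theorem isLifting_op (h : IsLifting V A) : IsLifting V' (Op A) :=
  IsLifting.op D.symm.isIso_flipEquiv h (D.isHopf_op h)

/-- The antipode identifies A^cop with A^op, so no separate analysis of gr(A^cop) is needed. -/
theorem isLifting_cop (h : IsLifting V A) : IsLifting V' (Cop A) := by
  obtain ⟨i⟩ := nonempty_cop_equiv_op h.1 (D.isHopf_op h)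
  exact IsLifting.of_equiv i.symm (D.isLifting_op h)

end YDModule.OpTwist
end HopfLift
namespace HopfLift

/-! ### The functors `A ↦ A^cop` and `A ↦ A^op` -/

section Functors

variable {k A B : Type*} [Field k] [Ring A] [Bialgebra k A] [Ring B] [Bialgebra k B]

/-- An isomorphism `A ≃ B` is an isomorphism `A^cop ≃ B^cop`. -/
def Cop.map (e : A ≃ₐc[k] B) : Cop A ≃ₐc[k] Cop B :=
  BialgEquiv.ofAlgEquiv ((Cop.equiv k A).symm.trans ((e : A ≃ₐ[k] B).trans (Cop.equiv k B)))
    (by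
      apply AlgHom.ext
      exact fun a => CoalgHomClass.counit_comp_apply e ((Cop.equiv k A).symm a))
    (by
      apply AlgHom.toLinearMap_injective
      apply LinearMap.ext
      intro a
      have h : ∀ t : A ⊗[k] A, TensorProduct.map
          ((Cop.equiv k A).symm.trans ((e : A ≃ₐ[k] B).trans (Cop.equiv k B))).toLinearMap
          ((Cop.equiv k A).symm.trans ((e : A ≃ₐ[k] B).trans (Cop.equiv k B))).toLinearMap
          (TensorProduct.map (Cop.equiv k A).toLinearMap (Cop.equiv k A).toLinearMap
            (TensorProduct.comm k A A t)) =
          TensorProduct.map (Cop.equiv k B).toLinearMap (Cop.equiv k B).toLinearMap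
            (TensorProduct.comm k B B
              (TensorProduct.map (e : A →ₗ[k] B) (e : A →ₗ[k] B) t)) := by
        intro t
        induction t with
        | zero => simp
        | add x y hx hy => simp only [map_add, hx, hy]
        | tmul x y => simp
      refine (h (Coalgebra.comul (R := k) (A := A) a)).trans ?_
      have h2 := CoalgHomClass.map_comp_comul_apply e ((Cop.equiv k A).symm a)
      exact congrArg (fun t => TensorProduct.map (Cop.equiv k B).toLinearMap
        (Cop.equiv k B).toLinearMap (TensorProduct.comm k B B t)) h2)

/-- The bialgebra `(A^cop)^cop` is `A`. -/
def Cop.cop : Cop (Cop A) ≃ₐc[k] A :=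
  BialgEquiv.ofAlgEquiv ((Cop.equiv k (Cop A)).symm.trans (Cop.equiv k A).symm) rfl
    (by
      apply AlgHom.toLinearMap_injective
      apply LinearMap.ext
      intro a
      have h : ∀ t : A ⊗[k] A, TensorProduct.map
          ((Cop.equiv k (Cop A)).symm.trans (Cop.equiv k A).symm).toLinearMap
          ((Cop.equiv k (Cop A)).symm.trans (Cop.equiv k A).symm).toLinearMap
          (TensorProduct.map (Cop.equiv k (Cop A)).toLinearMap (Cop.equiv k (Cop A)).toLinearMap
            (TensorProduct.comm k (Cop A) (Cop A)
              (TensorProduct.map (Cop.equiv k A).toLinearMap (Cop.equiv k A).toLinearMap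
                (TensorProduct.comm k A A t)))) = t := by
        intro t
        induction t with
        | zero => simp
        | add x y hx hy => simp only [map_add, hx, hy]
        | tmul x y => simp
      exact h (Coalgebra.comul (R := k) (A := A) a))

/-- An isomorphism `A ≃ B` is an isomorphism `A^op ≃ B^op`. -/
def Op.map (e : A ≃ₐc[k] B) : Op A ≃ₐc[k] Op B :=
  BialgEquiv.ofAlgEquiv (AlgEquiv.ofLinearEquiv ((Op.linearEquiv k A).symm.trans
      ((e : A ≃ₐ[k] B).toLinearEquiv.trans (Op.linearEquiv k B)))
      (map_one e) (fun a b => map_mul e ((Op.linearEquiv k A).symm b) ((Op.linearEquiv k A).symm a)))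
    (by
      apply AlgHom.ext
      exact fun a => CoalgHomClass.counit_comp_apply e ((Op.linearEquiv k A).symm a))
    (by
      apply AlgHom.toLinearMap_injective
      apply LinearMap.ext
      intro a
      have h2 := CoalgHomClass.map_comp_comul_apply e ((Op.linearEquiv k A).symm a)
      refine Eq.trans ?_ (congrArg (TensorProduct.map (Op.linearEquiv k B).toLinearMap
        (Op.linearEquiv k B).toLinearMap) h2)
      change TensorProduct.map _ _ (TensorProduct.map (Op.linearEquiv k A).toLinearMap
        (Op.linearEquiv k A).toLinearMap (Coalgebra.comul (R := k) (A := A) a)) = _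
      rw [← LinearMap.comp_apply, ← LinearMap.comp_apply, ← TensorProduct.map_comp,
        ← TensorProduct.map_comp]
      rfl)

/-- The bialgebra `(A^op)^op` is `A`. -/
def Op.op : Op (Op A) ≃ₐc[k] A :=
  BialgEquiv.ofAlgEquiv (AlgEquiv.ofLinearEquiv
      ((Op.linearEquiv k (Op A)).symm.trans (Op.linearEquiv k A).symm) rfl (fun _ _ => rfl)) rfl
    (by
      apply AlgHom.toLinearMap_injective
      apply LinearMap.ext
      intro a
      change TensorProduct.map _ _ (TensorProduct.map (Op.linearEquiv k (Op A)).toLinearMap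
        (Op.linearEquiv k (Op A)).toLinearMap (TensorProduct.map (Op.linearEquiv k A).toLinearMap
        (Op.linearEquiv k A).toLinearMap (Coalgebra.comul (R := k) (A := A) a))) = _
      rw [← LinearMap.comp_apply, ← LinearMap.comp_apply, ← TensorProduct.map_comp,
        ← TensorProduct.map_comp]
      exact LinearMap.congr_fun TensorProduct.map_id (Coalgebra.comul (R := k) (A := A) a))

end Functors

/-- Two bialgebra structures on the same set are equal if the identity is an isomorphism. -/
theorem bialgCat_eq_of_equiv {k : Type u} [Field k] {A : Type v} (r₁ r₂ : Ring A)
    (b₁ : @Bialgebra k A _ r₁.toSemiring) (b₂ : @Bialgebra k A _ r₂.toSemiring)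
    (e : (@BialgCat.of k _ A r₁ b₁) ≃ₐc[k] (@BialgCat.of k _ A r₂ b₂))
    (he : ∀ a : A, e a = a) : @BialgCat.of k _ A r₁ b₁ = @BialgCat.of k _ A r₂ b₂ := by
  let X : BialgCat k := @BialgCat.of k _ A r₁ b₁
  have hr : r₁ = r₂ := by
    apply Ring.ext
    · funext a b
      have := map_add e (show X from a) (show X from b)
      exact (he _).symm.trans (this.trans (congrArg₂ (fun a b => r₂.add a b) (he a) (he b)))
    · funext a b
      have := map_mul e (show X from a) (show X from b)
      exact (he _).symm.trans (this.trans (congrArg₂ (fun a b => r₂.mul a b) (he a) (he b)))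
  subst hr
  obtain @⟨i₁, c₁, _, _, _, _⟩ := b₁
  obtain @⟨i₂, c₂, _, _, _, _⟩ := b₂
  obtain rfl : i₁ = i₂ :=
    Algebra.algebra_ext _ _ fun c => (he _).symm.trans (AlgHomClass.commutes e c)
  let f : A →ₗ[k] A := { toFun := e, map_add' := map_add e, map_smul' := map_smul e }
  have hf : f = LinearMap.id := LinearMap.ext he
  have hε : c₂.counit = c₁.counit := LinearMap.ext fun a =>
    (congrArg c₂.counit (he a).symm).trans (CoalgHomClass.counit_comp_apply e (show X from a))
  have hΔ : c₂.comul = c₁.comul := by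
    apply LinearMap.ext
    intro a
    have h : TensorProduct.map f f (c₁.comul a) = c₂.comul (f a) :=
      CoalgHomClass.map_comp_comul_apply e (show X from a)
    rw [hf, TensorProduct.map_id] at h
    exact h.symm
  have hc : c₁ = c₂ := by
    obtain @⟨@⟨_, _⟩, _, _, _⟩ := c₁
    obtain @⟨@⟨_, _⟩, _, _, _⟩ := c₂
    obtain rfl := hε
    obtain rfl := hΔ
    rfl
  subst hc
  rfl

/-- An equality of objects, not just an isomorphism: it makes `cop` an involution on the class of
bialgebras, which gives injectivity and explicit preimages. -/
theorem cop_cop {k : Type u} [Field k] (A : BialgCat.{v} k) : cop (cop A) = A :=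
  bialgCat_eq_of_equiv _ A.instRing _ A.instBialgebra (Cop.cop (k := k) (A := A)) (fun _ => rfl)

theorem op_op {k : Type u} [Field k] (A : BialgCat.{v} k) : op (op A) = A :=
  bialgCat_eq_of_equiv _ A.instRing _ A.instBialgebra (Op.op (k := k) (A := A)) (fun _ => rfl)

/-- The converse is functoriality applied once more, followed by `cop_cop`. -/
theorem nonempty_equiv_iff_cop {k : Type u} [Field k] (A B : BialgCat.{v} k) :
    Nonempty (A ≃ₐc[k] B) ↔ Nonempty (cop A ≃ₐc[k] cop B) := by
  refine ⟨fun ⟨e⟩ => ⟨Cop.map (A := A) (B := B) e⟩, fun ⟨e⟩ => ?_⟩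
  have h : Nonempty (cop (cop A) ≃ₐc[k] cop (cop B)) :=
    ⟨Cop.map (A := Cop A) (B := Cop B) e⟩
  rwa [cop_cop, cop_cop] at h

theorem nonempty_equiv_iff_op {k : Type u} [Field k] (A B : BialgCat.{v} k) :
    Nonempty (A ≃ₐc[k] B) ↔ Nonempty (op A ≃ₐc[k] op B) := by
  refine ⟨fun ⟨e⟩ => ⟨Op.map (A := A) (B := B) e⟩, fun ⟨e⟩ => ?_⟩
  have h : Nonempty (op (op A) ≃ₐc[k] op (op B)) :=
    ⟨Op.map (A := Op A) (B := Op B) e⟩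
  rwa [op_op, op_op] at h

/-! ### The Yetter-Drinfeld modules of a realization and of its dual -/

namespace YDModule

variable {k H M M' : Type*} [Field k] [Ring H] [HopfAlgebra k H] [AddCommGroup M] [Module k M]
  [AddCommGroup M'] [Module k M'] {V : YDModule k H M} {V' : YDModule k H M'}

open HopfAlgebra

/-- For cocommutative H an antipode is also a skew antipode, so it is an involution, and it
preserves coproducts. It can thus serve as σ, changing the coaction only. -/
theorem OpTwist.of_cocommutative (e : M' ≃ₗ[k] M)
    (hH : ∀ h : H, TensorProduct.comm k H H (Coalgebra.comul h) = Coalgebra.comul (R := k) h)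
    (coact : ∀ m, V.coact (e m) = TensorProduct.map (antipode k) e.toLinearMap (V'.coact m))
    (act : ∀ h m, V.act h (e m) = e (V'.act h m)) :
    OpTwist V V' e (antipode k) LinearMap.id where
  σ_σ := antipode_apply_of_skew (antipode k) fun h => by
    rw [hH, mul_antipode_rTensor_comul_apply]
  τ_τ _ := rfl
  σ_one := antipode_one
  σ_mul := antipode_mul_antidistrib
  counit_σ := counit_antipode
  comul_σ h := by rw [comul_antipode, hH]
  counit_τ _ := rfl
  comul_τ h := by rw [hH, TensorProduct.map_id]; rfl
  σ_τ h := by rw [hH]; exact mul_antipode_rTensor_comul_apply h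
  τ_σ h := by rw [hH]; exact mul_antipode_lTensor_comul_apply h
  coact := coact
  act := act

/-- For commutative H the identity is antimultiplicative and can serve as σ. The antipode is an
involution reversing coproducts and serves as τ, changing the action only. -/
theorem OpTwist.of_commutative (e : M' ≃ₗ[k] M) (hH : ∀ g h : H, g * h = h * g)
    (coact : ∀ m, V.coact (e m) = TensorProduct.map LinearMap.id e.toLinearMap (V'.coact m))
    (act : ∀ h m, V.act (antipode k h) (e m) = e (V'.act h m)) :
    OpTwist V V' e LinearMap.id (antipode k) := by
  have h1 : ∀ h : H, LinearMap.mul' k H (TensorProduct.map LinearMap.id (antipode k)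
      (TensorProduct.comm k H H (Coalgebra.comul h))) = algebraMap k H (Coalgebra.counit h) := by
    intro h
    rw [← mul_antipode_rTensor_comul_apply]
    generalize Coalgebra.comul (R := k) h = t
    induction t with
    | zero => simp
    | add x y hx hy => simp only [map_add, hx, hy]
    | tmul x y => simp [hH y]
  have h2 : ∀ h : H, LinearMap.mul' k H (TensorProduct.map (antipode k) LinearMap.id
      (TensorProduct.comm k H H (Coalgebra.comul h))) = algebraMap k H (Coalgebra.counit h) := by
    intro h
    rw [← mul_antipode_lTensor_comul_apply]
    generalize Coalgebra.comul (R := k) h = t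
    induction t with
    | zero => simp
    | add x y hx hy => simp only [map_add, hx, hy]
    | tmul x y => simp [hH x]
  exact
  { σ_σ := fun _ => rfl
    τ_τ := antipode_apply_of_skew (antipode k) h2
    σ_one := rfl
    σ_mul := hH
    counit_σ := fun _ => rfl
    comul_σ := fun h => by rw [TensorProduct.map_id]; rfl
    counit_τ := counit_antipode
    comul_τ := comul_antipode
    σ_τ := h1
    τ_σ := h2
    coact := coact
    act := act }

end YDModule

namespace Realization

variable {k X G : Type*} [Field k] [Rack X] [Group G] {q : X → X → kˣ} (R : Realization q G)

/-- The linear isomorphism `x_i ↦ x_i`. -/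
def dualEquiv (k X : Type*) [Field k] : (Xᵐᵒᵖ →₀ k) ≃ₗ[k] (X →₀ k) :=
  Finsupp.domLCongr MulOpposite.opEquiv.symm

omit [Rack X] in
theorem dualEquiv_single (i : Xᵐᵒᵖ) (c : k) :
    dualEquiv k X (Finsupp.single i c) = Finsupp.single i.unop c :=
  Finsupp.domLCongr_single _ _ _

/-- The dual realization keeps χ and the permutation action and replaces g_i by g_i⁻¹, which is its
image under the antipode of kG. -/
theorem opTwist_V : YDModule.OpTwist R.V R.dual.V (dualEquiv k X)
    (HopfAlgebra.antipode k) LinearMap.id := by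
  refine YDModule.OpTwist.of_cocommutative _ (fun h => ?_) ?_ ?_
  · exact Coalgebra.comm_comul k h
  · refine fun m => LinearMap.congr_fun (f := R.V.coact ∘ₗ (dualEquiv k X).toLinearMap)
      (g := TensorProduct.map (HopfAlgebra.antipode k) (dualEquiv k X).toLinearMap ∘ₗ
        R.dual.V.coact) ?_ m
    ext i : 2
    simp [V, dual, dualEquiv_single]
  · intro h m
    have : R.V.act.toLinearMap.compl₂ (dualEquiv k X).toLinearMap =
        R.dual.V.act.toLinearMap.compr₂ (dualEquiv k X).toLinearMap := by
      ext t i : 4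
      simp [V, dual, dualEquiv_single]
    exact LinearMap.congr_fun (LinearMap.congr_fun this h) m

/-- The coaction involves only χ and the permutation action, so it is unchanged. The scalar f(g_i⁻¹)
becomes f(g_i), that is, f is composed with inversion. -/
theorem opTwist_W [Fintype G] [DecidableEq G] : YDModule.OpTwist R.W R.dual.W (dualEquiv k X)
    LinearMap.id (HopfAlgebra.antipode k) := by
  refine YDModule.OpTwist.of_commutative _ mul_comm ?_ ?_
  · refine fun m => LinearMap.congr_fun (f := R.W.coact ∘ₗ (dualEquiv k X).toLinearMap)
      (g := TensorProduct.map LinearMap.id (dualEquiv k X).toLinearMap ∘ₗ R.dual.W.coact) ?_ m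
    ext i : 2
    simp [W, wCoact, dual, dualEquiv_single]
  · intro h m
    refine LinearMap.congr_fun (f := R.W.act (HopfAlgebra.antipode k h) ∘ₗ
      (dualEquiv k X).toLinearMap) (g := (dualEquiv k X).toLinearMap ∘ₗ R.dual.W.act h) ?_ m
    ext i : 2
    simp [W, wAct, dual, dualEquiv_single, HopfAlgebra.antipode]

end Realization

end HopfLift
-- The correspondence of liftings
theorem mainTheorem10 {k : Type u} [Field k] [IsAlgClosed k] [CharZero k]
    {G : Type w} [Group G] [Fintype G] [DecidableEq G]
    {X : Type x} [Rack X] [Nonempty X]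
    (q : X → X → kˣ) (hq : HopfLift.IsRackCocycle q)
    (R : HopfLift.Realization q G) (hR : R.IsFaithful) :
    (Set.BijOn HopfLift.cop (HopfLift.liftings.{v} R.V) (HopfLift.liftings.{v} R.dual.V) ∧
      ∀ A B : BialgCat.{v} k,
        Nonempty (A ≃ₐc[k] B) ↔ Nonempty (HopfLift.cop A ≃ₐc[k] HopfLift.cop B)) ∧
    (Set.BijOn HopfLift.op (HopfLift.liftings.{v} R.W) (HopfLift.liftings.{v} R.dual.W) ∧
      ∀ A B : BialgCat.{v} k,
        Nonempty (A ≃ₐc[k] B) ↔ Nonempty (HopfLift.op A ≃ₐc[k] HopfLift.op B)) := by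
  refine ⟨⟨⟨?_, ?_, ?_⟩, HopfLift.nonempty_equiv_iff_cop⟩, ⟨⟨?_, ?_, ?_⟩,
    HopfLift.nonempty_equiv_iff_op⟩⟩
  · exact fun A hA => R.opTwist_V.isLifting_cop (A := A) hA
  · intro A _ B _ h
    rw [← HopfLift.cop_cop A, h, HopfLift.cop_cop]
  -- The preimage of B is its own co-opposite. The symmetric twist leads from the dual realization
  -- back to the original one, so the double dual never has to be identified with it.
  · exact fun B hB => ⟨HopfLift.cop B, R.opTwist_V.symm.isLifting_cop (A := B) hB, HopfLift.cop_cop B⟩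
  · exact fun A hA => R.opTwist_W.isLifting_op (A := A) hA
  · intro A _ B _ h
    rw [← HopfLift.op_op A, h, HopfLift.op_op]
  · exact fun B hB => ⟨HopfLift.op B, R.opTwist_W.symm.isLifting_op (A := B) hB, HopfLift.op_op B⟩
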